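/- Let $p\ge 3$ be odd, let $0\le L<p$ be even, let $0<t_1<t_0$ and $\eta_0>0$. Let $S\in\mathcal C^\infty([-t_0,t_0]\times\mathbb R)$ and $P\in\mathcal C^\infty([-t_0,t_0]\times\mathbb R\times\mathbb R\times[0,\eta_0))$ be real functions ($P$ need not be linear in its second variable), such that $S(t,0)=0$ for all $t$ and $\partial_t^i\partial_\alpha^jS(0,0)=0$ whenever $i+(p-L+1)j\le p+1$. Consider the equation $$\eta^{p+2}\dot u=(p+1)\eta t^pu+\eta^{p-L+1}\alpha t^L+S(t,\eta^{p-L+1}\alpha)+\eta^{p+1}P(t,\eta u,\eta^{p-L+1}\alpha,\eta).\qquad(2)$$ A canard solution of (2) is a family $(\alpha_\eta,u_\eta)$ such that, for all small $\eta>0$, $\alpha_\eta\in\mathbb R$, $u_\eta$ solves (2) on $[-t_0,t_0]$ with $\alpha=\alpha_\eta$, $u_\eta(-t_0)=0=u_\eta(t_0)$, and $\alpha_\eta$ and $\sup_{[-t_0,t_0]}|u_\eta|$ are bounded as $\eta\to0^+$. For $\eta>0$ put $$\mathcal I_\eta(v)(t)=-e^{(t/\eta)^{p+1}}\int_t^{+\infty}\Big(v(y)-\frac{\int_{\mathbb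 R}v(z)e^{-(z/\eta)^{p+1}}dz}{\int_{\mathbb R}z^Le^{-(z/\eta)^{p+1}}dz}\,y^L\Big)e^{-(y/\eta)^{p+1}}dy ,$$ and let $\psi_k=\mathcal I_1(X^k)$, so that $\mathcal I_\eta(X^k)(t)=\eta^{k+1}\psi_k(t/\eta)$. Let $\mathcal F$ be the smallest family of functions of $(t,\eta)$, each carrying an order, that contains $1$ (order $0$) and is closed under multiplication by $t$ and by $\eta$ (order $+1$), multiplication by $\psi_k(t/\eta)$ for $0\le k\le p-1$ (same order), products (orders add) and $\mathcal I_\eta$ (order $+1$). An element of order $d$ has the form $\eta^d\Phi(t/\eta)$. If a function $\rho$ has, as $T\to+\infty$ and as $T\to-\infty$, one and the same asymptotic expansion $\sum_{n=0}^Nq_nT^n+\sum_{m\ge1}c_mT^{-m}$, let $[\rho](T)=\rho(T)-\sum_{n=0}^Nq_nT^n$. Let $\mathcal B_k$ be the set of the monomials $[\Phi(T)]\eta^k$ with $\eta^k\Phi(t/\eta)\in\mathcal F$ of order $k$. Let $\mathcal C_k=\mathbb R\eta^k\times\big(\mathcal C^\infty([-t_1,t_1])\eta^k\oplus\mathrm{Vect}\,\mathcal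 B_k\big)$ and $\mathcal A_k=\bigoplus_{l\le k}\mathcal C_l$ (formal direct sums, the elements of $\mathcal B_k$ being formal symbols), and let $\hat{\mathcal A}$ be the projective limit of $(\mathcal A_k)_k$ under the natural projections $\mathcal A_{k+1}\to\mathcal A_k$. Then every canard solution $(\alpha_\eta,u_\eta)$ of (2) has at least one semi-asymptotic expansion in $\hat{\mathcal A}$: there are elements $\big(a_n\eta^n,\,(u_n+\sum_jr_{n,j}[\Phi_{n,j}])\eta^n\big)\in\mathcal C_n$, $n\in\mathbb N$ (the sums over $j$ being finite), such that for every $k\in\mathbb N$, as $\eta\to0^+$, $$\Big|\alpha_\eta-\sum_{n=0}^ka_n\eta^n\Big|=\mathcal O(\eta^{k+1}),\qquad \sup_{t\in[-t_1,t_1]}\Big|u_\eta(t)-\sum_{n=0}^k\Big(u_n(t)+\sum_jr_{n,j}[\Phi_{n,j}]\big(\tfrac t\eta\big)\Big)\eta^n\Big|=\mathcal O(\eta^{k+1}).$$ -/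

import Mathlib

open Set Filter Topology MeasureTheory Asymptotics
open scoped ContDiff

noncomputable section

namespace Canard

/-- The operator `I_η`:
`I_η(v)(t) = e^{(t/η)^{p+1}} ∫_{+∞}^t (v(y) - c y^L) e^{-(y/η)^{p+1}} dy`, where
`c = ∫_ℝ v(z) e^{-(z/η)^{p+1}} dz / ∫_ℝ z^L e^{-(z/η)^{p+1}} dz`. -/
def canardOp (p L : ℕ) (η : ℝ) (v : ℝ → ℝ) (t : ℝ) : ℝ :=
  -Real.exp ((t / η) ^ (p + 1)) *
    ∫ y in Ioi t,
      (v y - (∫ z, v z * Real.exp (-(z / η) ^ (p + 1))) /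
          (∫ z, z ^ L * Real.exp (-(z / η) ^ (p + 1))) * y ^ L) *
        Real.exp (-(y / η) ^ (p + 1))

/-- Homogeneity of `I_η` in the stretched variable `T = t / η`:
`I_η(η^d Φ(X/η)) = η^{d+1} I_1(Φ)(T)`. -/
theorem canardOp_scaling (p L d : ℕ) {η : ℝ} (hη : 0 < η) (Φ : ℝ → ℝ) (t : ℝ) :
    canardOp p L η (fun y => η ^ d * Φ (y / η)) t
      = η ^ (d + 1) * canardOp p L 1 Φ (t / η) := by
  have h1 : (∫ z, η ^ d * Φ (z / η) * Real.exp (-(z / η) ^ (p + 1)))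
      = η ^ (d + 1) * ∫ z, Φ z * Real.exp (-z ^ (p + 1)) := by
    have := Measure.integral_comp_div (fun z => η ^ d * Φ z * Real.exp (-z ^ (p + 1))) η
    rw [this, abs_of_pos hη]
    simp only [mul_assoc, integral_const_mul, smul_eq_mul]
    ring
  have h2 : (∫ z, z ^ L * Real.exp (-(z / η) ^ (p + 1)))
      = η ^ (L + 1) * ∫ z, z ^ L * Real.exp (-z ^ (p + 1)) := by
    have := Measure.integral_comp_div (fun z => η ^ L * z ^ L * Real.exp (-z ^ (p + 1))) η
    rw [abs_of_pos hη] at this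
    simp only [mul_assoc, integral_const_mul, smul_eq_mul] at this
    rw [pow_succ', mul_assoc, ← this, ← integral_const_mul]
    refine integral_congr_ae (Eventually.of_forall fun z => ?_)
    simp only [div_pow]
    field_simp
  unfold canardOp
  rw [h1, h2]
  simp only [div_one]
  set A := ∫ z, Φ z * Real.exp (-z ^ (p + 1))
  set B := ∫ z, z ^ L * Real.exp (-z ^ (p + 1))
  have h3 := integral_comp_mul_left_Ioi (E := ℝ)
    (fun y => (Φ y - A / B * y ^ L) * Real.exp (-y ^ (p + 1))) t (inv_pos.2 hη)
  rw [inv_inv, smul_eq_mul, inv_mul_eq_div] at h3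
  have h4 : (∫ y in Ioi t, (η ^ d * Φ (y / η) - η ^ (d + 1) * A / (η ^ (L + 1) * B) * y ^ L) *
        Real.exp (-(y / η) ^ (p + 1)))
      = η ^ d * ∫ y in Ioi t, (Φ (η⁻¹ * y) - A / B * (η⁻¹ * y) ^ L) *
          Real.exp (-(η⁻¹ * y) ^ (p + 1)) := by
    rw [← integral_const_mul (η ^ d)]
    congr 1
    ext y
    have : η ^ (d + 1) * A / (η ^ (L + 1) * B) * y ^ L = η ^ d * (A / B * (y / η) ^ L) := by
      rw [div_pow, mul_div_mul_comm, pow_succ, pow_succ]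
      field_simp
    rw [this, inv_mul_eq_div]
    ring
  rw [h4, h3]
  ring

/-- The functions `ψ_k`, for which `I_η(X^k)(t) = η^{k+1} ψ_k(t/η)`. -/
def psi (p L k : ℕ) : ℝ → ℝ := canardOp p L 1 (fun y => y ^ k)

/-- The intermediary functions, written in the stretched variable `T = t / η`:
`Intermediary p L d Φ` says that `(t, η) ↦ η^d Φ(t/η)` is an intermediary function, of order `d`.
They are obtained from `1` by multiplication by `t = η T`, by `η`, by
`ψ_k(t/η) = η^{-(k+1)} I_η(X^k)(t)` with `0 ≤ k ≤ p - 1`, by products, and by application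
of `I_η`, which raises the order by one. -/
inductive Intermediary (p L : ℕ) : ℕ → (ℝ → ℝ) → Prop
  | one : Intermediary p L 0 (fun _ => 1)
  | mul_t {d : ℕ} {Φ : ℝ → ℝ} :
      Intermediary p L d Φ → Intermediary p L (d + 1) (fun T => T * Φ T)
  | mul_eta {d : ℕ} {Φ : ℝ → ℝ} :
      Intermediary p L d Φ → Intermediary p L (d + 1) Φ
  | mul_psi {d : ℕ} {Φ : ℝ → ℝ} (k : ℕ) (hk : k < p) :
      Intermediary p L d Φ → Intermediary p L d (fun T => psi p L k T * Φ T)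
  | mul {d e : ℕ} {Φ Θ : ℝ → ℝ} :
      Intermediary p L d Φ → Intermediary p L e Θ →
        Intermediary p L (d + e) (fun T => Φ T * Θ T)
  | comp {d : ℕ} {Φ : ℝ → ℝ} :
      Intermediary p L d Φ → Intermediary p L (d + 1) (canardOp p L 1 Φ)

/-- `φ(T) ~ ∑_{m ≥ 1} c_m T^{-m}` as `T → -∞` and as `T → +∞`, with the same coefficients. -/
def HasNegativePowerExpansion (φ : ℝ → ℝ) : Prop :=
  ∃ c : ℕ → ℝ, ∀ N : ℕ,
    (fun T : ℝ => φ T - ∑ m ∈ Finset.Icc 1 N, c m * (T⁻¹) ^ m)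
      =O[atBot ⊔ atTop] fun T : ℝ => (T⁻¹) ^ (N + 1)

/-- `φ = [ρ]`: the function `ρ` has an asymptotic expansion
`∑_{n=0}^N q_n T^n + ∑_{m ≥ 1} c_m T^{-m}` at `±∞`, and `φ` is `ρ` minus its polynomial part. -/
def IsBracket (ρ φ : ℝ → ℝ) : Prop :=
  HasNegativePowerExpansion φ ∧ ∃ q : Polynomial ℝ, ∀ T, φ T = ρ T - q.eval T

/-- The set of the monomials `[Φ(T)] η^k` of order `k`, each given by its function `[Φ]` of `T`. -/
def B (p L k : ℕ) : Set (ℝ → ℝ) :=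
  {φ | ∃ Φ : ℝ → ℝ, Intermediary p L k Φ ∧ IsBracket Φ φ}

/-- The real vector space `C^∞([-t₁, t₁])`. -/
def Smooth (t₁ : ℝ) : Submodule ℝ (Icc (-t₁) t₁ → ℝ) where
  carrier := {f | ∃ g : ℝ → ℝ, ContDiffOn ℝ ∞ g (Icc (-t₁) t₁) ∧ ∀ t, f t = g t}
  add_mem' := by
    rintro f₁ f₂ ⟨g₁, h₁, e₁⟩ ⟨g₂, h₂, e₂⟩
    exact ⟨fun t => g₁ t + g₂ t, h₁.add h₂, fun t => by simp [e₁, e₂]⟩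
  zero_mem' := ⟨fun _ => 0, contDiffOn_const, fun _ => rfl⟩
  smul_mem' := by
    rintro a f ⟨g, h, e⟩
    exact ⟨fun t => a * g t, contDiffOn_const.mul h, fun t => by simp [e]⟩

/-- The formal space `C_k = ℝ η^k × (C^∞([-t₁, t₁]) η^k ⊕ Vect B_k)`. -/
abbrev C (p L : ℕ) (t₁ : ℝ) (k : ℕ) : Type :=
  ℝ × (Smooth t₁ × (B p L k →₀ ℝ))

/-- The formal space `A_k = ⨁_{l ≤ k} C_l`. -/
abbrev A (p L : ℕ) (t₁ : ℝ) (k : ℕ) : Type :=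
  ∀ l : Fin (k + 1), C p L t₁ l

/-- The natural projection `π_k : A_{k+1} → A_k`. -/
def proj (p L : ℕ) (t₁ : ℝ) (k : ℕ) : A p L t₁ (k + 1) →ₗ[ℝ] A p L t₁ k where
  toFun c l := c l.castSucc
  map_add' _ _ := rfl
  map_smul' _ _ := rfl

/-- The projective limit of the sequence `(A_k, π_k)`. -/
def ALim (p L : ℕ) (t₁ : ℝ) : Submodule ℝ (∀ k : ℕ, A p L t₁ k) where
  carrier := {c | ∀ k, proj p L t₁ k (c (k + 1)) = c k}
  add_mem' := by
    intro a b ha hb k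
    simp only [Pi.add_apply, map_add, ha k, hb k]
  zero_mem' := by
    intro k
    simp only [Pi.zero_apply, map_zero]
  smul_mem' := by
    intro r a ha k
    simp only [Pi.smul_apply, map_smul, ha k]

/-- First component of the couple of functions associated with an element of `A_k`:
`∑_{l ≤ k} a_l η^l`. -/
def evalParam {p L : ℕ} {t₁ : ℝ} {k : ℕ} (c : A p L t₁ k) (η : ℝ) : ℝ :=
  ∑ l : Fin (k + 1), (c l).1 * η ^ (l : ℕ)

/-- Second component of the couple of functions associated with an element of `A_k`:
`∑_{l ≤ k} (u_l(t) + ∑_φ r_{l,φ} φ(t/η)) η^l`, where `φ` runs over finitely many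
elements of `B_l`. -/
def evalFun {p L : ℕ} {t₁ : ℝ} {k : ℕ} (c : A p L t₁ k) (η : ℝ) (t : Icc (-t₁) t₁) : ℝ :=
  ∑ l : Fin (k + 1),
    ((c l).2.1.1 t + (c l).2.2.sum fun φ r => r * φ.1 ((t : ℝ) / η)) * η ^ (l : ℕ)

/-- The couple `(γ, w)` has the element `c` of the projective limit as semi-asymptotic
expansion, uniformly on `[-t₁, t₁]`. -/
def HasSemiAsymptoticExpansion {p L : ℕ} {t₁ : ℝ} (γ : ℝ → ℝ) (w : ℝ → ℝ → ℝ)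
    (c : ALim p L t₁) : Prop :=
  ∀ k : ℕ,
    (∃ K : ℝ, ∀ᶠ η in 𝓝[>] (0 : ℝ), |γ η - evalParam (c.1 k) η| ≤ K * η ^ (k + 1)) ∧
    (∃ K : ℝ, ∀ᶠ η in 𝓝[>] (0 : ℝ), ∀ t : Icc (-t₁) t₁,
      |w η t - evalFun (c.1 k) η t| ≤ K * η ^ (k + 1))

/-- `(α_η, u_η)` is, for all small `η > 0`, a solution on `[-t₀, t₀]` of
`η^{p+2} u' = (p+1) η t^p u + η^{p-L+1} α t^L + S(t, η^{p-L+1} α)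
  + η^{p+1} P(t, η u, η^{p-L+1} α, η)` with `u(-t₀) = 0 = u(t₀)`,
and it is bounded as `η → 0`. -/
structure IsCanardSolution (p L : ℕ) (t₀ : ℝ) (S : ℝ → ℝ → ℝ) (P : ℝ → ℝ → ℝ → ℝ → ℝ)
    (α : ℝ → ℝ) (u : ℝ → ℝ → ℝ) : Prop where
  solution : ∀ᶠ η in 𝓝[>] (0 : ℝ), ∃ u' : ℝ → ℝ, ∀ t ∈ Icc (-t₀) t₀,
    HasDerivWithinAt (u η) (u' t) (Icc (-t₀) t₀) t ∧
    η ^ (p + 2) * u' t =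
      (p + 1) * η * t ^ p * u η t + η ^ (p - L + 1) * α η * t ^ L
        + S t (η ^ (p - L + 1) * α η)
        + η ^ (p + 1) * P t (η * u η t) (η ^ (p - L + 1) * α η) η
  boundary : ∀ᶠ η in 𝓝[>] (0 : ℝ), u η (-t₀) = 0 ∧ u η t₀ = 0
  bounded : ∃ M : ℝ, ∀ᶠ η in 𝓝[>] (0 : ℝ),
    |α η| ≤ M ∧ ∀ t ∈ Icc (-t₀) t₀, |u η t| ≤ M

end Canard

end

/-! Put T = t/η and divide (2) by η^(p+1): it becomes η u' = (p+1) T^p u + α T^L + F, where F is the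
sum of P and S/η^(p+1). In F the unknowns always come with at least one spare power of η: inside P
through ηu and η^(p-L+1) α, and in S/η^(p+1) because the vanishing derivatives of S at the origin
turn each Taylor term in α into a positive power of η times T^i with i ≤ p. So an approximation of
(α, u) up to O(η^k) determines F up to O(η^(k+1) (1+|T|^p)). The expansion is built by induction on
k, starting from the boundedness of (α, u).

Two facts on the linear equation make a step of the induction work. The first is approximate
solvability among finite sums of η^n g(t) and η^n φ(t/η), with φ a bracket of order n
(`isSolvable_pow_mul_smooth`, `isSolvable_smooth_mul_bracket`). A smooth factor is written g(0) + t
h(t). The constant part is solved exactly by the operator I_1, its constant c giving the correction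
of α. The remaining part carries t = ηT, hence one more power of η, and the process is iterated.
When T^p is reached, the term is absorbed by v = -g/(p+1). This requires that I_1 and [T φ] preserve
functions with expansions in negative powers, the same at both infinities. That holds since an
actual solution of moderate growth stays close to the formal series solution
(`hasNegativePowerExpansion_of_deriv`), and polynomial forcing can be reduced to degree below p
(`exists_polynomial_solution`).

The second is stability (`exists_stability_constant`). On [-X, X] a solution is controlled from the
right end down to 0 and from the left end up to 0. The two values found at 0 must agree, which
determines the coefficient of T^L; boundary values only contribute exponentially small terms inside
a smaller interval. Therefore the approximate solution of the linear equation is close to (α, u), at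
the cost of a slight shrinking of the interval (`hasCompositeApproximation_of_forcing`).

Finally, the approximations of the various orders fit together because the coefficients of a
composite sum are unique (`eq_zero_of_isBigO_compositeSum`): fixed t ≠ 0 isolates the smooth part,
fixed T the bracket. -/

namespace Canard

/-! ### Asymptotic expansions at infinity -/

/-- `f` has the asymptotic expansion `∑ m, c_m T ^ (-m)` at both infinities. -/
def HasExpansion (f : ℝ → ℝ) (c : PowerSeries ℝ) : Prop :=
  ∀ N : ℕ, (fun T : ℝ => f T - (PowerSeries.trunc N c).eval T⁻¹)
    =O[atBot ⊔ atTop] fun T : ℝ => (T⁻¹) ^ N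

theorem tendsto_inv_atBot_sup_atTop :
    Tendsto (fun T : ℝ => T⁻¹) (atBot ⊔ atTop) (𝓝 0) :=
  tendsto_sup.2 ⟨tendsto_inv_atBot_zero, tendsto_inv_atTop_zero⟩

theorem eventually_ne_zero_atBot_sup_atTop : ∀ᶠ T : ℝ in atBot ⊔ atTop, T ≠ 0 :=
  eventually_sup.2 ⟨(eventually_lt_atBot 0).mono fun _ h => h.ne,
    (eventually_gt_atTop 0).mono fun _ h => h.ne'⟩

theorem isBigO_polynomial_eval_inv (q : Polynomial ℝ) :
    (fun T : ℝ => q.eval T⁻¹) =O[atBot ⊔ atTop] fun _ : ℝ => (1 : ℝ) :=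
  ((q.continuous.tendsto 0).comp tendsto_inv_atBot_sup_atTop).isBigO_one ℝ

theorem isBigO_polynomial_eval_inv_of_dvd {N : ℕ} {q : Polynomial ℝ}
    (h : (Polynomial.X : Polynomial ℝ) ^ N ∣ q) :
    (fun T : ℝ => q.eval T⁻¹) =O[atBot ⊔ atTop] fun T : ℝ => (T⁻¹) ^ N := by
  obtain ⟨r, rfl⟩ := h
  have := (isBigO_refl (fun T : ℝ => (T⁻¹) ^ N) (atBot ⊔ atTop)).mul (isBigO_polynomial_eval_inv r)
  simpa using this

theorem isBigO_inv_pow_of_le {m n : ℕ} (h : m ≤ n) :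
    (fun T : ℝ => (T⁻¹) ^ n) =O[atBot ⊔ atTop] fun T : ℝ => (T⁻¹) ^ m := by
  obtain ⟨k, rfl⟩ := Nat.exists_eq_add_of_le h
  have := isBigO_polynomial_eval_inv_of_dvd (N := m) (q := Polynomial.X ^ (m + k))
    (pow_dvd_pow _ h)
  simpa using this

/-- Polynomials in 1/T divisible by X^N are already O(T^(-N)), so any approximant congruent to the
truncation modulo X^N will do. This permits, for instance, the product of two truncations. -/
theorem HasExpansion.of_dvd_sub {f : ℝ → ℝ} {c : PowerSeries ℝ}
    (h : ∀ N : ℕ, ∃ q : Polynomial ℝ, (Polynomial.X : Polynomial ℝ) ^ N ∣ q - PowerSeries.trunc N c ∧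
      (fun T : ℝ => f T - q.eval T⁻¹) =O[atBot ⊔ atTop] fun T : ℝ => (T⁻¹) ^ N) :
    HasExpansion f c := by
  intro N
  obtain ⟨q, hq, hf⟩ := h N
  refine (hf.add (isBigO_polynomial_eval_inv_of_dvd hq)).congr_left fun T => ?_
  simp

theorem HasExpansion.congr' {f g : ℝ → ℝ} {c : PowerSeries ℝ} (hf : HasExpansion f c)
    (h : f =ᶠ[atBot ⊔ atTop] g) : HasExpansion g c := fun N =>
  (hf N).congr' (h.mono fun T hT => by simp [hT]) EventuallyEq.rfl

theorem X_pow_dvd_sub_trunc {q : Polynomial ℝ} {c : PowerSeries ℝ} {N : ℕ}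
    (h : ∀ m < N, q.coeff m = PowerSeries.coeff m c) :
    (Polynomial.X : Polynomial ℝ) ^ N ∣ q - PowerSeries.trunc N c := by
  rw [Polynomial.X_pow_dvd_iff]
  intro m hm
  simp [PowerSeries.coeff_trunc, hm, h m hm]

theorem hasExpansion_polynomial (q : Polynomial ℝ) :
    HasExpansion (fun T => q.eval T⁻¹) (q : PowerSeries ℝ) := by
  refine HasExpansion.of_dvd_sub fun N => ⟨q, X_pow_dvd_sub_trunc fun m _ => by simp, ?_⟩
  simp only [sub_self]
  exact isBigO_zero _ _

theorem HasExpansion.add {f g : ℝ → ℝ} {c d : PowerSeries ℝ} (hf : HasExpansion f c)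
    (hg : HasExpansion g d) : HasExpansion (fun T => f T + g T) (c + d) := by
  intro N
  refine ((hf N).add (hg N)).congr_left fun T => ?_
  simp only [map_add, Polynomial.eval_add]
  ring

theorem HasExpansion.isBigO_one {f : ℝ → ℝ} {c : PowerSeries ℝ} (hf : HasExpansion f c) :
    f =O[atBot ⊔ atTop] fun _ => (1 : ℝ) := by
  simpa using hf 0

theorem HasExpansion.mul {f g : ℝ → ℝ} {c d : PowerSeries ℝ} (hf : HasExpansion f c)
    (hg : HasExpansion g d) : HasExpansion (fun T => f T * g T) (c * d) := by
  refine HasExpansion.of_dvd_sub fun N =>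
    ⟨PowerSeries.trunc N c * PowerSeries.trunc N d, X_pow_dvd_sub_trunc fun m hm => ?_, ?_⟩
  · rw [PowerSeries.coeff_mul, Polynomial.coeff_mul]
    refine Finset.sum_congr rfl fun x hx => ?_
    have := Finset.HasAntidiagonal.mem_antidiagonal.1 hx
    rw [PowerSeries.coeff_trunc, PowerSeries.coeff_trunc, if_pos (by omega), if_pos (by omega)]
  · have h1 := (hf N).mul hg.isBigO_one
    have h2 := (isBigO_polynomial_eval_inv (PowerSeries.trunc N c)).mul (hg N)
    simp only [mul_one, one_mul] at h1 h2
    refine (h1.add h2).congr_left fun T => ?_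
    simp only [Polynomial.eval_mul]
    ring

theorem HasExpansion.const_mul {f : ℝ → ℝ} {c : PowerSeries ℝ} (hf : HasExpansion f c) (r : ℝ) :
    HasExpansion (fun T => r * f T) (((Polynomial.C r : Polynomial ℝ) : PowerSeries ℝ) * c) := by
  simpa using (hasExpansion_polynomial (Polynomial.C r)).mul hf

/-- Multiplication by T removes one factor X from the series; the estimate of order N for the
product comes from the one of order N + 1. -/
theorem HasExpansion.mul_self_of_X_mul {f : ℝ → ℝ} {d : PowerSeries ℝ}
    (hf : HasExpansion f (PowerSeries.X * d)) : HasExpansion (fun T => T * f T) d := by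
  refine HasExpansion.of_dvd_sub fun N => ⟨PowerSeries.trunc N d, by simp, ?_⟩
  have h := (isBigO_refl (fun T : ℝ => T) (atBot ⊔ atTop)).mul (hf (N + 1))
  refine h.congr' ?_ ?_
  · filter_upwards [eventually_ne_zero_atBot_sup_atTop] with T hT
    have : PowerSeries.trunc (N + 1) (PowerSeries.X * d)
        = Polynomial.X * PowerSeries.trunc N d := by
      ext m
      cases m with
      | zero => simp [PowerSeries.coeff_trunc]
      | succ m => simp [PowerSeries.coeff_trunc, PowerSeries.coeff_succ_X_mul]
    rw [this, Polynomial.eval_mul, Polynomial.eval_X]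
    field_simp
  · filter_upwards [eventually_ne_zero_atBot_sup_atTop] with T hT
    rw [pow_succ', ← mul_assoc, mul_inv_cancel₀ hT, one_mul]

theorem exists_eq_X_mul_of_constantCoeff_eq_zero {c : PowerSeries ℝ}
    (hc : PowerSeries.constantCoeff c = 0) : ∃ d, c = PowerSeries.X * d :=
  PowerSeries.X_dvd_iff.2 hc

theorem trunc_succ_eval {c : PowerSeries ℝ} (hc : PowerSeries.constantCoeff c = 0) (N : ℕ) (x : ℝ) :
    (PowerSeries.trunc (N + 1) c).eval x
      = ∑ m ∈ Finset.Icc 1 N, PowerSeries.coeff m c * x ^ m := by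
  rw [Polynomial.eval, PowerSeries.eval₂_trunc_eq_sum_range, Finset.range_eq_Ico, Finset.sum_eq_sum_Ico_succ_bot (by simp)]
  simp only [PowerSeries.coeff_zero_eq_constantCoeff, hc, map_zero, zero_mul, zero_add]
  rfl

/-- Passage from coefficient sequences starting at 1 to power series without constant term, for
which sums and products are those of the ring of power series. -/
theorem hasNegativePowerExpansion_iff {φ : ℝ → ℝ} :
    HasNegativePowerExpansion φ ↔
      ∃ c : PowerSeries ℝ, PowerSeries.constantCoeff c = 0 ∧ HasExpansion φ c := by
  constructor
  · rintro ⟨c, hc⟩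
    have h0 : PowerSeries.constantCoeff (PowerSeries.mk fun m => if m = 0 then 0 else c m) = 0 := by
      rw [← PowerSeries.coeff_zero_eq_constantCoeff_apply, PowerSeries.coeff_mk, if_pos rfl]
    have key : ∀ N : ℕ, (fun T : ℝ => φ T - (PowerSeries.trunc (N + 1)
        (PowerSeries.mk fun m => if m = 0 then 0 else c m)).eval T⁻¹)
        =O[atBot ⊔ atTop] fun T : ℝ => (T⁻¹) ^ (N + 1) := fun N => by
      refine (hc N).congr_left fun T => ?_
      rw [trunc_succ_eval h0]
      congr 1
      refine Finset.sum_congr rfl fun m hm => ?_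
      have := (Finset.mem_Icc.1 hm).1
      rw [PowerSeries.coeff_mk, if_neg (by omega)]
    refine ⟨_, h0, fun N => ?_⟩
    cases N with
    | zero =>
      refine ((key 0).trans (isBigO_inv_pow_of_le (Nat.zero_le _))).congr_left fun T => ?_
      rw [trunc_succ_eval h0]
      simp
    | succ N => exact key N
  · rintro ⟨c, h0, hc⟩
    refine ⟨fun m => PowerSeries.coeff m c, fun N => ?_⟩
    refine (hc (N + 1)).congr_left fun T => ?_
    rw [trunc_succ_eval h0]

theorem HasNegativePowerExpansion.add {φ θ : ℝ → ℝ} (hφ : HasNegativePowerExpansion φ)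
    (hθ : HasNegativePowerExpansion θ) : HasNegativePowerExpansion (fun T => φ T + θ T) := by
  rw [hasNegativePowerExpansion_iff] at *
  obtain ⟨c, hc, h⟩ := hφ
  obtain ⟨d, hd, h'⟩ := hθ
  exact ⟨c + d, by simp [hc, hd], h.add h'⟩

theorem HasNegativePowerExpansion.const_mul {φ : ℝ → ℝ} (hφ : HasNegativePowerExpansion φ) (r : ℝ) :
    HasNegativePowerExpansion (fun T => r * φ T) := by
  rw [hasNegativePowerExpansion_iff] at *
  obtain ⟨c, hc, h⟩ := hφ
  exact ⟨_, by simp [hc], h.const_mul r⟩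

theorem HasNegativePowerExpansion.mul_hasExpansion {φ θ : ℝ → ℝ} {c : PowerSeries ℝ}
    (hφ : HasNegativePowerExpansion φ) (hθ : HasExpansion θ c) :
    HasNegativePowerExpansion (fun T => φ T * θ T) := by
  rw [hasNegativePowerExpansion_iff] at *
  obtain ⟨d, hd, h⟩ := hφ
  exact ⟨_, by simp [hd], h.mul hθ⟩

theorem HasNegativePowerExpansion.mul {φ θ : ℝ → ℝ} (hφ : HasNegativePowerExpansion φ)
    (hθ : HasNegativePowerExpansion θ) : HasNegativePowerExpansion (fun T => φ T * θ T) := by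
  obtain ⟨c, -, h⟩ := hasNegativePowerExpansion_iff.1 hθ
  exact hφ.mul_hasExpansion h

theorem HasNegativePowerExpansion.congr' {φ θ : ℝ → ℝ} (hφ : HasNegativePowerExpansion φ)
    (h : φ =ᶠ[atBot ⊔ atTop] θ) : HasNegativePowerExpansion θ := by
  rw [hasNegativePowerExpansion_iff] at *
  obtain ⟨c, hc, h'⟩ := hφ
  exact ⟨c, hc, h'.congr' h⟩

theorem hasNegativePowerExpansion_zero : HasNegativePowerExpansion fun _ => 0 :=
  ⟨0, fun N => by
    simp only [Pi.zero_apply, zero_mul, Finset.sum_const_zero, sub_self]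
    exact isBigO_zero _ _⟩

theorem hasNegativePowerExpansion_inv_pow {m : ℕ} (hm : m ≠ 0) :
    HasNegativePowerExpansion fun T => T⁻¹ ^ m :=
  hasNegativePowerExpansion_iff.2 ⟨((Polynomial.X ^ m : Polynomial ℝ) : PowerSeries ℝ),
    by simp [hm], by simpa using hasExpansion_polynomial (Polynomial.X ^ m)⟩

/-- The constant is the coefficient of 1/T: it is the whole polynomial part of T φ. -/
theorem HasNegativePowerExpansion.exists_mul_self_sub {φ : ℝ → ℝ}
    (hφ : HasNegativePowerExpansion φ) :
    ∃ c : ℝ, HasNegativePowerExpansion fun T => T * φ T - c := by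
  obtain ⟨d, hd, h⟩ := hasNegativePowerExpansion_iff.1 hφ
  obtain ⟨e, rfl⟩ := exists_eq_X_mul_of_constantCoeff_eq_zero hd
  refine ⟨PowerSeries.constantCoeff e, hasNegativePowerExpansion_iff.2
    ⟨e + ((Polynomial.C (-PowerSeries.constantCoeff e) : Polynomial ℝ) : PowerSeries ℝ), ?_, ?_⟩⟩
  · simp
  · simpa [sub_eq_add_neg] using h.mul_self_of_X_mul.add
      (hasExpansion_polynomial (Polynomial.C (-PowerSeries.constantCoeff e)))

theorem HasNegativePowerExpansion.tendsto {φ : ℝ → ℝ} (hφ : HasNegativePowerExpansion φ) :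
    Tendsto φ (atBot ⊔ atTop) (𝓝 0) := by
  obtain ⟨c, hc⟩ := hφ
  have h := hc 0
  simp only [Finset.Icc_eq_empty_of_lt zero_lt_one, Finset.sum_empty, sub_zero, zero_add,
    pow_one] at h
  exact h.trans_tendsto tendsto_inv_atBot_sup_atTop

/-- A nonconstant polynomial is unbounded at +∞, and a constant tending to 0 is 0. This makes the
splitting into polynomial part and bracket unique. -/
theorem eq_zero_of_hasNegativePowerExpansion_polynomial {q : Polynomial ℝ}
    (h : HasNegativePowerExpansion fun T => q.eval T) : q = 0 := by
  have h1 := h.tendsto.mono_left (le_sup_right : atTop ≤ atBot ⊔ atTop)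
  have hd : q.degree ≤ 0 := by
    rw [Polynomial.degree_le_zero_iff]
    by_contra hne
    have hdeg : 0 < q.degree := by
      by_contra hcon
      exact hne (Polynomial.degree_le_zero_iff.1 (not_lt.1 hcon)) |>.elim
    exact not_tendsto_nhds_of_tendsto_atTop (q.abs_tendsto_atTop hdeg) _ (h1.abs)
  rw [Polynomial.degree_le_zero_iff.1 hd] at h1 ⊢
  simp only [Polynomial.eval_C] at h1
  rw [tendsto_nhds_unique tendsto_const_nhds h1, map_zero]

/-! ### Expansions with a polynomial part. -/

/-- `ρ` is the sum of a polynomial and of a function with an expansion in negative powers. -/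
def HasLaurentExpansion (ρ : ℝ → ℝ) : Prop :=
  ∃ q : Polynomial ℝ, HasNegativePowerExpansion fun T => ρ T - q.eval T

theorem HasLaurentExpansion.add {ρ σ : ℝ → ℝ} (hρ : HasLaurentExpansion ρ)
    (hσ : HasLaurentExpansion σ) : HasLaurentExpansion fun T => ρ T + σ T := by
  obtain ⟨q, hq⟩ := hρ
  obtain ⟨r, hr⟩ := hσ
  refine ⟨q + r, ?_⟩
  convert hq.add hr using 2 with T
  simp only [Polynomial.eval_add]
  ring

theorem HasLaurentExpansion.const_mul {ρ : ℝ → ℝ} (hρ : HasLaurentExpansion ρ) (r : ℝ) :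
    HasLaurentExpansion fun T => r * ρ T := by
  obtain ⟨q, hq⟩ := hρ
  refine ⟨Polynomial.C r * q, ?_⟩
  convert hq.const_mul r using 2 with T
  simp only [Polynomial.eval_mul, Polynomial.eval_C]
  ring

theorem HasNegativePowerExpansion.hasLaurentExpansion {φ : ℝ → ℝ}
    (h : HasNegativePowerExpansion φ) : HasLaurentExpansion φ :=
  ⟨0, by simpa using h⟩

theorem hasLaurentExpansion_polynomial (q : Polynomial ℝ) :
    HasLaurentExpansion fun T => q.eval T :=
  ⟨q, by simpa using hasNegativePowerExpansion_zero⟩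

theorem HasLaurentExpansion.mul_self {ρ : ℝ → ℝ} (hρ : HasLaurentExpansion ρ) :
    HasLaurentExpansion fun T => T * ρ T := by
  obtain ⟨q, hq⟩ := hρ
  obtain ⟨c, hc⟩ := hq.exists_mul_self_sub
  refine ⟨Polynomial.X * q + Polynomial.C c, ?_⟩
  convert hc using 2 with T
  simp only [Polynomial.eval_add, Polynomial.eval_mul, Polynomial.eval_C, Polynomial.eval_X]
  ring

theorem HasLaurentExpansion.polynomial_mul {ρ : ℝ → ℝ} (hρ : HasLaurentExpansion ρ)
    (q : Polynomial ℝ) : HasLaurentExpansion fun T => q.eval T * ρ T := by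
  induction q using Polynomial.induction_on' with
  | add q r hq hr => simpa only [Polynomial.eval_add, add_mul] using hq.add hr
  | monomial n a =>
    have : HasLaurentExpansion fun T => T ^ n * ρ T := by
      induction n with
      | zero => simpa using hρ
      | succ n ih => simpa only [pow_succ', mul_assoc] using ih.mul_self
    simpa only [Polynomial.eval_monomial, mul_assoc] using this.const_mul a

/-- With polynomial parts q and r, ρσ = qσ + r(ρ - q) + (ρ - q)(σ - r). -/
theorem HasLaurentExpansion.mul {ρ σ : ℝ → ℝ} (hρ : HasLaurentExpansion ρ)
    (hσ : HasLaurentExpansion σ) : HasLaurentExpansion fun T => ρ T * σ T := by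
  obtain ⟨q, hq⟩ := hρ
  have h1 := hσ.polynomial_mul q
  obtain ⟨r, hr⟩ := hσ
  have h2 := hq.hasLaurentExpansion.polynomial_mul r
  convert (h1.add h2).add (hq.mul hr).hasLaurentExpansion using 2 with T
  ring

theorem HasLaurentExpansion.exists_isBigO_pow {ρ : ℝ → ℝ} (hρ : HasLaurentExpansion ρ) :
    ∃ d : ℕ, ρ =O[atBot ⊔ atTop] fun T => T ^ d := by
  obtain ⟨q, hq⟩ := hρ
  obtain ⟨c, hc⟩ := hasNegativePowerExpansion_iff.1 hq
  have hone : ∀ d : ℕ, (fun _ : ℝ => (1 : ℝ)) =O[atBot ⊔ atTop] fun T : ℝ => T ^ d := fun d => by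
    refine IsBigO.of_bound 1 ?_
    have : ∀ᶠ T : ℝ in atBot ⊔ atTop, 1 ≤ |T| := eventually_sup.2
      ⟨tendsto_abs_atBot_atTop.eventually_ge_atTop 1, tendsto_abs_atTop_atTop.eventually_ge_atTop 1⟩
    filter_upwards [this] with T hT
    simpa using one_le_pow₀ hT
  have hpoly : ∃ d : ℕ, (fun T : ℝ => q.eval T) =O[atBot ⊔ atTop] fun T => T ^ d := by
    refine ⟨q.natDegree, ?_⟩
    simp only [Polynomial.eval_eq_sum_range]
    refine IsBigO.fun_sum fun i hi => IsBigO.const_mul_left ?_ _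
    obtain ⟨k, hk⟩ := Nat.exists_eq_add_of_le (Nat.lt_succ_iff.1 (Finset.mem_range.1 hi))
    rw [hk]
    simpa [pow_add] using (isBigO_refl (fun T : ℝ => T ^ i) (atBot ⊔ atTop)).mul (hone k)
  obtain ⟨d, hd⟩ := hpoly
  refine ⟨d, ((hc.2.isBigO_one.trans (hone d)).add hd).congr_left fun T => by ring⟩

end Canard

namespace Canard

/-! ### The linear equation `u' = (p + 1) T ^ p u + h` near infinity -/

theorem hasDerivAt_exp_neg_pow (p : ℕ) (T : ℝ) :
    HasDerivAt (fun T : ℝ => Real.exp (-T ^ (p + 1)))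
      (-((p + 1) * T ^ p) * Real.exp (-T ^ (p + 1))) T := by
  have h := ((hasDerivAt_pow (p + 1) T).neg).exp
  simp only [Nat.cast_add, Nat.cast_one, Nat.add_sub_cancel] at h
  exact h.congr_deriv (mul_comm _ _)

theorem hasDerivAt_mul_exp_neg_pow {p : ℕ} {u : ℝ → ℝ} {u' T : ℝ} (h : HasDerivAt u u' T) :
    HasDerivAt (fun T => u T * Real.exp (-T ^ (p + 1)))
      ((u' - (p + 1) * T ^ p * u T) * Real.exp (-T ^ (p + 1))) T :=
  (h.mul (hasDerivAt_exp_neg_pow p T)).congr_deriv (by ring)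

theorem tendsto_exp_neg_pow_atTop (p : ℕ) :
    Tendsto (fun T : ℝ => Real.exp (-T ^ (p + 1))) atTop (𝓝 0) :=
  Real.tendsto_exp_neg_atTop_nhds_zero.comp (tendsto_pow_atTop (Nat.succ_ne_zero p))

theorem nonneg_of_deriv_nonpos_of_tendsto {f f' : ℝ → ℝ} {a : ℝ}
    (hf : ∀ T ∈ Ici a, HasDerivAt f (f' T) T) (hf' : ∀ T ∈ Ici a, f' T ≤ 0)
    (hlim : Tendsto f atTop (𝓝 0)) : 0 ≤ f a := by
  have hanti : AntitoneOn f (Ici a) := by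
    refine antitoneOn_of_hasDerivWithinAt_nonpos (convex_Ici a)
      (fun T hT => (hf T hT).continuousAt.continuousWithinAt)
      (fun T hT => (hf T (interior_subset hT)).hasDerivWithinAt)
      (fun T hT => hf' T (interior_subset hT))
  exact le_of_tendsto hlim ((eventually_ge_atTop a).mono fun T hT => hanti self_mem_Ici hT hT)

/-- For s = ±1 the function (D + s u) exp(-T^(p+1)) is nonincreasing: the constant D contributes
-(p+1) D T^p, which dominates the defect D T^p. It tends to 0 at +∞, so it is nonnegative at a. -/
theorem abs_le_of_abs_deriv_sub_le {p : ℕ} {u u' : ℝ → ℝ} {a D : ℝ} (ha : 0 ≤ a)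
    (hu : ∀ T ∈ Ici a, HasDerivAt u (u' T) T)
    (hD : ∀ T ∈ Ici a, |u' T - (p + 1) * T ^ p * u T| ≤ D * T ^ p)
    (hlim : Tendsto (fun T => u T * Real.exp (-T ^ (p + 1))) atTop (𝓝 0)) : |u a| ≤ D := by
  have key : ∀ s : ℝ, |s| = 1 → 0 ≤ D + s * u a := by
    intro s hs
    have h0 : 0 ≤ (D + s * u a) * Real.exp (-a ^ (p + 1)) := by
      refine nonneg_of_deriv_nonpos_of_tendsto
        (f := fun T => (D + s * u T) * Real.exp (-T ^ (p + 1)))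
        (fun T hT => hasDerivAt_mul_exp_neg_pow (((hu T hT).const_mul s).const_add D))
        (fun T hT => ?_) ?_
      · refine mul_nonpos_of_nonpos_of_nonneg ?_ (Real.exp_pos _).le
        have hT0 : 0 ≤ T ^ p := pow_nonneg (ha.trans hT) p
        have hDT := hD T hT
        have h1 : |s * (u' T - (p + 1) * T ^ p * u T)| ≤ D * T ^ p := by
          rw [abs_mul, hs, one_mul]
          exact hDT
        have h2 := (abs_le.1 h1).2
        have h3 : 0 ≤ (p : ℝ) * (D * T ^ p) :=
          mul_nonneg (Nat.cast_nonneg p) ((abs_nonneg _).trans hDT)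
        linarith
      · have := ((tendsto_exp_neg_pow_atTop p).const_mul D).add (hlim.const_mul s)
        simp only [mul_zero, add_zero] at this
        refine this.congr fun T => by ring
    exact nonneg_of_mul_nonneg_left h0 (Real.exp_pos _)
  have h1 := key 1 (by simp)
  have h2 := key (-1) (by simp)
  rw [abs_le]
  constructor <;> linarith

theorem hasDerivAt_comp_neg {u : ℝ → ℝ} {u' T : ℝ} (h : HasDerivAt u u' (-T)) :
    HasDerivAt (fun T => u (-T)) (-u') T := by
  have := h.comp T (hasDerivAt_neg T)
  rw [mul_neg_one] at this
  exact this

/-- For each large b the comparison on [b, +∞) is used with D = C b^(-N), since T^(-N) ≤ b^(-N)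
there; it is then read at the left end b. -/
theorem isBigO_inv_pow_atTop_of_isBigO {p N : ℕ} {u u' : ℝ → ℝ}
    (hu : ∀ᶠ T in atTop, HasDerivAt u (u' T) T)
    (h : (fun T => T⁻¹ ^ p * (u' T - (p + 1) * T ^ p * u T)) =O[atTop] fun T : ℝ => T⁻¹ ^ N)
    (hlim : Tendsto (fun T => u T * Real.exp (-T ^ (p + 1))) atTop (𝓝 0)) :
    u =O[atTop] fun T : ℝ => T⁻¹ ^ N := by
  obtain ⟨C, hC0, hC⟩ := h.exists_pos
  rw [IsBigOWith] at hC
  obtain ⟨a, ha⟩ := eventually_atTop.1 ((hu.and hC).and (eventually_gt_atTop 0))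
  refine IsBigO.of_bound C ((eventually_ge_atTop a).mono fun b hb => ?_)
  have hb0 := (ha b hb).2
  rw [Real.norm_eq_abs, Real.norm_of_nonneg (by positivity)]
  refine abs_le_of_abs_deriv_sub_le (p := p) hb0.le
    (fun T hT => (ha T (hb.trans hT)).1.1) (fun T hT => ?_) hlim
  have hT0 : 0 < T := hb0.trans_le hT
  have h1 := (ha T (hb.trans hT)).1.2
  rw [Real.norm_eq_abs, abs_mul, Real.norm_of_nonneg (by positivity), abs_of_pos (by positivity)]
    at h1
  have h2 : T⁻¹ ^ N ≤ b⁻¹ ^ N :=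
    pow_le_pow_left₀ (by positivity) (inv_anti₀ hb0 hT) N
  calc |u' T - (p + 1) * T ^ p * u T|
      = T ^ p * (T⁻¹ ^ p * |u' T - (p + 1) * T ^ p * u T|) := by
        rw [← mul_assoc, ← mul_pow, mul_inv_cancel₀ hT0.ne', one_pow, one_mul]
    _ ≤ T ^ p * (C * b⁻¹ ^ N) := by 
        exact mul_le_mul_of_nonneg_left (h1.trans (mul_le_mul_of_nonneg_left h2 hC0.le))
          (pow_nonneg hT0.le p)
    _ = C * b⁻¹ ^ N * T ^ p := mul_comm _ _

/-- As p is odd, u(-T) satisfies an equation of the same form, so the estimate at -∞ is the one at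
+∞ after reflection. -/
theorem isBigO_inv_pow_of_isBigO {p N : ℕ} (hp : Odd p) {u u' : ℝ → ℝ}
    (hu : ∀ᶠ T in atBot ⊔ atTop, HasDerivAt u (u' T) T)
    (h : (fun T => T⁻¹ ^ p * (u' T - (p + 1) * T ^ p * u T))
      =O[atBot ⊔ atTop] fun T : ℝ => T⁻¹ ^ N)
    (hlim : Tendsto (fun T => u T * Real.exp (-T ^ (p + 1))) (atBot ⊔ atTop) (𝓝 0)) :
    u =O[atBot ⊔ atTop] fun T : ℝ => T⁻¹ ^ N := by
  rw [eventually_sup] at hu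
  rw [isBigO_sup] at h
  rw [tendsto_sup] at hlim
  refine isBigO_sup.2 ⟨?_, isBigO_inv_pow_atTop_of_isBigO hu.2 h.2 hlim.2⟩
  have hN : (fun T : ℝ => (-T)⁻¹ ^ N) =O[atTop] fun T : ℝ => T⁻¹ ^ N :=
    IsBigO.of_bound 1 (Eventually.of_forall fun T => by simp)
  have key : (fun T => u (-T)) =O[atTop] fun T : ℝ => T⁻¹ ^ N := by
    refine isBigO_inv_pow_atTop_of_isBigO (p := p) (u' := fun T => -u' (-T)) ?_ ?_ ?_
    · filter_upwards [tendsto_neg_atTop_atBot.eventually hu.1] with T hT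
      exact hasDerivAt_comp_neg hT
    · refine ((h.1.comp_tendsto tendsto_neg_atTop_atBot).trans hN).congr_left fun T => ?_
      simp only [Function.comp, inv_neg, hp.neg_pow]
      ring
    · refine (hlim.1.comp tendsto_neg_atTop_atBot).congr fun T => ?_
      simp only [Function.comp, hp.add_one.neg_pow]
  have := key.comp_tendsto tendsto_neg_atBot_atTop
  refine (this.congr_left fun T => by simp).trans (IsBigO.of_bound 1 (Eventually.of_forall
    fun T => by simp))

/-- Coefficients of the formal solution of `u' = (p + 1) T ^ p (u + ∑ e_m T ^ (-m) / (p + 1))`. -/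
noncomputable def formalSolution (p : ℕ) (e : ℕ → ℝ) : ℕ → ℝ
  | m => if m < p + 2 then -e m / (p + 1) else
      -(e m + ((m : ℝ) - (p + 1)) * formalSolution p e (m - (p + 1))) / (p + 1)
  termination_by m => m
  decreasing_by omega

/-- In the variable x = 1/T one has d/dT = -x² d/dx. If e is the series of T^(-p) (u' - (p+1) T^p
u), the series b of u must satisfy e + x^(p+2) b' + (p+1) b = 0, and comparing coefficients gives
the recurrence. Truncation keeps the identity modulo x^N. -/
theorem formalSolution_dvd (p N : ℕ) (e : PowerSeries ℝ) :
    (Polynomial.X : Polynomial ℝ) ^ N ∣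
      (PowerSeries.trunc N e + Polynomial.X ^ (p + 2) * Polynomial.derivative
        (PowerSeries.trunc N (PowerSeries.mk (formalSolution p fun m => PowerSeries.coeff m e)))
      + Polynomial.C ((p : ℝ) + 1) *
        PowerSeries.trunc N (PowerSeries.mk (formalSolution p fun m => PowerSeries.coeff m e))) := by
  rw [Polynomial.X_pow_dvd_iff]
  intro m hm
  have hp : (p : ℝ) + 1 ≠ 0 := by positivity
  simp only [Polynomial.coeff_add, Polynomial.coeff_C_mul, PowerSeries.coeff_trunc, hm, if_true,
    PowerSeries.coeff_mk, Polynomial.coeff_X_pow_mul', Polynomial.coeff_derivative]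
  conv_lhs => enter [2]; rw [formalSolution]
  by_cases h : m < p + 2
  · rw [if_neg (by omega), if_pos h]
    field_simp
    ring
  · rw [if_pos (by omega), if_neg h, if_pos (by omega),
      show m - (p + 2) + 1 = m - (p + 1) by omega]
    have : ((m - (p + 2) : ℕ) : ℝ) = m - (p + 2) := by
      rw [Nat.cast_sub (by omega)]; push_cast; ring
    rw [this]
    field_simp
    ring

/-- The truncated formal solution is subtracted from u. The difference satisfies the equation with a
defect that is O(T^(-N)) after division by T^p, and the growth condition excludes multiples of
exp(T^(p+1)). -/
theorem hasNegativePowerExpansion_of_deriv {p : ℕ} (hp : Odd p) {u u' : ℝ → ℝ}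
    (hu : ∀ T, HasDerivAt u (u' T) T)
    (h : HasNegativePowerExpansion fun T => T⁻¹ ^ p * (u' T - (p + 1) * T ^ p * u T))
    (hlim : Tendsto (fun T => u T * Real.exp (-T ^ (p + 1))) (atBot ⊔ atTop) (𝓝 0)) :
    HasNegativePowerExpansion u := by
  obtain ⟨e, he0, he⟩ := hasNegativePowerExpansion_iff.1 h
  refine hasNegativePowerExpansion_iff.2
    ⟨PowerSeries.mk (formalSolution p fun m => PowerSeries.coeff m e), ?_, fun N => ?_⟩
  · rw [← PowerSeries.coeff_zero_eq_constantCoeff_apply, PowerSeries.coeff_mk, formalSolution]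
    simp [he0]
  have hdvd := formalSolution_dvd p N e
  set b := PowerSeries.trunc N (PowerSeries.mk (formalSolution p fun m => PowerSeries.coeff m e))
  have hb : ∀ᶠ T : ℝ in atBot ⊔ atTop, HasDerivAt (fun T : ℝ => b.eval T⁻¹)
      (b.derivative.eval T⁻¹ * -(T⁻¹ ^ 2)) T := by
    filter_upwards [eventually_ne_zero_atBot_sup_atTop] with T hT
    have := (b.hasDerivAt T⁻¹).comp T (hasDerivAt_inv hT)
    rw [← inv_pow] at this
    exact this
  refine isBigO_inv_pow_of_isBigO hp (hb.mono fun T hT => (hu T).sub hT) ?_ ?_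
  · refine ((he N).add (isBigO_polynomial_eval_inv_of_dvd hdvd)).congr' ?_ EventuallyEq.rfl
    filter_upwards [eventually_ne_zero_atBot_sup_atTop] with T hT
    simp only [Polynomial.eval_add, Polynomial.eval_mul, Polynomial.eval_pow, Polynomial.eval_X,
      Polynomial.eval_C]
    have : T⁻¹ ^ p * T ^ p = 1 := by rw [← mul_pow, inv_mul_cancel₀ hT, one_pow]
    linear_combination (-(p + 1) * b.eval T⁻¹) * this
  · have h1 : Tendsto (fun T : ℝ => b.eval T⁻¹) (atBot ⊔ atTop) (𝓝 (b.eval 0)) :=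
      (b.continuous.tendsto 0).comp tendsto_inv_atBot_sup_atTop
    have h2 : Tendsto (fun T : ℝ => Real.exp (-T ^ (p + 1))) (atBot ⊔ atTop) (𝓝 0) := by
      refine tendsto_sup.2 ⟨?_, tendsto_exp_neg_pow_atTop p⟩
      refine ((tendsto_exp_neg_pow_atTop p).comp tendsto_neg_atBot_atTop).congr fun T => ?_
      simp only [Function.comp, hp.add_one.neg_pow]
    have := hlim.sub (h1.mul h2)
    simp only [mul_zero, sub_zero] at this
    exact this.congr fun T => by ring

/-! ### The operator `I_1` -/

theorem isBigO_pow_mul_exp_neg_pow (p d : ℕ) (hp : Odd p) :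
    (fun T : ℝ => T ^ d * Real.exp (-T ^ (p + 1))) =O[atBot ⊔ atTop]
      fun T : ℝ => (1 + T ^ 2)⁻¹ := by
  have key : Tendsto (fun T : ℝ => (1 + T ^ 2) * T ^ d * Real.exp (-T ^ (p + 1))) atTop (𝓝 0) := by
    have h1 := (Real.tendsto_pow_mul_exp_neg_atTop_nhds_zero d).add
      (Real.tendsto_pow_mul_exp_neg_atTop_nhds_zero (d + 2))
    simp only [add_zero] at h1
    refine tendsto_of_tendsto_of_tendsto_of_le_of_le' tendsto_const_nhds h1
      ((eventually_ge_atTop 0).mono fun T hT => by positivity)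
      ((eventually_ge_atTop 1).mono fun T hT => ?_)
    have h2 : Real.exp (-T ^ (p + 1)) ≤ Real.exp (-T) :=
      Real.exp_le_exp.2 (neg_le_neg (le_self_pow₀ hT (Nat.succ_ne_zero p)))
    have h3 : 0 ≤ (1 + T ^ 2) * T ^ d := by positivity
    calc _ ≤ (1 + T ^ 2) * T ^ d * Real.exp (-T) := mul_le_mul_of_nonneg_left h2 h3
      _ = _ := by ring
  have key2 : (fun T : ℝ => (1 + T ^ 2) * T ^ d * Real.exp (-T ^ (p + 1)))
      =O[atBot ⊔ atTop] fun _ => (1 : ℝ) := by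
    refine isBigO_sup.2 ⟨?_, key.isBigO_one ℝ⟩
    refine ((key.isBigO_one ℝ).comp_tendsto tendsto_neg_atBot_atTop).norm_left.congr_left
      (fun T => ?_) |>.of_norm_left
    simp [hp.add_one.neg_pow]
  have := (isBigO_refl (fun T : ℝ => (1 + T ^ 2)⁻¹) (atBot ⊔ atTop)).mul key2
  simp only [mul_one] at this
  refine this.congr_left fun T => ?_
  have : 1 + T ^ 2 ≠ 0 := by positivity
  field_simp

theorem integrable_mul_exp_neg_pow {p : ℕ} (hp : Odd p) {Φ : ℝ → ℝ} (hΦ : Continuous Φ)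
    (h : HasLaurentExpansion Φ) : Integrable fun T => Φ T * Real.exp (-T ^ (p + 1)) := by
  obtain ⟨d, hd⟩ := h.exists_isBigO_pow
  have hO : (fun T => Φ T * Real.exp (-T ^ (p + 1))) =O[cocompact ℝ] fun T : ℝ => (1 + T ^ 2)⁻¹ := by
    rw [cocompact_eq_atBot_atTop]
    exact (hd.mul (isBigO_refl _ _)).trans (isBigO_pow_mul_exp_neg_pow p d hp)
  refine LocallyIntegrable.integrable_of_isBigO_cocompact ?_ hO
    (integrable_inv_one_add_sq.integrableAtFilter _)
  exact (by fun_prop : Continuous fun T => Φ T * Real.exp (-T ^ (p + 1))).locallyIntegrable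

theorem hasLaurentExpansion_pow (k : ℕ) : HasLaurentExpansion fun T => T ^ k := by
  simpa using hasLaurentExpansion_polynomial (Polynomial.X ^ k)

theorem integral_pow_mul_exp_pos {p L : ℕ} (hp : Odd p) (hL : Even L) :
    0 < ∫ z : ℝ, z ^ L * Real.exp (-z ^ (p + 1)) := by
  rw [integral_pos_iff_support_of_nonneg
    (fun z => mul_nonneg (hL.pow_nonneg z) (Real.exp_pos _).le)
    (integrable_mul_exp_neg_pow hp (continuous_pow L) (hasLaurentExpansion_pow L))]
  refine lt_of_lt_of_le (b := volume (Ioi (0 : ℝ))) (by simp) (measure_mono fun z hz => ?_)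
  exact mul_ne_zero (pow_ne_zero _ (ne_of_gt hz)) (Real.exp_pos _).ne'

/-- The constant `c` in the definition of `I_1(Φ)`. -/
noncomputable def canardConst (p L : ℕ) (Φ : ℝ → ℝ) : ℝ :=
  (∫ z, Φ z * Real.exp (-z ^ (p + 1))) / ∫ z, z ^ L * Real.exp (-z ^ (p + 1))

theorem canardOp_one (p L : ℕ) (Φ : ℝ → ℝ) (T : ℝ) :
    canardOp p L 1 Φ T = -(∫ y in Ioi T,
      (Φ y - canardConst p L Φ * y ^ L) * Real.exp (-y ^ (p + 1))) * Real.exp (T ^ (p + 1)) := by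
  simp only [canardOp, canardConst, div_one]
  ring

theorem canardOp_mul_exp (p L : ℕ) (Φ : ℝ → ℝ) (T : ℝ) :
    canardOp p L 1 Φ T * Real.exp (-T ^ (p + 1)) = -(∫ y in Ioi T,
      (Φ y - canardConst p L Φ * y ^ L) * Real.exp (-y ^ (p + 1))) := by
  rw [canardOp_one, mul_assoc, ← Real.exp_add, add_neg_cancel, Real.exp_zero, mul_one]

variable {p L : ℕ}

theorem integrable_canard_integrand (hp : Odd p) {Φ : ℝ → ℝ} (hΦ : Continuous Φ)
    (h : HasLaurentExpansion Φ) :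
    Integrable fun y => (Φ y - canardConst p L Φ * y ^ L) * Real.exp (-y ^ (p + 1)) := by
  refine integrable_mul_exp_neg_pow hp (by fun_prop) ?_
  simpa [sub_eq_add_neg] using h.add ((hasLaurentExpansion_pow L).const_mul (-canardConst p L Φ))

theorem integral_Ioi_eq_sub_intervalIntegral {h : ℝ → ℝ} (hi : Integrable h) (T : ℝ) :
    ∫ y in Ioi T, h y = (∫ y in Ioi 0, h y) - ∫ y in 0..T, h y := by
  rw [← intervalIntegral.integral_interval_add_Ioi (a := 0) (b := T) hi.integrableOn hi.integrableOn]
  ring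

theorem hasDerivAt_canardOp (hp : Odd p) {Φ : ℝ → ℝ} (hΦ : Continuous Φ)
    (h : HasLaurentExpansion Φ) (T : ℝ) :
    HasDerivAt (canardOp p L 1 Φ)
      ((p + 1) * T ^ p * canardOp p L 1 Φ T + Φ T - canardConst p L Φ * T ^ L) T := by
  have hi := integrable_canard_integrand (L := L) hp hΦ h
  have h1 : HasDerivAt (fun T => ∫ y in Ioi T,
      (Φ y - canardConst p L Φ * y ^ L) * Real.exp (-y ^ (p + 1)))
      (-((Φ T - canardConst p L Φ * T ^ L) * Real.exp (-T ^ (p + 1)))) T := by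
    rw [funext (integral_Ioi_eq_sub_intervalIntegral hi)]
    refine HasDerivAt.const_sub _ (intervalIntegral.integral_hasDerivAt_right
      (hi.intervalIntegrable) ?_ ?_)
    · exact (by fun_prop : Continuous fun y : ℝ =>
        (Φ y - canardConst p L Φ * y ^ L) * Real.exp (-y ^ (p + 1))).stronglyMeasurableAtFilter _ _
    · exact (by fun_prop : Continuous fun y : ℝ =>
        (Φ y - canardConst p L Φ * y ^ L) * Real.exp (-y ^ (p + 1))).continuousAt
  have h2 : HasDerivAt (fun T : ℝ => Real.exp (T ^ (p + 1)))
      (Real.exp (T ^ (p + 1)) * ((p + 1) * T ^ p)) T := by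
    have := (hasDerivAt_pow (p + 1) T).exp
    rwa [Nat.add_sub_cancel, Nat.cast_add, Nat.cast_one] at this
  have h3 := h1.neg.mul h2
  have hfun : canardOp p L 1 Φ = (fun T => -(∫ y in Ioi T,
      (Φ y - canardConst p L Φ * y ^ L) * Real.exp (-y ^ (p + 1))) * Real.exp (T ^ (p + 1))) :=
    funext (canardOp_one p L Φ)
  rw [hfun]
  refine h3.congr_deriv ?_
  have he : Real.exp (-T ^ (p + 1)) * Real.exp (T ^ (p + 1)) = 1 := by
    rw [← Real.exp_add, neg_add_cancel, Real.exp_zero]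
  simp only [Pi.neg_apply]
  linear_combination (Φ T - canardConst p L Φ * T ^ L) * he

theorem continuous_canardOp (hp : Odd p) {Φ : ℝ → ℝ} (hΦ : Continuous Φ)
    (h : HasLaurentExpansion Φ) : Continuous (canardOp p L 1 Φ) :=
  continuous_iff_continuousAt.2 fun T => (hasDerivAt_canardOp hp hΦ h T).continuousAt

/-- At +∞ the quantity is the tail of a convergent integral. At -∞ it tends to minus the full
integral, which vanishes by the choice of `canardConst`; this is the only purpose of that constant.
-/
theorem tendsto_canardOp_mul_exp (hp : Odd p) (hL : Even L) {Φ : ℝ → ℝ} (hΦ : Continuous Φ)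
    (h : HasLaurentExpansion Φ) :
    Tendsto (fun T => canardOp p L 1 Φ T * Real.exp (-T ^ (p + 1))) (atBot ⊔ atTop) (𝓝 0) := by
  have hi := integrable_canard_integrand (L := L) hp hΦ h
  simp_rw [canardOp_mul_exp]
  rw [← neg_zero]
  refine (tendsto_sup.2 ⟨?_, tendsto_integral_Ioi_zero tendsto_id⟩).neg
  have h0 : ∫ y, (Φ y - canardConst p L Φ * y ^ L) * Real.exp (-y ^ (p + 1)) = 0 := by
    simp_rw [sub_mul, mul_assoc]
    rw [integral_sub (integrable_mul_exp_neg_pow hp hΦ h)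
      ((integrable_mul_exp_neg_pow hp (continuous_pow L) (hasLaurentExpansion_pow L)).const_mul _),
      integral_const_mul, canardConst, div_mul_cancel₀ _ (integral_pow_mul_exp_pos hp hL).ne',
      sub_self]
  have h1 := (intervalIntegral_tendsto_integral_Iic 0 hi.integrableOn tendsto_id).const_add
    (∫ y in Ioi 0, (Φ y - canardConst p L Φ * y ^ L) * Real.exp (-y ^ (p + 1)))
  rw [add_comm (∫ y in Ioi 0, _), intervalIntegral.integral_Iic_add_Ioi hi.integrableOn
    hi.integrableOn, h0] at h1
  refine h1.congr fun T => ?_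
  rw [id, integral_Ioi_eq_sub_intervalIntegral hi T, intervalIntegral.integral_symm,
    sub_eq_add_neg]

theorem canardConst_add (hp : Odd p) {Φ Θ : ℝ → ℝ} (hΦ : Continuous Φ)
    (h : HasLaurentExpansion Φ) (hΘ : Continuous Θ) (h' : HasLaurentExpansion Θ) :
    canardConst p L (fun T => Φ T + Θ T) = canardConst p L Φ + canardConst p L Θ := by
  simp only [canardConst, add_mul]
  rw [integral_add (integrable_mul_exp_neg_pow hp hΦ h) (integrable_mul_exp_neg_pow hp hΘ h'),
    add_div]

theorem canardOp_add (hp : Odd p) {Φ Θ : ℝ → ℝ} (hΦ : Continuous Φ)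
    (h : HasLaurentExpansion Φ) (hΘ : Continuous Θ) (h' : HasLaurentExpansion Θ) :
    canardOp p L 1 (fun T => Φ T + Θ T) = fun T => canardOp p L 1 Φ T + canardOp p L 1 Θ T := by
  ext T
  rw [canardOp_one, canardOp_one, canardOp_one, canardConst_add hp hΦ h hΘ h', ← add_mul,
    ← neg_add, ← integral_add (integrable_canard_integrand hp hΦ h).integrableOn
      (integrable_canard_integrand hp hΘ h').integrableOn]
  congr 3
  ext y
  ring

theorem canardOp_const_mul (r : ℝ) (Φ : ℝ → ℝ) :
    canardOp p L 1 (fun T => r * Φ T) = fun T => r * canardOp p L 1 Φ T := by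
  ext T
  have hc : canardConst p L (fun T => r * Φ T) = r * canardConst p L Φ := by
    simp only [canardConst, mul_assoc, integral_const_mul]
    ring
  rw [canardOp_one, canardOp_one, hc]
  have : ∀ y : ℝ, (r * Φ y - r * canardConst p L Φ * y ^ L) * Real.exp (-y ^ (p + 1))
      = r * ((Φ y - canardConst p L Φ * y ^ L) * Real.exp (-y ^ (p + 1))) := fun y => by ring
  simp_rw [this]
  rw [integral_const_mul]
  ring

/-! ### Polynomial part of I_1(Φ). -/

/-- A forcing X^(p+m) is cancelled by v = -X^m/(p+1), whose derivative creates a forcing of degree m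
- 1 only. Iterating, all that remains is a forcing of degree below p, for which I_1 has no
polynomial part. -/
theorem exists_polynomial_solution (hp : p ≠ 0) (q : Polynomial ℝ) :
    ∃ v r : Polynomial ℝ, r.degree < p ∧
      v.derivative = Polynomial.C ((p : ℝ) + 1) * Polynomial.X ^ p * v + q - r := by
  have key : ∀ n : ℕ, ∃ v r : Polynomial ℝ, r.degree < p ∧
      v.derivative = Polynomial.C ((p : ℝ) + 1) * Polynomial.X ^ p * v + Polynomial.X ^ n - r := by
    intro n
    induction n using Nat.strong_induction_on with
    | _ n ih =>
      rcases lt_or_ge n p with hn | hn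
      · exact ⟨0, Polynomial.X ^ n, by simpa using hn, by simp⟩
      · obtain ⟨m, rfl⟩ := Nat.exists_eq_add_of_le hn
        have hp1 : (p : ℝ) + 1 ≠ 0 := by positivity
        obtain ⟨v, r, hr, hv⟩ : ∃ v r : Polynomial ℝ, r.degree < p ∧
            v.derivative = Polynomial.C ((p : ℝ) + 1) * Polynomial.X ^ p * v
              + Polynomial.derivative (Polynomial.X ^ m) - r := by
          rcases m with _ | m
          · exact ⟨0, 0, by simp, by simp⟩
          · obtain ⟨v, r, hr, hv⟩ := ih m (by omega)
            refine ⟨Polynomial.C ((m : ℝ) + 1) * v, Polynomial.C ((m : ℝ) + 1) * r, ?_, ?_⟩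
            · rwa [Polynomial.degree_C_mul (by positivity)]
            · rw [Polynomial.derivative_C_mul, hv]
              simp
              ring
        -- Here v solves the problem for the derivative of X^m, the forcing created by cancelling
        -- X^(p+m).
        refine ⟨Polynomial.C ((p : ℝ) + 1)⁻¹ * (v - Polynomial.X ^ m),
          Polynomial.C ((p : ℝ) + 1)⁻¹ * r, ?_, ?_⟩
        · rwa [Polynomial.degree_C_mul (by positivity)]
        · rw [Polynomial.derivative_C_mul, Polynomial.derivative_sub, hv]
          have hC : Polynomial.C ((p : ℝ) + 1)⁻¹ * Polynomial.C ((p : ℝ) + 1) = 1 := by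
            rw [← Polynomial.C_mul, inv_mul_cancel₀ hp1, Polynomial.C_1]
          rw [pow_add]
          linear_combination (Polynomial.X ^ p * Polynomial.X ^ m) * hC
  induction q using Polynomial.induction_on' with
  | add q₁ q₂ h₁ h₂ =>
    obtain ⟨v₁, r₁, hr₁, hv₁⟩ := h₁
    obtain ⟨v₂, r₂, hr₂, hv₂⟩ := h₂
    refine ⟨v₁ + v₂, r₁ + r₂, (Polynomial.degree_add_le _ _).trans_lt (max_lt hr₁ hr₂), ?_⟩
    rw [Polynomial.derivative_add, hv₁, hv₂]
    ring
  | monomial n a =>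
    obtain ⟨v, r, hr, hv⟩ := key n
    refine ⟨Polynomial.C a * v, Polynomial.C a * r, ?_, ?_⟩
    · rw [← Polynomial.smul_eq_C_mul]
      exact (Polynomial.degree_smul_le _ _).trans_lt hr
    · rw [Polynomial.derivative_C_mul, hv, ← Polynomial.C_mul_X_pow_eq_monomial]
      ring

theorem hasNegativePowerExpansion_inv_pow_mul_polynomial {r : Polynomial ℝ} (hr : r.degree < p) :
    HasNegativePowerExpansion fun T => T⁻¹ ^ p * r.eval T := by
  have h : ∀ s : Finset ℕ, (∀ i ∈ s, i < p) →
      HasNegativePowerExpansion fun T => ∑ i ∈ s, r.coeff i * T⁻¹ ^ (p - i) := by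
    intro s
    induction s using Finset.induction_on with
    | empty =>
      intro _
      simpa using hasNegativePowerExpansion_zero
    | insert a s ha ih =>
      intro hs
      simp only [Finset.sum_insert ha]
      refine HasNegativePowerExpansion.add ?_ (ih fun i hi => hs i (Finset.mem_insert_of_mem hi))
      have := hs a (Finset.mem_insert_self a s)
      exact (hasNegativePowerExpansion_inv_pow (by omega)).const_mul _
  refine (h (Finset.range p) fun i hi => Finset.mem_range.1 hi).congr' ?_
  filter_upwards [eventually_ne_zero_atBot_sup_atTop] with T hT
  rw [Polynomial.eval_eq_sum_range' (n := p + 1)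
    (Nat.lt_succ_of_le (Polynomial.natDegree_le_of_degree_le hr.le)), Finset.sum_range_succ,
    Polynomial.coeff_eq_zero_of_degree_lt hr, zero_mul, add_zero, Finset.mul_sum]
  refine Finset.sum_congr rfl fun i hi => ?_
  obtain ⟨k, hk⟩ := Nat.exists_eq_add_of_le (Finset.mem_range.1 hi).le
  have hTi : T⁻¹ ^ i * T ^ i = 1 := by rw [← mul_pow, inv_mul_cancel₀ hT, one_pow]
  rw [hk, Nat.add_sub_cancel_left, pow_add]
  linear_combination (-r.coeff i * T⁻¹ ^ k) * hTi

/-- The difference I_1(Φ) - v solves the linear equation with forcing (Φ - q) + r - c T^L. Since r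
and T^L have degree below p, division by T^p leaves only negative powers. -/
theorem hasNegativePowerExpansion_canardOp_sub (hp : Odd p) (hL : Even L) (hLp : L < p)
    {Φ : ℝ → ℝ} (hΦ : Continuous Φ) {q v r : Polynomial ℝ}
    (h : HasNegativePowerExpansion fun T => Φ T - q.eval T) (hr : r.degree < p)
    (hv : v.derivative = Polynomial.C ((p : ℝ) + 1) * Polynomial.X ^ p * v + q - r) :
    HasNegativePowerExpansion fun T => canardOp p L 1 Φ T - v.eval T := by
  have hΦ' : HasLaurentExpansion Φ := ⟨q, h⟩
  refine hasNegativePowerExpansion_of_deriv hp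
    (fun T => (hasDerivAt_canardOp hp hΦ hΦ' T).sub (v.hasDerivAt T)) ?_ ?_
  · have hp0 : p ≠ 0 := by omega
    have h1 := (hasNegativePowerExpansion_inv_pow hp0).mul h
    have hr' : (r - Polynomial.C (canardConst p L Φ) * Polynomial.X ^ L).degree < (p : WithBot ℕ) := by
      refine (Polynomial.degree_sub_le _ _).trans_lt (max_lt hr ?_)
      refine (Polynomial.degree_C_mul_X_pow_le _ _).trans_lt ?_
      exact_mod_cast hLp
    convert h1.add (hasNegativePowerExpansion_inv_pow_mul_polynomial hr') using 2 with T
    rw [hv]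
    simp only [Polynomial.eval_sub, Polynomial.eval_add, Polynomial.eval_mul, Polynomial.eval_pow,
      Polynomial.eval_C, Polynomial.eval_X]
    ring
  · have hint := tendsto_canardOp_mul_exp hp hL hΦ hΦ'
    have hv0 : Tendsto (fun T => v.eval T * Real.exp (-T ^ (p + 1))) (atBot ⊔ atTop) (𝓝 0) := by
      obtain ⟨d, hd⟩ := (hasLaurentExpansion_polynomial v).exists_isBigO_pow
      refine ((hd.mul (isBigO_refl _ _)).trans (isBigO_pow_mul_exp_neg_pow p d hp)).trans_tendsto ?_
      have h2 : Tendsto (fun T : ℝ => 1 + T ^ 2) (atBot ⊔ atTop) atTop := by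
        refine tendsto_atTop_add_const_left _ _ (tendsto_sup.2 ⟨?_, ?_⟩)
        · refine ((tendsto_pow_atTop two_ne_zero).comp tendsto_neg_atBot_atTop).congr fun T => ?_
          simp
        · exact tendsto_pow_atTop two_ne_zero
      exact h2.inv_tendsto_atTop
    have := hint.sub hv0
    rw [sub_zero] at this
    exact this.congr fun T => by ring

theorem hasNegativePowerExpansion_canardOp (hp : Odd p) (hL : Even L) (hLp : L < p)
    {Φ : ℝ → ℝ} (hΦ : Continuous Φ) {r : Polynomial ℝ}
    (h : HasNegativePowerExpansion fun T => Φ T - r.eval T) (hr : r.degree < p) :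
    HasNegativePowerExpansion (canardOp p L 1 Φ) := by
  simpa using hasNegativePowerExpansion_canardOp_sub hp hL hLp hΦ (v := 0) h hr (by simp)

theorem hasLaurentExpansion_canardOp (hp : Odd p) (hL : Even L) (hLp : L < p) {Φ : ℝ → ℝ}
    (hΦ : Continuous Φ) (h : HasLaurentExpansion Φ) :
    HasLaurentExpansion (canardOp p L 1 Φ) := by
  obtain ⟨q, hq⟩ := h
  obtain ⟨v, r, hr, hv⟩ := exists_polynomial_solution (p := p) (by omega) q
  exact ⟨v, hasNegativePowerExpansion_canardOp_sub hp hL hLp hΦ hq hr hv⟩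

/-! ### Intermediary functions -/

theorem continuous_psi (hp : Odd p) (k : ℕ) : Continuous (psi p L k) :=
  continuous_canardOp hp (continuous_pow k) (hasLaurentExpansion_pow k)

theorem hasNegativePowerExpansion_psi (hp : Odd p) (hL : Even L) (hLp : L < p) {k : ℕ}
    (hk : k < p) : HasNegativePowerExpansion (psi p L k) :=
  hasNegativePowerExpansion_canardOp hp hL hLp (continuous_pow k) (r := Polynomial.X ^ k)
    (by simpa using hasNegativePowerExpansion_zero) (by simpa using hk)

theorem Intermediary.continuous_and_hasLaurentExpansion (hp : Odd p) (hL : Even L) (hLp : L < p)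
    {d : ℕ} {Φ : ℝ → ℝ} (h : Intermediary p L d Φ) : Continuous Φ ∧ HasLaurentExpansion Φ := by
  induction h with
  | one => exact ⟨continuous_const, by simpa using hasLaurentExpansion_pow 0⟩
  | mul_t _ ih => exact ⟨continuous_id.mul ih.1, ih.2.mul_self⟩
  | mul_eta _ ih => exact ih
  | mul_psi k hk _ ih =>
    exact ⟨(continuous_psi hp k).mul ih.1,
      (hasNegativePowerExpansion_psi hp hL hLp hk).hasLaurentExpansion.mul ih.2⟩
  | mul _ _ ih₁ ih₂ => exact ⟨ih₁.1.mul ih₂.1, ih₁.2.mul ih₂.2⟩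
  | comp _ ih =>
    exact ⟨continuous_canardOp hp ih.1 ih.2, hasLaurentExpansion_canardOp hp hL hLp ih.1 ih.2⟩

/-- The space spanned by the intermediary functions of order `n`, in the variable `T`. -/
noncomputable def intermediarySpan (p L n : ℕ) : Submodule ℝ (ℝ → ℝ) :=
  Submodule.span ℝ {Φ | Intermediary p L n Φ}

theorem continuous_and_hasLaurentExpansion_of_mem (hp : Odd p) (hL : Even L) (hLp : L < p)
    {n : ℕ} {Φ : ℝ → ℝ} (h : Φ ∈ intermediarySpan p L n) :
    Continuous Φ ∧ HasLaurentExpansion Φ := by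
  induction h using Submodule.span_induction with
  | mem Φ h => exact Intermediary.continuous_and_hasLaurentExpansion hp hL hLp h
  | zero => exact ⟨continuous_const, hasNegativePowerExpansion_zero.hasLaurentExpansion⟩
  | add Φ Θ _ _ h₁ h₂ => exact ⟨h₁.1.add h₂.1, h₁.2.add h₂.2⟩
  | smul r Φ _ h => exact ⟨h.1.const_smul r, h.2.const_mul r⟩

theorem mul_mem_intermediarySpan {m n : ℕ} {Φ Θ : ℝ → ℝ} (hΦ : Φ ∈ intermediarySpan p L m)
    (hΘ : Θ ∈ intermediarySpan p L n) : Φ * Θ ∈ intermediarySpan p L (m + n) := by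
  have := Submodule.mul_mem_mul hΦ hΘ
  rw [intermediarySpan, intermediarySpan, Submodule.span_mul_span] at this
  refine Submodule.span_mono ?_ this
  rintro _ ⟨Φ, hΦ, Θ, hΘ, rfl⟩
  exact Intermediary.mul hΦ hΘ

theorem map_mem_intermediarySpan {m n : ℕ} {Φ : ℝ → ℝ} (F : (ℝ → ℝ) →ₗ[ℝ] (ℝ → ℝ))
    (hF : ∀ Φ, Intermediary p L m Φ → F Φ ∈ intermediarySpan p L n)
    (hΦ : Φ ∈ intermediarySpan p L m) : F Φ ∈ intermediarySpan p L n :=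
  (Submodule.span_le (p := (intermediarySpan p L n).comap F)).2 hF hΦ

theorem intermediarySpan_le_succ (n : ℕ) : intermediarySpan p L n ≤ intermediarySpan p L (n + 1) :=
  Submodule.span_mono fun _ h => Intermediary.mul_eta h

theorem intermediarySpan_mono {m n : ℕ} (h : m ≤ n) :
    intermediarySpan p L m ≤ intermediarySpan p L n :=
  monotone_nat_of_le_succ (f := intermediarySpan p L) intermediarySpan_le_succ h

theorem const_mem_intermediarySpan (n : ℕ) (c : ℝ) :
    (fun _ => c) ∈ intermediarySpan p L n := by
  have h := (intermediarySpan p L 0).smul_mem c (Submodule.subset_span Intermediary.one)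
  convert intermediarySpan_mono (Nat.zero_le n) h using 1
  ext T
  simp

theorem mul_self_mem_intermediarySpan {n : ℕ} {Φ : ℝ → ℝ} (hΦ : Φ ∈ intermediarySpan p L n) :
    (fun T => T * Φ T) ∈ intermediarySpan p L (n + 1) :=
  map_mem_intermediarySpan (LinearMap.mulLeft ℝ (fun T : ℝ => T))
    (fun _ h => Submodule.subset_span h.mul_t) hΦ

theorem canardOp_mem_intermediarySpan (hp : Odd p) (hL : Even L) (hLp : L < p) {n : ℕ}
    {Φ : ℝ → ℝ} (h : Φ ∈ intermediarySpan p L n) :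
    canardOp p L 1 Φ ∈ intermediarySpan p L (n + 1) := by
  induction h using Submodule.span_induction with
  | mem Φ h => exact Submodule.subset_span h.comp
  | zero =>
    have : canardOp p L 1 0 = 0 := by
      have h := canardOp_const_mul (p := p) (L := L) 0 0
      simp only [zero_mul] at h
      exact h
    rw [this]
    exact Submodule.zero_mem _
  | add Φ Θ h₁ h₂ ih₁ ih₂ =>
    obtain ⟨h₁, h₁'⟩ := continuous_and_hasLaurentExpansion_of_mem hp hL hLp h₁
    obtain ⟨h₂, h₂'⟩ := continuous_and_hasLaurentExpansion_of_mem hp hL hLp h₂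
    have := canardOp_add (L := L) hp h₁ h₁' h₂ h₂'
    exact this ▸ Submodule.add_mem _ ih₁ ih₂
  | smul r Φ _ ih =>
    exact canardOp_const_mul (p := p) (L := L) r Φ ▸ Submodule.smul_mem _ r ih

/-! ### Brackets and their stability under the operations. -/

/-- The linear span of the functions `[Φ]`, with `Φ` intermediary of order `n`. -/
noncomputable def bracketSpan (p L n : ℕ) : Submodule ℝ (ℝ → ℝ) where
  carrier := {φ | φ ∈ intermediarySpan p L n ∧ HasNegativePowerExpansion φ}
  add_mem' h₁ h₂ := ⟨Submodule.add_mem _ h₁.1 h₂.1, h₁.2.add h₂.2⟩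
  zero_mem' := ⟨Submodule.zero_mem _, hasNegativePowerExpansion_zero⟩
  smul_mem' r _ h := ⟨Submodule.smul_mem _ r h.1, h.2.const_mul r⟩

theorem bracketSpan_mono {m n : ℕ} (h : m ≤ n) : bracketSpan p L m ≤ bracketSpan p L n :=
  fun _ hφ => ⟨intermediarySpan_mono h hφ.1, hφ.2⟩

theorem mul_mem_bracketSpan {m n : ℕ} {φ θ : ℝ → ℝ} (hφ : φ ∈ bracketSpan p L m)
    (hθ : θ ∈ bracketSpan p L n) : φ * θ ∈ bracketSpan p L (m + n) :=
  ⟨mul_mem_intermediarySpan hφ.1 hθ.1, hφ.2.mul hθ.2⟩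

theorem exists_mul_self_sub_mem_bracketSpan {n : ℕ} {φ : ℝ → ℝ} (hφ : φ ∈ bracketSpan p L n) :
    ∃ c : ℝ, (fun T => T * φ T - c) ∈ bracketSpan p L (n + 1) := by
  obtain ⟨c, hc⟩ := hφ.2.exists_mul_self_sub
  exact ⟨c, Submodule.sub_mem _ (mul_self_mem_intermediarySpan hφ.1)
    (const_mem_intermediarySpan _ c), hc⟩

theorem continuous_of_mem_bracketSpan (hp : Odd p) (hL : Even L) (hLp : L < p) {n : ℕ} {φ : ℝ → ℝ}
    (hφ : φ ∈ bracketSpan p L n) : Continuous φ :=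
  (continuous_and_hasLaurentExpansion_of_mem hp hL hLp hφ.1).1

/-- A forcing without polynomial part produces none: q = r = 0 is allowed in the preceding analysis,
with v = 0. -/
theorem canardOp_mem_bracketSpan (hp : Odd p) (hL : Even L) (hLp : L < p) {n : ℕ} {φ : ℝ → ℝ}
    (hφ : φ ∈ bracketSpan p L n) : canardOp p L 1 φ ∈ bracketSpan p L (n + 1) :=
  ⟨canardOp_mem_intermediarySpan hp hL hLp hφ.1,
    hasNegativePowerExpansion_canardOp hp hL hLp (continuous_of_mem_bracketSpan hp hL hLp hφ)
      (r := 0) (by simpa using hφ.2) (by simp)⟩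

theorem psi_mem_bracketSpan (hp : Odd p) (hL : Even L) (hLp : L < p) {k : ℕ} (hk : k < p) (n : ℕ) :
    psi p L k ∈ bracketSpan p L n := by
  refine bracketSpan_mono (Nat.zero_le n) ⟨Submodule.subset_span ?_,
    hasNegativePowerExpansion_psi hp hL hLp hk⟩
  simpa using Intermediary.mul_psi (p := p) (L := L) k hk Intermediary.one

theorem exists_bound_of_mem_bracketSpan (hp : Odd p) (hL : Even L) (hLp : L < p) {n : ℕ}
    {φ : ℝ → ℝ} (hφ : φ ∈ bracketSpan p L n) : ∃ K : ℝ, ∀ T, |φ T| ≤ K := by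
  have hb := (continuous_of_mem_bracketSpan hp hL hLp hφ).isBounded_range_iff_isBigO.2
    (cocompact_eq_atBot_atTop (α := ℝ) ▸ hφ.2.tendsto.isBigO_one ℝ)
  obtain ⟨K, hK⟩ := hb.exists_norm_le
  exact ⟨K, fun T => hK _ ⟨T, rfl⟩⟩

/-- `bracketSpan` is defined by two conditions because products and I_1 visibly preserve them. To
return to the monomials, write φ as a combination of intermediary functions and subtract the
polynomial part of each; the total polynomial part is zero by uniqueness, so φ is the same
combination of brackets. -/
theorem bracketSpan_le_span (hp : Odd p) (hL : Even L) (hLp : L < p) (n : ℕ) :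
    bracketSpan p L n ≤ Submodule.span ℝ (B p L n) := by
  have key : ∀ Φ ∈ intermediarySpan p L n,
      ∃ q : Polynomial ℝ, (fun T => Φ T - q.eval T) ∈ Submodule.span ℝ (B p L n) ∧
        HasNegativePowerExpansion fun T => Φ T - q.eval T := by
    intro Φ h
    induction h using Submodule.span_induction with
    | mem Φ h =>
      obtain ⟨q, hq⟩ := (Intermediary.continuous_and_hasLaurentExpansion hp hL hLp h).2
      exact ⟨q, Submodule.subset_span ⟨Φ, h, hq, q, fun _ => rfl⟩, hq⟩
    | zero =>
      refine ⟨0, ?_, by simpa using hasNegativePowerExpansion_zero⟩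
      convert Submodule.zero_mem (Submodule.span ℝ (B p L n)) using 1
      ext T
      simp
    | add Φ Θ _ _ h₁ h₂ =>
      obtain ⟨q, hq, hq'⟩ := h₁
      obtain ⟨r, hr, hr'⟩ := h₂
      have : (fun T => (Φ + Θ) T - (q + r).eval T)
          = (fun T => Φ T - q.eval T) + fun T => Θ T - r.eval T := by
        ext T
        simp only [Pi.add_apply, Polynomial.eval_add]
        ring
      exact ⟨q + r, this ▸ Submodule.add_mem _ hq hr, this ▸ hq'.add hr'⟩
    | smul c Φ _ h =>
      obtain ⟨q, hq, hq'⟩ := h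
      have : (fun T => (c • Φ) T - (Polynomial.C c * q).eval T)
          = c • fun T => Φ T - q.eval T := by
        ext T
        simp only [Pi.smul_apply, smul_eq_mul, Polynomial.eval_mul, Polynomial.eval_C]
        ring
      exact ⟨Polynomial.C c * q, this ▸ Submodule.smul_mem _ c hq, this ▸ hq'.const_mul c⟩
  intro φ hφ
  obtain ⟨q, hq, hq'⟩ := key φ hφ.1
  -- Both φ and φ - q have expansions in negative powers, hence so has the polynomial q.
  have hq0 : q = 0 := by
    refine eq_zero_of_hasNegativePowerExpansion_polynomial ?_
    convert hφ.2.add (hq'.const_mul (-1)) using 2 with T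
    ring
  simpa [hq0] using hq

end Canard

namespace Canard

/-! ### Stability of the linear equation on a bounded interval -/

/-- The barrier is 3(1 + exp(-T)). Near 0 the factor T^p gives no damping, and the decrease of 3
exp(-T), at least 1 on [0, 1] because e < 3, replaces it; for T ≥ 1 the term in T^p suffices. -/
theorem barrier_deriv_le {p : ℕ} (hp : p ≠ 0) {T : ℝ} (hT : 0 ≤ T) :
    3 * -Real.exp (-T) - (p + 1) * T ^ p * (3 * (1 + Real.exp (-T))) ≤ -(1 + T ^ p) := by
  have hTp : 0 ≤ T ^ p := pow_nonneg hT p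
  have he := Real.exp_pos (-T)
  have hp1 : (1 : ℝ) ≤ p := by exact_mod_cast Nat.one_le_iff_ne_zero.2 hp
  have h1 : 0 ≤ ((p : ℝ) + 1) * T ^ p * (3 * Real.exp (-T)) := by positivity
  have h2 : 2 * T ^ p ≤ ((p : ℝ) + 1) * T ^ p := by gcongr; linarith
  rcases le_total T 1 with h | h
  · have h3 : 1 / 3 ≤ Real.exp (-T) := by
      have h4 : Real.exp (-1) ≤ Real.exp (-T) := Real.exp_le_exp.2 (by linarith)
      have h5 : (1 : ℝ) / 3 ≤ Real.exp (-1) := by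
        rw [Real.exp_neg, one_div]
        exact inv_anti₀ (Real.exp_pos 1) Real.exp_one_lt_three.le
      linarith
    linarith
  · have h3 : 1 ≤ T ^ p := one_le_pow₀ h
    linarith

/-- D times the barrier, plus ±w, multiplied by exp(-T^(p+1)), is nonincreasing; its values at T and
X are compared. The barrier is at most 6 on [0, +∞), whence the constant. -/
theorem abs_mul_exp_sub_le {p : ℕ} (hp : p ≠ 0) {w w' : ℝ → ℝ} {X D : ℝ} (hD : 0 ≤ D)
    (hw : ∀ T ∈ Icc 0 X, HasDerivAt w (w' T) T)
    (h : ∀ T ∈ Icc 0 X, |w' T - (p + 1) * T ^ p * w T| ≤ D * (1 + T ^ p)) :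
    ∀ T ∈ Icc 0 X, |w T * Real.exp (-T ^ (p + 1)) - w X * Real.exp (-X ^ (p + 1))|
      ≤ 6 * D * Real.exp (-T ^ (p + 1)) := by
  intro T hT
  have key : ∀ s : ℝ, |s| = 1 →
      s * (w X * Real.exp (-X ^ (p + 1)) - w T * Real.exp (-T ^ (p + 1)))
        ≤ 6 * D * Real.exp (-T ^ (p + 1)) := by
    intro s hs
    have hderiv : ∀ T ∈ Icc 0 X, HasDerivAt
        (fun T => (D * (3 * (1 + Real.exp (-T))) + s * w T) * Real.exp (-T ^ (p + 1)))
        ((D * (3 * -Real.exp (-T)) + s * w' T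
          - (p + 1) * T ^ p * (D * (3 * (1 + Real.exp (-T))) + s * w T))
            * Real.exp (-T ^ (p + 1))) T := fun T hT => by
      have he : HasDerivAt (fun T : ℝ => Real.exp (-T)) (-Real.exp (-T)) T := by
        simpa using (hasDerivAt_neg T).exp
      exact hasDerivAt_mul_exp_neg_pow
        ((((he.const_add 1).const_mul 3).const_mul D).add ((hw T hT).const_mul s))
    have hanti : AntitoneOn
        (fun T => (D * (3 * (1 + Real.exp (-T))) + s * w T) * Real.exp (-T ^ (p + 1)))
        (Icc 0 X) := by
      refine antitoneOn_of_hasDerivWithinAt_nonpos (convex_Icc 0 X)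
        (fun T hT => (hderiv T hT).continuousAt.continuousWithinAt)
        (fun T hT => (hderiv T (interior_subset hT)).hasDerivWithinAt) fun T hT => ?_
      have hT := interior_subset hT
      refine mul_nonpos_of_nonpos_of_nonneg ?_ (Real.exp_pos _).le
      have h1 : |s * (w' T - (p + 1) * T ^ p * w T)| ≤ D * (1 + T ^ p) := by
        rw [abs_mul, hs, one_mul]
        exact h T hT
      have h2 := mul_le_mul_of_nonneg_left (barrier_deriv_le hp hT.1) hD
      have h3 := (abs_le.1 h1).2
      linarith
    have h1 := hanti hT (right_mem_Icc.2 (hT.1.trans hT.2)) hT.2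
    simp only at h1
    have h2 : 0 ≤ D * (3 * (1 + Real.exp (-X))) * Real.exp (-X ^ (p + 1)) := by positivity
    have h3 : D * (3 * (1 + Real.exp (-T))) * Real.exp (-T ^ (p + 1))
        ≤ 6 * D * Real.exp (-T ^ (p + 1)) := by
      refine mul_le_mul_of_nonneg_right ?_ (Real.exp_pos _).le
      have : Real.exp (-T) ≤ 1 := Real.exp_le_one_iff.2 (neg_nonpos.2 hT.1)
      nlinarith
    linarith
  rw [abs_le]
  have h1 := key 1 (by simp)
  have h2 := key (-1) (by simp)
  constructor <;> linarith

/-- A primitive of `T ^ L * exp (-T ^ (p + 1))`. -/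
noncomputable def weightPrimitive (p L : ℕ) (X : ℝ) : ℝ :=
  ∫ y in (0 : ℝ)..X, y ^ L * Real.exp (-y ^ (p + 1))

theorem hasDerivAt_weightPrimitive (p L : ℕ) (T : ℝ) :
    HasDerivAt (weightPrimitive p L) (T ^ L * Real.exp (-T ^ (p + 1))) T := by
  have hc : Continuous fun y : ℝ => y ^ L * Real.exp (-y ^ (p + 1)) := by fun_prop
  exact intervalIntegral.integral_hasDerivAt_right (hc.intervalIntegrable _ _)
    (hc.stronglyMeasurableAtFilter _ _) hc.continuousAt

theorem weightPrimitive_one_pos (p L : ℕ) : 0 < weightPrimitive p L 1 := by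
  refine intervalIntegral.intervalIntegral_pos_of_pos_on
    ((by fun_prop : Continuous fun y : ℝ => y ^ L * Real.exp (-y ^ (p + 1))).intervalIntegrable _ _)
    (fun y hy => ?_) zero_lt_one
  have := hy.1
  positivity

theorem weightPrimitive_one_le (p L : ℕ) {X : ℝ} (hX : 1 ≤ X) :
    weightPrimitive p L 1 ≤ weightPrimitive p L X := by
  have hm : MonotoneOn (weightPrimitive p L) (Ici 0) :=
    monotoneOn_of_hasDerivWithinAt_nonneg (convex_Ici 0)
      (fun T _ => (hasDerivAt_weightPrimitive p L T).continuousAt.continuousWithinAt)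
      (fun T _ => (hasDerivAt_weightPrimitive p L T).hasDerivWithinAt)
      (fun T hT => mul_nonneg (pow_nonneg (interior_subset hT) L) (Real.exp_pos _).le)
  exact hm (mem_Ici.2 zero_le_one) (mem_Ici.2 (zero_le_one.trans hX)) hX

/-- The term β T^L is removed by subtracting β exp(T^(p+1)) times the primitive of the weight, an
exact solution vanishing at 0. At X its exponential cancels the weight, so β is tied to w(0) and
w(X) up to 6ε. -/
theorem abs_sub_mul_exp_add_weight_le {p L : ℕ} (hp : p ≠ 0) {w w' : ℝ → ℝ} {X ε β : ℝ}
    (hX : 0 ≤ X) (hε : 0 ≤ ε) (hw : ∀ T ∈ Icc 0 X, HasDerivAt w (w' T) T)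
    (h : ∀ T ∈ Icc 0 X, |w' T - (p + 1) * T ^ p * w T - β * T ^ L| ≤ ε * (1 + T ^ p)) :
    |w 0 - w X * Real.exp (-X ^ (p + 1)) + β * weightPrimitive p L X| ≤ 6 * ε := by
  have he : ∀ T : ℝ, Real.exp (T ^ (p + 1)) * Real.exp (-T ^ (p + 1)) = 1 := fun T => by
    rw [← Real.exp_add, add_neg_cancel, Real.exp_zero]
  have hd : ∀ T ∈ Icc 0 X, HasDerivAt
      (fun T => w T - β * (weightPrimitive p L T * Real.exp (T ^ (p + 1))))
      (w' T - β * (T ^ L + weightPrimitive p L T * (Real.exp (T ^ (p + 1)) * ((p + 1) * T ^ p))))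
      T := by
    intro T hT
    have h2 : HasDerivAt (fun T : ℝ => Real.exp (T ^ (p + 1)))
        (Real.exp (T ^ (p + 1)) * ((p + 1) * T ^ p)) T := by
      have := (hasDerivAt_pow (p + 1) T).exp
      rwa [Nat.add_sub_cancel, Nat.cast_add, Nat.cast_one] at this
    refine ((hw T hT).sub (((hasDerivAt_weightPrimitive p L T).mul h2).const_mul β)).congr_deriv ?_
    have := he T
    linear_combination (-β * T ^ L) * this
  have := abs_mul_exp_sub_le hp hε hd (fun T hT => ?_) 0 (left_mem_Icc.2 hX)
  · simp only [weightPrimitive, intervalIntegral.integral_same, mul_zero, sub_zero, ne_eq,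
      Nat.add_eq_zero_iff, one_ne_zero, and_false, not_false_eq_true, zero_pow, neg_zero,
      Real.exp_zero, mul_one] at this
    convert this using 2
    rw [weightPrimitive]
    have := he X
    linear_combination (-β * ∫ y in (0 : ℝ)..X, y ^ L * Real.exp (-y ^ (p + 1))) * this
  · convert h T hT using 2
    ring

/-- The previous relation is applied on [0, X] and, after reflection, on [-X, 0]. Since p is odd and
L even, β changes sign in the second, and subtraction eliminates w(0) and bounds β. Then β T^L is a
small error, and the barrier on each half bounds w. -/
theorem exists_stability_constant {p L : ℕ} (hp : Odd p) (hL : Even L) (hLp : L < p) :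
    ∃ C : ℝ, 0 ≤ C ∧ ∀ (X ε M β : ℝ) (w w' : ℝ → ℝ), 1 ≤ X → 0 ≤ ε →
      (∀ T ∈ Icc (-X) X, HasDerivAt w (w' T) T) →
      (∀ T ∈ Icc (-X) X, |w' T - (p + 1) * T ^ p * w T - β * T ^ L| ≤ ε * (1 + |T| ^ p)) →
      |w X| ≤ M → |w (-X)| ≤ M →
      |β| ≤ C * (ε + M * Real.exp (-X ^ (p + 1))) ∧
      ∀ T ∈ Icc (-X) X, |w T| ≤ C * (ε + M * Real.exp (T ^ (p + 1) - X ^ (p + 1))) := by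
  have hp0 : p ≠ 0 := by omega
  set Q := weightPrimitive p L 1 with hQ
  have hQ0 : 0 < Q := weightPrimitive_one_pos p L
  -- 6/Q bounds β; w is bounded by 6(|β| + ε) plus the boundary term, which costs 36/Q + 7.
  refine ⟨7 + 36 / Q + 1 / Q * 6, by positivity, ?_⟩
  intro X ε M β w w' hX hε hw h hM hM'
  have hX0 : 0 ≤ X := zero_le_one.trans hX
  have hM0 : 0 ≤ M := (abs_nonneg _).trans hM
  have hpos : ∀ T ∈ Icc 0 X, T ∈ Icc (-X) X := fun T hT => ⟨by linarith [hT.1], hT.2⟩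
  have hneg : ∀ T ∈ Icc 0 X, -T ∈ Icc (-X) X := fun T hT =>
    ⟨by linarith [hT.2], by linarith [hT.1]⟩
  have hw1 : ∀ T ∈ Icc 0 X, HasDerivAt w (w' T) T := fun T hT => hw T (hpos T hT)
  have hw2 : ∀ T ∈ Icc 0 X, HasDerivAt (fun T => w (-T)) (-w' (-T)) T := fun T hT =>
    hasDerivAt_comp_neg (hw (-T) (hneg T hT))
  have h1 : ∀ T ∈ Icc 0 X, |w' T - (p + 1) * T ^ p * w T - β * T ^ L| ≤ ε * (1 + T ^ p) :=
    fun T hT => by simpa [abs_of_nonneg hT.1] using h T (hpos T hT)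
  have h2 : ∀ T ∈ Icc 0 X, |-w' (-T) - (p + 1) * T ^ p * w (-T) - -β * T ^ L|
      ≤ ε * (1 + T ^ p) := fun T hT => by
    have := h (-T) (hneg T hT)
    rw [abs_neg, abs_of_nonneg hT.1, hp.neg_pow, hL.neg_pow, ← abs_neg] at this
    convert this using 2
    ring
  have e1 := abs_sub_mul_exp_add_weight_le hp0 hX0 hε hw1 h1
  have e2 := abs_sub_mul_exp_add_weight_le hp0 hX0 hε hw2 h2
  simp only [neg_zero] at e2
  set e := Real.exp (-X ^ (p + 1)) with he_def
  have he0 : 0 < e := Real.exp_pos _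
  have hQX := weightPrimitive_one_le p L hX
  rw [← hQ] at hQX
  have hβ : |β| * Q ≤ 6 * ε + M * e := by
    have a1 : |w X * e| ≤ M * e := by rw [abs_mul, abs_of_pos he0]; gcongr
    have a2 : |w (-X) * e| ≤ M * e := by rw [abs_mul, abs_of_pos he0]; gcongr
    -- Half the difference of `e1` and `e2`: w(0) cancels and the two terms in β add up.
    have a3 : |β * weightPrimitive p L X| ≤ 6 * ε + M * e := by
      rw [abs_le] at *
      constructor <;> linarith [a1.1, a1.2, a2.1, a2.2, e1.1, e1.2, e2.1, e2.2]
    rw [abs_mul, abs_of_pos (hQ0.trans_le hQX)] at a3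
    exact (mul_le_mul_of_nonneg_left hQX (abs_nonneg β)).trans a3
  have hβ' : |β| ≤ 6 / Q * (ε + M * e) := by
    rw [div_mul_eq_mul_div, le_div_iff₀ hQ0]
    have : 0 ≤ M * e := by positivity
    linarith
  have hMe : 0 ≤ M * e := by positivity
  constructor
  · refine hβ'.trans (mul_le_mul_of_nonneg_right ?_ (by positivity))
    have : 0 < 36 / Q := by positivity
    rw [one_div_mul_eq_div]
    linarith
  have hD0 : 0 ≤ |β| + ε := by positivity
  have hforce : ∀ T : ℝ, 0 ≤ T → ∀ b y : ℝ, |b| = |β| →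
      |y - b * T ^ L| ≤ ε * (1 + T ^ p) → |y| ≤ (|β| + ε) * (1 + T ^ p) := by
    intro T hT b y hb hy
    have hTL : T ^ L ≤ 1 + T ^ p := by
      rcases le_total T 1 with h | h
      · have := pow_le_one₀ (n := L) hT h
        have := pow_nonneg hT p
        linarith
      · have := pow_le_pow_right₀ h hLp.le
        linarith
    have hb' : |b * T ^ L| ≤ |β| * (1 + T ^ p) := by
      rw [abs_mul, hb, abs_of_nonneg (pow_nonneg hT L)]
      gcongr
    calc |y| = |(y - b * T ^ L) + b * T ^ L| := by ring_nf
      _ ≤ _ := (abs_add_le _ _).trans (add_le_add hy hb')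
      _ = _ := by ring
  -- Now β T^L is counted as error, thanks to T^L ≤ 1 + T^p.
  have f1 := abs_mul_exp_sub_le hp0 hD0 hw1 fun T hT => hforce T hT.1 β _ rfl (h1 T hT)
  have f2 := abs_mul_exp_sub_le hp0 hD0 hw2 fun T hT =>
    hforce T hT.1 (-β) _ (abs_neg β) (h2 T hT)
  have hfin : ∀ T : ℝ, ∀ a b : ℝ, |b| ≤ M → |a * Real.exp (-T ^ (p + 1)) - b * e|
      ≤ 6 * (|β| + ε) * Real.exp (-T ^ (p + 1)) →
      |a| ≤ 6 * (|β| + ε) + M * Real.exp (T ^ (p + 1) - X ^ (p + 1)) := by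
    intro T a b hb hab
    have hE : Real.exp (T ^ (p + 1)) * Real.exp (-T ^ (p + 1)) = 1 := by
      rw [← Real.exp_add, add_neg_cancel, Real.exp_zero]
    have hE' : Real.exp (T ^ (p + 1) - X ^ (p + 1)) = Real.exp (T ^ (p + 1)) * e := by
      rw [he_def, ← Real.exp_add, sub_eq_add_neg]
    have c1 : |b * e| ≤ M * e := by rw [abs_mul, abs_of_pos he0]; gcongr
    have c2 : |a| * Real.exp (-T ^ (p + 1))
        ≤ 6 * (|β| + ε) * Real.exp (-T ^ (p + 1)) + M * e := by
      rw [← abs_of_pos (Real.exp_pos (-T ^ (p + 1))), ← abs_mul,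
        abs_of_pos (Real.exp_pos (-T ^ (p + 1)))]
      have := abs_add_le (a * Real.exp (-T ^ (p + 1)) - b * e) (b * e)
      rw [sub_add_cancel] at this
      linarith
    have c3 := mul_le_mul_of_nonneg_left c2 (Real.exp_pos (T ^ (p + 1))).le
    rw [hE']
    calc |a| = Real.exp (T ^ (p + 1)) * (|a| * Real.exp (-T ^ (p + 1))) := by
          linear_combination (-|a|) * hE
      _ ≤ _ := c3
      _ = _ := by linear_combination (6 * (|β| + ε)) * hE
  have hall : ∀ T ∈ Icc (-X) X,
      |w T| ≤ 6 * (|β| + ε) + M * Real.exp (T ^ (p + 1) - X ^ (p + 1)) := by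
    intro T hT
    rcases le_total 0 T with h0 | h0
    · exact hfin T _ _ hM (f1 T ⟨h0, hT.2⟩)
    · have := hfin (-T) _ _ hM' (f2 (-T) ⟨by linarith, by linarith [hT.1]⟩)
      rwa [neg_neg, hp.add_one.neg_pow] at this
  intro T hT
  refine (hall T hT).trans ?_
  have hTe : e ≤ Real.exp (T ^ (p + 1) - X ^ (p + 1)) := by
    rw [he_def]
    have := hp.add_one.pow_nonneg T
    exact Real.exp_le_exp.2 (by linarith)
  set E := Real.exp (T ^ (p + 1) - X ^ (p + 1))
  have hME : M * e ≤ M * E := mul_le_mul_of_nonneg_left hTe hM0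
  have hb2 : |β| ≤ 6 / Q * (ε + M * E) := hβ'.trans (by gcongr)
  have hp1 : 0 ≤ 1 / Q * 6 * (ε + M * E) := by positivity
  have hp2 : 0 ≤ ε + M * E := by positivity
  have hp3 : 0 ≤ M * E := by positivity
  have : 36 / Q * (ε + M * E) = 6 * (6 / Q * (ε + M * E)) := by ring
  nlinarith

end Canard

namespace Canard

/-! ### Smooth functions: division by the variable, cutoff, Taylor expansion -/

theorem hasDerivAt_integral_pow_mul_comp_mul {f : ℝ → ℝ} (hf : ContDiff ℝ 1 f) (m : ℕ) (t : ℝ) :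
    HasDerivAt (fun t => ∫ s in (0 : ℝ)..1, s ^ m * f (t * s))
      (∫ s in (0 : ℝ)..1, s ^ (m + 1) * deriv f (t * s)) t := by
  have hc : Continuous f := hf.continuous
  have hc' : Continuous (deriv f) := hf.continuous_deriv le_rfl
  obtain ⟨K, hK⟩ := (isCompact_Icc (a := -(|t| + 1)) (b := |t| + 1)).exists_bound_of_continuousOn
    hc'.continuousOn
  refine (intervalIntegral.hasDerivAt_integral_of_dominated_loc_of_deriv_le
    (F' := fun t s => s ^ (m + 1) * deriv f (t * s)) (bound := fun _ => K)
    (Metric.ball_mem_nhds t one_pos) ?_ ?_ ?_ ?_ ?_ ?_).2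
  · exact Eventually.of_forall fun x => (by fun_prop :
      Continuous fun s => s ^ m * f (x * s)).aestronglyMeasurable
  · exact (by fun_prop : Continuous fun s => s ^ m * f (t * s)).intervalIntegrable _ _
  · exact (by fun_prop : Continuous fun s => s ^ (m + 1) * deriv f (t * s)).aestronglyMeasurable
  · refine Eventually.of_forall fun s hs x hx => ?_
    rw [uIoc_of_le zero_le_one] at hs
    have hx' : |x| ≤ |t| + 1 := by
      have h1 : |x - t| < 1 := by simpa [Real.dist_eq] using hx
      have h2 := abs_add_le (x - t) t
      rw [sub_add_cancel] at h2
      linarith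
    have h1 : |x * s| ≤ |t| + 1 := by
      rw [abs_mul, abs_of_pos hs.1]
      exact (mul_le_of_le_one_right (abs_nonneg x) hs.2).trans hx'
    have h2 := hK (x * s) (abs_le.1 h1)
    rw [norm_mul, norm_pow, Real.norm_of_nonneg hs.1.le]
    exact (mul_le_of_le_one_left (norm_nonneg _) (pow_le_one₀ hs.1.le hs.2)).trans h2
  · exact intervalIntegrable_const
  · refine Eventually.of_forall fun s _ x _ => ?_
    have h1 := ((hf.differentiable one_ne_zero (x * s)).hasDerivAt.comp x
      ((hasDerivAt_id x).mul_const s)).const_mul (s ^ m)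
    refine h1.congr_deriv ?_
    ring

/-- The derivative is an integral of the same kind, with f' and m + 1; the exponent m is there to
make the induction close. -/
theorem contDiff_integral_pow_mul_comp_mul {f : ℝ → ℝ} (hf : ContDiff ℝ ∞ f) (m : ℕ) :
    ContDiff ℝ ∞ fun t => ∫ s in (0 : ℝ)..1, s ^ m * f (t * s) := by
  rw [contDiff_infty]
  intro n
  induction n generalizing f m with
  | zero =>
    have : Differentiable ℝ fun t => ∫ s in (0 : ℝ)..1, s ^ m * f (t * s) := fun t =>
      (hasDerivAt_integral_pow_mul_comp_mul (hf.of_le (by norm_cast)) m t).differentiableAt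
    exact contDiff_zero.2 this.continuous
  | succ n ih =>
    have hd := hasDerivAt_integral_pow_mul_comp_mul (hf.of_le (by norm_cast)) m
    rw [Nat.cast_succ, contDiff_succ_iff_deriv]
    refine ⟨fun t => (hd t).differentiableAt, by simp, ?_⟩
    rw [funext fun t => (hd t).deriv]
    exact ih (contDiff_infty_iff_deriv.1 hf).2 (m + 1)

/-- Hadamard's lemma: h(t) is the integral of g'(ts) over s in [0, 1]. -/
theorem exists_contDiff_eq_add_mul {g : ℝ → ℝ} (hg : ContDiff ℝ ∞ g) :
    ∃ h : ℝ → ℝ, ContDiff ℝ ∞ h ∧ ∀ t, g t = g 0 + t * h t := by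
  refine ⟨_, contDiff_integral_pow_mul_comp_mul (contDiff_infty_iff_deriv.1 hg).2 0, fun t => ?_⟩
  have hd : ∀ s ∈ uIcc (0 : ℝ) 1, HasDerivAt (fun s => g (t * s)) (t * deriv g (t * s)) s := by
    intro s _
    have := (hg.differentiable (by simp) (t * s)).hasDerivAt.comp s ((hasDerivAt_id s).const_mul t)
    refine this.congr_deriv ?_
    ring
  have hc : Continuous (deriv g) := (contDiff_infty_iff_deriv.1 hg).2.continuous
  have := intervalIntegral.integral_eq_sub_of_hasDerivAt hd
    ((by fun_prop : Continuous fun s => t * deriv g (t * s)).intervalIntegrable _ _)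
  simp only [pow_zero, one_mul]
  rw [← intervalIntegral.integral_const_mul, this]
  simp

theorem iteratedDeriv_id_mul_zero {h : ℝ → ℝ} (hh : ContDiff ℝ ∞ h) (n : ℕ) (t : ℝ) :
    iteratedDeriv (n + 1) (fun t => t * h t) t
      = t * iteratedDeriv (n + 1) h t + (n + 1) * iteratedDeriv n h t := by
  have hd : ∀ m : ℕ, Differentiable ℝ (iteratedDeriv m h) := fun m =>
    hh.differentiable_iteratedDeriv m (by exact_mod_cast ENat.natCast_lt_top m)
  induction n generalizing t with
  | zero =>
    rw [iteratedDeriv_one, iteratedDeriv_one, iteratedDeriv_zero]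
    have : deriv (fun t => t * h t) t = 1 * h t + t * deriv h t :=
      ((hasDerivAt_id t).mul (hh.differentiable (by simp) t).hasDerivAt).deriv
    simpa [add_comm] using this
  | succ n ih =>
    rw [iteratedDeriv_succ, funext ih]
    have h1 := (hasDerivAt_id t).mul (hd (n + 1) t).hasDerivAt
    have h2 := (hd n t).hasDerivAt.const_mul ((n : ℝ) + 1)
    have := (h1.add h2).deriv
    simp only [id] at this
    refine this.trans ?_
    rw [← iteratedDeriv_succ, ← iteratedDeriv_succ]
    push_cast
    ring

/-- Repeated division by t: if g = t k, the derivative of order i + 1 of g at 0 is (i + 1) times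
that of order i of k. -/
theorem exists_contDiff_eq_pow_mul {g : ℝ → ℝ} (hg : ContDiff ℝ ∞ g) (m : ℕ)
    (h0 : ∀ i < m, iteratedDeriv i g 0 = 0) :
    ∃ h : ℝ → ℝ, ContDiff ℝ ∞ h ∧ ∀ t, g t = t ^ m * h t := by
  induction m generalizing g with
  | zero => exact ⟨g, hg, fun t => by simp⟩
  | succ m ih =>
    obtain ⟨k, hk, hgk⟩ := exists_contDiff_eq_add_mul hg
    have hg0 : g 0 = 0 := by simpa using h0 0 (Nat.succ_pos m)
    have hgk' : g = fun t => t * k t := funext fun t => by rw [hgk t, hg0, zero_add]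
    obtain ⟨h, hh, hkh⟩ := ih hk fun i hi => by
      have := h0 (i + 1) (by omega)
      rw [hgk', iteratedDeriv_id_mul_zero hk, zero_mul, zero_add] at this
      exact (mul_eq_zero.1 this).resolve_left (by positivity)
    exact ⟨h, hh, fun t => by rw [hgk', pow_succ', mul_assoc, ← hkh t]⟩

/-- Multiplication by a bump function equal to 1 on [-R, R] and supported inside (-t₀, t₀). Giving
up a little of the interval makes all coefficients smooth on the whole line. -/
theorem exists_contDiff_eqOn {f : ℝ → ℝ} {t₀ R : ℝ} (hR : 0 < R) (hRt : R < t₀)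
    (hf : ContDiffOn ℝ ∞ f (Icc (-t₀) t₀)) :
    ∃ g : ℝ → ℝ, ContDiff ℝ ∞ g ∧ ∀ t ∈ Icc (-R) R, g t = f t := by
  let χ : ContDiffBump (0 : ℝ) := ⟨R, (R + t₀) / 2, hR, by linarith⟩
  refine ⟨fun t => χ t * f t, contDiff_iff_contDiffAt.2 fun t => ?_, fun t ht => ?_⟩
  · rcases lt_or_ge |t| t₀ with ht | ht
    · exact χ.contDiff.contDiffAt.mul (hf.contDiffAt (Icc_mem_nhds (abs_lt.1 ht).1 (abs_lt.1 ht).2))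
    · have h0 : (fun t => χ t * f t) =ᶠ[𝓝 t] fun _ => 0 := by
        have : ∀ᶠ x in 𝓝 t, (R + t₀) / 2 < |x| :=
          continuous_abs.continuousAt.eventually_const_lt (by linarith)
        filter_upwards [this] with x hx
        rw [χ.zero_of_le_dist (by simpa [Real.dist_eq] using hx.le), zero_mul]
      exact contDiffAt_const.congr_of_eventuallyEq h0
  · have : χ t = 1 := χ.one_of_mem_closedBall (by
      rw [Metric.mem_closedBall, Real.dist_eq, sub_zero]
      exact abs_le.2 ht)
    simp [this]

/-! ### Taylor expansions with remainder uniform in t. -/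

variable {E : Type*} [NormedAddCommGroup E] [NormedSpace ℝ E]

theorem iteratedDerivWithin_comp_line {f : E → ℝ} {Z : Set E} (hZ : UniqueDiffOn ℝ Z)
    (hf : ContDiffOn ℝ ∞ f Z) {I : Set ℝ} (hI : UniqueDiffOn ℝ I) {z v : E}
    (hmaps : ∀ s ∈ I, z + s • v ∈ Z) (j : ℕ) :
    ∀ s ∈ I, iteratedDerivWithin j (fun s => f (z + s • v)) I s
      = iteratedFDerivWithin ℝ j f Z (z + s • v) fun _ => v := by
  induction j with
  | zero => intro s _; simp
  | succ j ih =>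
    intro s hs
    rw [iteratedDerivWithin_succ, derivWithin_congr ih (ih s hs), iteratedFDerivWithin_succ_apply_left]
    have h1 := (hf.differentiableOn_iteratedFDerivWithin (m := j)
      (by exact_mod_cast ENat.natCast_lt_top j) hZ _ (hmaps s hs)).hasFDerivWithinAt
    have h2 : HasDerivWithinAt (fun s : ℝ => z + s • v) v I s := by
      simpa using (((hasDerivAt_id s).smul_const v).const_add z).hasDerivWithinAt
    have h3 := h1.comp_hasDerivWithinAt s h2 hmaps
    have h4 := (ContinuousMultilinearMap.apply ℝ (fun _ : Fin j => E) ℝ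
      fun _ => v).hasFDerivAt.comp_hasDerivWithinAt s h3
    exact h4.derivWithin (hI s hs)

/-- The one-variable Taylor formula along the segment from z to z + v, with the derivative of order
n + 1 bounded on the compact K. Derivatives within Z are needed because t and η range over sets with
boundary points. -/
theorem exists_taylor_bound {f : E → ℝ} {Z K : Set E} (hZ : UniqueDiffOn ℝ Z)
    (hf : ContDiffOn ℝ ∞ f Z) (hK : IsCompact K) (hKZ : K ⊆ Z) (n : ℕ) :
    ∃ M : ℝ, 0 ≤ M ∧ ∀ z v : E, (∀ s ∈ Icc (0 : ℝ) 1, z + s • v ∈ K) →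
      |f (z + v) - ∑ j ∈ Finset.range (n + 1),
        (j.factorial : ℝ)⁻¹ * iteratedFDerivWithin ℝ j f Z z fun _ => v| ≤ M * ‖v‖ ^ (n + 1) := by
  obtain ⟨M, hM⟩ := hK.exists_bound_of_continuousOn
    ((hf.continuousOn_iteratedFDerivWithin (m := n + 1) (by exact_mod_cast le_top) hZ).mono hKZ)
  refine ⟨max M 0, le_max_right _ _, fun z v hzv => ?_⟩
  have hI : UniqueDiffOn ℝ (Icc (0 : ℝ) 1) := uniqueDiffOn_Icc zero_lt_one
  have hmaps : ∀ s ∈ Icc (0 : ℝ) 1, z + s • v ∈ Z := fun s hs => hKZ (hzv s hs)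
  have hcomp : ContDiffOn ℝ (n + 1) (fun s : ℝ => f (z + s • v)) (Icc 0 1) := by
    refine (hf.of_le (by exact_mod_cast le_top)).comp ?_ hmaps
    exact (by fun_prop : ContDiff ℝ (n + 1) fun s : ℝ => z + s • v).contDiffOn
  have hline := iteratedDerivWithin_comp_line hZ hf hI hmaps
  have hb := taylor_mean_remainder_bound (n := n) (C := max M 0 * ‖v‖ ^ (n + 1)) zero_le_one hcomp
    (right_mem_Icc.2 zero_le_one) fun s hs => by
      rw [hline (n + 1) s hs]
      refine (ContinuousMultilinearMap.le_opNorm _ _).trans ?_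
      rw [Finset.prod_const, Finset.card_univ, Fintype.card_fin]
      gcongr
      exact (hM _ (hzv s hs)).trans (le_max_left _ _)
  rw [taylor_within_apply] at hb
  have h0 : ∀ j : ℕ, iteratedDerivWithin j (fun s : ℝ => f (z + s • v)) (Icc 0 1) 0
      = iteratedFDerivWithin ℝ j f Z z fun _ => v := fun j => by
    simpa using hline j 0 (left_mem_Icc.2 zero_le_one)
  simp only [h0, sub_zero, one_pow, mul_one, one_smul, smul_eq_mul, Real.norm_eq_abs] at hb
  refine hb.trans (div_le_self (by positivity) ?_)
  exact_mod_cast Nat.one_le_iff_ne_zero.2 n.factorial_ne_zero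

theorem contDiffOn_iteratedFDerivWithin_apply {f : ℝ × E → ℝ} {I : Set ℝ} {Z : Set (ℝ × E)}
    (hZ : UniqueDiffOn ℝ Z) (hf : ContDiffOn ℝ ∞ f Z) {e : E} (hI : ∀ t ∈ I, (t, e) ∈ Z) {j : ℕ}
    (v : Fin j → ℝ × E) :
    ContDiffOn ℝ ∞ (fun t => iteratedFDerivWithin ℝ j f Z (t, e) v) I := by
  have h1 : ContDiffOn ℝ ∞ (iteratedFDerivWithin ℝ j f Z) Z := fun z hz =>
    (hf z hz).iteratedFDerivWithin_right hZ (by exact_mod_cast le_rfl) hz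
  have h2 : ContDiffOn ℝ ∞ (fun t : ℝ => (t, e)) I :=
    (contDiff_id.prodMk contDiff_const).contDiffOn
  exact (ContinuousMultilinearMap.apply ℝ (fun _ : Fin j => ℝ × E) ℝ v).contDiff.comp_contDiffOn
    (h1.comp h2 hI)

theorem uniqueDiffOn_Icc_neg {t₀ : ℝ} (h : 0 < t₀) : UniqueDiffOn ℝ (Icc (-t₀) t₀) :=
  uniqueDiffOn_Icc (by linarith)

/-- The coefficients are derivatives within the strip in the direction (0, 1). As the second
variable is unrestricted, they agree with the ordinary derivatives in which the vanishing conditions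
on S are stated. -/
theorem exists_taylor_second_variable {S : ℝ → ℝ → ℝ} {t₀ R : ℝ} (hR : 0 < R) (hRt : R < t₀)
    (hS : ContDiffOn ℝ ∞ (fun x : ℝ × ℝ => S x.1 x.2) (Icc (-t₀) t₀ ×ˢ univ)) (n : ℕ) :
    ∃ s : ℕ → ℝ → ℝ, (∀ j, ContDiff ℝ ∞ (s j)) ∧
      (∀ j, ∀ t ∈ Icc (-R) R, s j t = iteratedDeriv j (fun a => S t a) 0) ∧
      ∃ M : ℝ, 0 ≤ M ∧ ∀ t ∈ Icc (-R) R, ∀ a : ℝ, |a| ≤ 1 →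
        |S t a - ∑ j ∈ Finset.range (n + 1), (j.factorial : ℝ)⁻¹ * (a ^ j * s j t)|
          ≤ M * |a| ^ (n + 1) := by
  have hZ : UniqueDiffOn ℝ (Icc (-t₀) t₀ ×ˢ (univ : Set ℝ)) :=
    (uniqueDiffOn_Icc_neg (hR.trans hRt)).prod uniqueDiffOn_univ
  have hsub : Icc (-R) R ⊆ Icc (-t₀) t₀ := Icc_subset_Icc (by linarith) hRt.le
  have hex : ∀ j : ℕ, ∃ g : ℝ → ℝ, ContDiff ℝ ∞ g ∧ ∀ t ∈ Icc (-R) R,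
      g t = iteratedFDerivWithin ℝ j (fun x : ℝ × ℝ => S x.1 x.2) (Icc (-t₀) t₀ ×ˢ univ) (t, 0)
        fun _ => (0, 1) := fun j =>
    exists_contDiff_eqOn hR hRt (contDiffOn_iteratedFDerivWithin_apply hZ hS
      (fun t ht => ⟨ht, mem_univ _⟩) _)
  choose s hs hs' using hex
  refine ⟨s, hs, fun j t ht => ?_, ?_⟩
  · rw [hs' j t ht]
    have := iteratedDerivWithin_comp_line hZ hS uniqueDiffOn_univ (z := (t, 0)) (v := (0, 1))
      (fun s _ => ⟨by simpa using hsub ht, mem_univ _⟩) j 0 (mem_univ _)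
    simpa using this.symm
  · obtain ⟨M, hM0, hM⟩ := exists_taylor_bound hZ hS (K := Icc (-t₀) t₀ ×ˢ Icc (-1) 1)
      (isCompact_Icc.prod isCompact_Icc) (prod_mono Subset.rfl (subset_univ _)) n
    refine ⟨M, hM0, fun t ht a ha => ?_⟩
    have h1 := hM (t, 0) (0, a) fun s hs => by
      refine ⟨by simpa using hsub ht, ?_⟩
      have : |s * a| ≤ 1 := by
        rw [abs_mul, abs_of_nonneg hs.1]
        exact mul_le_one₀ hs.2 (abs_nonneg a) ha
      simpa using abs_le.1 this
    have hnorm : ‖((0 : ℝ), a)‖ = |a| := by simp [Prod.norm_def]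
    rw [hnorm] at h1
    convert h1 using 2
    · simp only [Prod.mk_add_mk, add_zero, zero_add]
      congr 1
      refine Finset.sum_congr rfl fun j _ => ?_
      rw [hs' j t ht]
      congr 1
      have := (iteratedFDerivWithin ℝ j (fun x : ℝ × ℝ => S x.1 x.2) (Icc (-t₀) t₀ ×ˢ univ)
        (t, 0)).map_smul_univ (fun _ => a) fun _ => ((0 : ℝ), (1 : ℝ))
      simpa using this.symm

/-- The j-th derivative is expanded by multilinearity on y = ∑ y_i e_i. The terms are indexed by
words w in three letters, and equal monomials need not be collected. -/
theorem exists_taylor_last_variables {P : ℝ → ℝ → ℝ → ℝ → ℝ} {t₀ R η₀ : ℝ} (hR : 0 < R)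
    (hRt : R < t₀) (hη₀ : 0 < η₀)
    (hP : ContDiffOn ℝ ∞ (fun x : ℝ × ℝ × ℝ × ℝ => P x.1 x.2.1 x.2.2.1 x.2.2.2)
      (Icc (-t₀) t₀ ×ˢ univ ×ˢ univ ×ˢ Ico 0 η₀)) (n : ℕ) :
    ∃ c : (j : ℕ) → (Fin j → Fin 3) → ℝ → ℝ, (∀ j w, ContDiff ℝ ∞ (c j w)) ∧
      ∃ M r₀ : ℝ, 0 ≤ M ∧ 0 < r₀ ∧ ∀ t ∈ Icc (-R) R, ∀ (y : Fin 3 → ℝ) (r : ℝ),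
        (∀ i, |y i| ≤ r) → r ≤ r₀ → 0 ≤ y 2 →
        |P t (y 0) (y 1) (y 2) - ∑ j ∈ Finset.range (n + 1), ∑ w : Fin j → Fin 3,
          c j w t * ∏ i, y (w i)| ≤ M * r ^ (n + 1) := by
  set Z : Set (ℝ × ℝ × ℝ × ℝ) := Icc (-t₀) t₀ ×ˢ univ ×ˢ univ ×ˢ Ico 0 η₀ with hZdef
  set f : ℝ × ℝ × ℝ × ℝ → ℝ := fun x => P x.1 x.2.1 x.2.2.1 x.2.2.2
  have hZ : UniqueDiffOn ℝ Z := (uniqueDiffOn_Icc_neg (hR.trans hRt)).prod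
    (uniqueDiffOn_univ.prod (uniqueDiffOn_univ.prod (uniqueDiffOn_Ico 0 η₀)))
  have hsub : Icc (-R) R ⊆ Icc (-t₀) t₀ := Icc_subset_Icc (by linarith) hRt.le
  let e : Fin 3 → ℝ × ℝ × ℝ × ℝ := ![(0, 1, 0, 0), (0, 0, 1, 0), (0, 0, 0, 1)]
  have hex : ∀ (j : ℕ) (w : Fin j → Fin 3), ∃ g : ℝ → ℝ, ContDiff ℝ ∞ g ∧ ∀ t ∈ Icc (-R) R,
      g t = (j.factorial : ℝ)⁻¹ * iteratedFDerivWithin ℝ j f Z (t, 0, 0, 0)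
        fun i => e (w i) := fun j w =>
    exists_contDiff_eqOn hR hRt (contDiffOn_const.mul (contDiffOn_iteratedFDerivWithin_apply hZ hP
      (fun t ht => ⟨ht, mem_univ _, mem_univ _, left_mem_Ico.2 hη₀⟩) _))
  choose c hc hc' using hex
  obtain ⟨M, hM0, hM⟩ := exists_taylor_bound hZ hP
    (K := Icc (-t₀) t₀ ×ˢ Icc (-1) 1 ×ˢ Icc (-1) 1 ×ˢ Icc 0 (η₀ / 2))
    (isCompact_Icc.prod (isCompact_Icc.prod (isCompact_Icc.prod isCompact_Icc)))
    (prod_mono Subset.rfl (prod_mono (subset_univ _) (prod_mono (subset_univ _)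
      (Icc_subset_Ico_right (by linarith))))) n
  -- This radius keeps the increments in the compact set K, away from the excluded endpoint η₀.
  refine ⟨c, hc, M, min 1 (η₀ / 2), hM0, by positivity, fun t ht y r hy hr hy2 => ?_⟩
  have hr1 : r ≤ 1 := hr.trans (min_le_left _ _)
  have hr2 : r ≤ η₀ / 2 := hr.trans (min_le_right _ _)
  have hbd : ∀ i, ∀ s ∈ Icc (0 : ℝ) 1, |s * y i| ≤ r := fun i s hs => by
    rw [abs_mul, abs_of_nonneg hs.1]
    exact (mul_le_of_le_one_left (abs_nonneg _) hs.2).trans (hy i)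
  have h1 := hM (t, 0, 0, 0) (0, y 0, y 1, y 2) fun s hs => by
    have b0 := abs_le.1 ((hbd 0 s hs).trans hr1)
    have b1 := abs_le.1 ((hbd 1 s hs).trans hr1)
    have b2 := (abs_le.1 ((hbd 2 s hs).trans hr2)).2
    refine ⟨by simpa using hsub ht, by simpa using b0, by simpa using b1, ?_⟩
    simpa using ⟨mul_nonneg hs.1 hy2, b2⟩
  have hnorm : ‖((0 : ℝ), y 0, y 1, y 2)‖ ≤ r := by
    simp only [Prod.norm_def, Real.norm_eq_abs, norm_zero]
    exact max_le ((abs_nonneg _).trans (hy 0)) (max_le (hy 0) (max_le (hy 1) (hy 2)))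
  have hv : ((0 : ℝ), y 0, y 1, y 2) = ∑ i, y i • e i := by
    simp [Fin.sum_univ_three, e]
  have h2 : M * ‖((0 : ℝ), y 0, y 1, y 2)‖ ^ (n + 1) ≤ M * r ^ (n + 1) := by gcongr
  refine le_trans (le_of_eq ?_) (h1.trans h2)
  congr 1
  have hf0 : f ((t, 0, 0, 0) + (0, y 0, y 1, y 2)) = P t (y 0) (y 1) (y 2) := by simp [f]
  rw [hf0]
  congr 1
  refine Finset.sum_congr rfl fun j _ => ?_
  rw [hv, (iteratedFDerivWithin ℝ j f Z (t, 0, 0, 0)).map_sum, Finset.mul_sum]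
  refine Finset.sum_congr rfl fun w _ => ?_
  rw [hc' j w t ht, (iteratedFDerivWithin ℝ j f Z (t, 0, 0, 0)).map_smul_univ, smul_eq_mul]
  ring

end Canard

namespace Canard

/-! ### Approximate solutions of the linear equation in composite form -/

/-- Finite sums of functions `η ^ n * g t`, with `g` smooth, and `η ^ n * φ (t / η)`, with `φ` in
the span of the monomials of order `n`. -/
noncomputable def compositeSpan (p L : ℕ) : Submodule ℝ (ℝ → ℝ → ℝ) :=
  Submodule.span ℝ
    ({f | ∃ (n : ℕ) (g : ℝ → ℝ), ContDiff ℝ ∞ g ∧ f = fun η t => η ^ n * g t} ∪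
      {f | ∃ (n : ℕ) (φ : ℝ → ℝ), φ ∈ bracketSpan p L n ∧ f = fun η t => η ^ n * φ (t / η)})

variable {p L : ℕ}

theorem smooth_mem_compositeSpan (n : ℕ) {g : ℝ → ℝ} (hg : ContDiff ℝ ∞ g) :
    (fun η t => η ^ n * g t) ∈ compositeSpan p L :=
  Submodule.subset_span (Or.inl ⟨n, g, hg, rfl⟩)

theorem bracket_mem_compositeSpan {n : ℕ} {φ : ℝ → ℝ} (hφ : φ ∈ bracketSpan p L n) :
    (fun η t => η ^ n * φ (t / η)) ∈ compositeSpan p L :=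
  Submodule.subset_span (Or.inr ⟨n, φ, hφ, rfl⟩)

theorem pow_mul_mem_compositeSpan (m : ℕ) {v : ℝ → ℝ → ℝ} (hv : v ∈ compositeSpan p L) :
    (fun η t => η ^ m * v η t) ∈ compositeSpan p L := by
  have : compositeSpan p L ≤
      (compositeSpan p L).comap (LinearMap.mulLeft ℝ (fun η _ : ℝ => η ^ m)) := by
    refine Submodule.span_le.2 ?_
    rintro f (⟨n, g, hg, rfl⟩ | ⟨n, φ, hφ, rfl⟩)
    · have := smooth_mem_compositeSpan (p := p) (L := L) (m + n) hg
      simp only [pow_add, mul_assoc] at this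
      exact this
    · have := bracket_mem_compositeSpan (bracketSpan_mono (Nat.le_add_left n m) hφ)
      simp only [pow_add, mul_assoc] at this
      exact this
  exact this hv

/-- `η v' = (p + 1) T ^ p v + a T ^ L + F`, with `T = t / η`, has an approximate solution `(a, v)`
of composite form, up to an error of order `η ^ N * (1 + |T| ^ p)`. -/
def IsSolvable (p L : ℕ) (R : ℝ) (N : ℕ) (F : ℝ → ℝ → ℝ) : Prop :=
  ∃ (a : Polynomial ℝ) (v v' : ℝ → ℝ → ℝ), v ∈ compositeSpan p L ∧
    (∀ η > 0, ∀ t, HasDerivAt (v η) (v' η t) t) ∧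
    ∃ K : ℝ, 0 ≤ K ∧ ∀ η ∈ Ioc (0 : ℝ) 1, ∀ t ∈ Icc (-R) R,
      |η * v' η t - (p + 1) * (t / η) ^ p * v η t - a.eval η * (t / η) ^ L - F η t|
        ≤ K * η ^ N * (1 + |t / η| ^ p)

variable {R : ℝ} {N : ℕ}

theorem IsSolvable.congr {F G : ℝ → ℝ → ℝ} (hF : IsSolvable p L R N F)
    (h : ∀ η > 0, ∀ t, F η t = G η t) : IsSolvable p L R N G := by
  obtain ⟨a, v, v', hv, hd, K, hK0, hK⟩ := hF
  exact ⟨a, v, v', hv, hd, K, hK0, fun η hη t ht => h η hη.1 t ▸ hK η hη t ht⟩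

theorem IsSolvable.add {F G : ℝ → ℝ → ℝ} (hF : IsSolvable p L R N F)
    (hG : IsSolvable p L R N G) : IsSolvable p L R N fun η t => F η t + G η t := by
  obtain ⟨a, v, v', hv, hd, K, hK0, hK⟩ := hF
  obtain ⟨b, w, w', hw, hd', M, hM0, hM⟩ := hG
  refine ⟨a + b, v + w, v' + w', Submodule.add_mem _ hv hw,
    fun η hη t => (hd η hη t).add (hd' η hη t), K + M, add_nonneg hK0 hM0, fun η hη t ht => ?_⟩
  have h := (abs_add_le _ _).trans (add_le_add (hK η hη t ht) (hM η hη t ht))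
  refine le_trans (le_of_eq ?_) (h.trans_eq (by ring))
  congr 1
  simp only [Pi.add_apply, Polynomial.eval_add]
  ring

theorem IsSolvable.pow_mul {F : ℝ → ℝ → ℝ} (hF : IsSolvable p L R N F) (r : ℝ) (m : ℕ) :
    IsSolvable p L R N fun η t => r * η ^ m * F η t := by
  obtain ⟨a, v, v', hv, hd, K, hK0, hK⟩ := hF
  refine ⟨Polynomial.C r * Polynomial.X ^ m * a, fun η t => r * (η ^ m * v η t),
    fun η t => r * (η ^ m * v' η t), Submodule.smul_mem _ r (pow_mul_mem_compositeSpan m hv),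
    fun η hη t => ((hd η hη t).const_mul _).const_mul _, |r| * K, by positivity,
    fun η hη t ht => ?_⟩
  have h1 : |r * η ^ m| ≤ |r| := by
    rw [abs_mul, abs_of_nonneg (pow_nonneg hη.1.le m)]
    exact mul_le_of_le_one_right (abs_nonneg r) (pow_le_one₀ hη.1.le hη.2)
  calc _ = |r * η ^ m| * |η * v' η t - (p + 1) * (t / η) ^ p * v η t - a.eval η * (t / η) ^ L
            - F η t| := by
        rw [← abs_mul]
        congr 1
        simp only [Polynomial.eval_mul, Polynomial.eval_C, Polynomial.eval_pow, Polynomial.eval_X]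
        ring
    _ ≤ |r| * (K * η ^ N * (1 + |t / η| ^ p)) :=
        mul_le_mul h1 (hK η hη t ht) (abs_nonneg _) (abs_nonneg _)
    _ = _ := by ring

theorem isSolvable_zero : IsSolvable p L R N fun _ _ => 0 :=
  ⟨0, 0, 0, Submodule.zero_mem _, fun η _ t => by simp, 0, le_rfl,
    fun η _ t _ => by simp⟩

theorem IsSolvable.polynomial_mul {F : ℝ → ℝ → ℝ} (hF : IsSolvable p L R N F) (q : Polynomial ℝ) :
    IsSolvable p L R N fun η t => q.eval η * F η t := by
  induction q using Polynomial.induction_on' with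
  | add q₁ q₂ h₁ h₂ => simpa only [Polynomial.eval_add, add_mul] using h₁.add h₂
  | monomial n a => simpa only [Polynomial.eval_monomial] using hF.pow_mul a n

theorem IsSolvable.sum {ι : Type*} (s : Finset ι) {F : ι → ℝ → ℝ → ℝ}
    (hF : ∀ i ∈ s, IsSolvable p L R N (F i)) :
    IsSolvable p L R N fun η t => ∑ i ∈ s, F i η t := by
  classical
  induction s using Finset.induction_on with
  | empty => simpa using isSolvable_zero
  | insert i s hi ih =>
    simp only [Finset.sum_insert hi]
    exact (hF i (Finset.mem_insert_self i s)).add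
      (ih fun j hj => hF j (Finset.mem_insert_of_mem hj))

theorem isSolvable_of_hasDerivAt {F v v' : ℝ → ℝ → ℝ} (a : Polynomial ℝ)
    (hv : v ∈ compositeSpan p L) (hd : ∀ η > 0, ∀ t, HasDerivAt (v η) (v' η t) t)
    (hF : ∀ η > 0, ∀ t, η * v' η t
      = (p + 1) * (t / η) ^ p * v η t + a.eval η * (t / η) ^ L + F η t) :
    IsSolvable p L R N F := by
  refine ⟨a, v, v', hv, hd, 0, le_rfl, fun η hη t _ => ?_⟩
  rw [hF η hη.1 t, zero_mul, zero_mul, abs_nonpos_iff]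
  ring

theorem isSolvable_of_abs_le {F : ℝ → ℝ → ℝ} {K : ℝ} (hK0 : 0 ≤ K)
    (hK : ∀ η ∈ Ioc (0 : ℝ) 1, ∀ t ∈ Icc (-R) R, |F η t| ≤ K * η ^ N * (1 + |t / η| ^ p)) :
    IsSolvable p L R N F :=
  ⟨0, 0, 0, Submodule.zero_mem _, fun η _ t => by simp, K, hK0,
    fun η hη t ht => by simpa using hK η hη t ht⟩

theorem hasDerivAt_pow_mul_comp_div {φ : ℝ → ℝ} {φ' η t : ℝ} (m : ℕ)
    (h : HasDerivAt φ φ' (t / η)) :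
    HasDerivAt (fun t => η ^ m * φ (t / η)) (η ^ m * (φ' * η⁻¹)) t := by
  have := (h.comp t ((hasDerivAt_id t).div_const η)).const_mul (η ^ m)
  rw [one_div] at this
  exact this

/-- Exact solution: v = η^m I_1(Φ)(t/η) and a = -c η^m. The power of η must match the order of
I_1(Φ), not that of Φ. -/
theorem isSolvable_pow_mul_comp_div (hp : Odd p) {Φ : ℝ → ℝ} (hΦ : Continuous Φ)
    (h : HasLaurentExpansion Φ) {m : ℕ} (hm : canardOp p L 1 Φ ∈ bracketSpan p L m) :
    IsSolvable p L R N fun η t => η ^ m * Φ (t / η) := by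
  refine isSolvable_of_hasDerivAt
    (Polynomial.C (-canardConst p L Φ) * Polynomial.X ^ m) (bracket_mem_compositeSpan hm)
    (fun η hη t => hasDerivAt_pow_mul_comp_div m (hasDerivAt_canardOp hp hΦ h (t / η)))
    fun η hη t => ?_
  simp only [Polynomial.eval_mul, Polynomial.eval_C, Polynomial.eval_pow, Polynomial.eval_X]
  field_simp
  ring

theorem exists_bound_on_Icc {g : ℝ → ℝ} (hg : Continuous g) (R : ℝ) :
    ∃ K : ℝ, 0 ≤ K ∧ ∀ t ∈ Icc (-R) R, |g t| ≤ K := by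
  obtain ⟨K, hK⟩ := (isCompact_Icc (a := -R) (b := R)).exists_bound_of_continuousOn hg.continuousOn
  exact ⟨max K 0, le_max_right _ _, fun t ht => (hK t ht).trans (le_max_left _ _)⟩

theorem abs_pow_le_one_add {i : ℕ} (hi : i ≤ p) (T : ℝ) : |T| ^ i ≤ 1 + |T| ^ p := by
  rcases le_total |T| 1 with h | h
  · have := pow_le_one₀ (n := i) (abs_nonneg T) h
    have := pow_nonneg (abs_nonneg T) p
    linarith
  · have := pow_le_pow_right₀ h hi
    linarith

/-- Each reduction gains one power of η. For i < p, write g = g(0) + t h: the term with g(0) is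
solved by ψ_i, and t = ηT turns the rest into η^(m+1) T^(i+1) h. For i = p the division by (p+1) T^p
is smooth and leaves g'. Once m ≥ N, the term is an admissible error. -/
theorem isSolvable_pow_mul_smooth (hp : Odd p) (hL : Even L) (hLp : L < p) {i m : ℕ} (hi : i ≤ p)
    {g : ℝ → ℝ} (hg : ContDiff ℝ ∞ g) :
    IsSolvable p L R N fun η t => η ^ m * (t / η) ^ i * g t := by
  -- k bounds the number of powers of η still missing; the induction is on it.
  obtain ⟨k, hk⟩ : ∃ k, N ≤ m + k := ⟨N, Nat.le_add_left N m⟩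
  induction k generalizing m i g with
  | zero =>
    obtain ⟨K, hK0, hK⟩ := exists_bound_on_Icc hg.continuous R
    refine isSolvable_of_abs_le hK0 fun η hη t ht => ?_
    rw [abs_mul, abs_mul, abs_pow, abs_pow, abs_of_pos hη.1]
    have h1 : η ^ m ≤ η ^ N := pow_le_pow_of_le_one hη.1.le hη.2 hk
    have h2 := abs_pow_le_one_add hi (t / η)
    have h3 : 0 ≤ η ^ m := pow_nonneg hη.1.le m
    calc η ^ m * |t / η| ^ i * |g t| ≤ η ^ N * (1 + |t / η| ^ p) * K := by
          have := pow_nonneg hη.1.le N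
          gcongr
          exact hK t ht
      _ = _ := by ring
  | succ k ih =>
    rcases hi.lt_or_eq with hip | rfl
    · obtain ⟨h, hh, hgh⟩ := exists_contDiff_eq_add_mul hg
      have h1 : IsSolvable p L R N fun η t => η ^ m * (t / η) ^ i :=
        isSolvable_pow_mul_comp_div hp (continuous_pow i) (hasLaurentExpansion_pow i)
          (psi_mem_bracketSpan hp hL hLp hip m)
      refine ((h1.pow_mul (g 0) 0).add
        (ih (i := i + 1) (m := m + 1) hip hh (by omega))).congr fun η hη t => ?_
      rw [hgh t]
      have : t = η * (t / η) := by field_simp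
      generalize t / η = T at this
      subst this
      ring
    · have hd := (contDiff_infty_iff_deriv.1 hg).2
      have hi1 : (i : ℝ) + 1 ≠ 0 := by positivity
      have h1 : IsSolvable i L R N fun η t =>
          η ^ m * (t / η) ^ i * g t - η ^ (m + 1) * ((i + 1 : ℝ)⁻¹ * deriv g t) := by
        refine isSolvable_of_hasDerivAt (v := fun η t => η ^ m * (-(i + 1 : ℝ)⁻¹ * g t)) 0
          (smooth_mem_compositeSpan m (contDiff_const.mul hg))
          (fun η hη t => (((hg.differentiable (by simp) t).hasDerivAt).const_mul _).const_mul _)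
          fun η hη t => ?_
        simp only [Polynomial.eval_zero]
        field_simp
        ring
      refine (h1.add (ih (i := 0) (m := m + 1) (Nat.zero_le i)
        (contDiff_const.mul hd : ContDiff ℝ ∞ fun t => (i + 1 : ℝ)⁻¹ * deriv g t)
        (by omega))).congr fun η hη t => ?_
      ring

theorem isSolvable_smooth (hp : Odd p) (hL : Even L) (hLp : L < p) (m : ℕ)
    {g : ℝ → ℝ} (hg : ContDiff ℝ ∞ g) : IsSolvable p L R N fun η t => η ^ m * g t := by
  simpa using isSolvable_pow_mul_smooth (R := R) (N := N) hp hL hLp (m := m) (Nat.zero_le p) hg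

/-- Write g φ = g(0) φ + c η h + η h (Tφ - c) with t = ηT. The first term is solved by I_1(φ), the
second is smooth, and the third has the same shape with the bracket Tφ - c of order n + 1. The
prefactor η^(n+1) is required because I_1(φ) has order n + 1. -/
theorem isSolvable_smooth_mul_bracket (hp : Odd p) (hL : Even L) (hLp : L < p) {n : ℕ}
    {g φ : ℝ → ℝ} (hg : ContDiff ℝ ∞ g) (hφ : φ ∈ bracketSpan p L n) :
    IsSolvable p L R N fun η t => η ^ (n + 1) * g t * φ (t / η) := by
  obtain ⟨k, hk⟩ : ∃ k, N ≤ n + 1 + k := ⟨N, Nat.le_add_left N (n + 1)⟩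
  induction k generalizing n g φ with
  | zero =>
    obtain ⟨K, hK0, hK⟩ := exists_bound_on_Icc hg.continuous R
    obtain ⟨M, hM⟩ := exists_bound_of_mem_bracketSpan hp hL hLp hφ
    have hM0 : 0 ≤ M := (abs_nonneg _).trans (hM 0)
    refine isSolvable_of_abs_le (mul_nonneg hK0 hM0) fun η hη t ht => ?_
    rw [abs_mul, abs_mul, abs_pow, abs_of_pos hη.1]
    have h1 : η ^ (n + 1) ≤ η ^ N := pow_le_pow_of_le_one hη.1.le hη.2 hk
    have h2 : (1 : ℝ) ≤ 1 + |t / η| ^ p := by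
      have := pow_nonneg (abs_nonneg (t / η)) p
      linarith
    have h3 : 0 ≤ η ^ N := pow_nonneg hη.1.le N
    calc η ^ (n + 1) * |g t| * |φ (t / η)| ≤ η ^ N * K * M := by
          gcongr
          · exact hK t ht
          · exact hM _
      _ = K * M * η ^ N * 1 := by ring
      _ ≤ _ := by gcongr
  | succ k ih =>
    obtain ⟨h, hh, hgh⟩ := exists_contDiff_eq_add_mul hg
    obtain ⟨c, hc⟩ := exists_mul_self_sub_mem_bracketSpan hφ
    have h1 : IsSolvable p L R N fun η t => η ^ (n + 1) * φ (t / η) :=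
      isSolvable_pow_mul_comp_div hp (continuous_of_mem_bracketSpan hp hL hLp hφ)
        hφ.2.hasLaurentExpansion (canardOp_mem_bracketSpan hp hL hLp hφ)
    refine (((h1.pow_mul (g 0) 0).add (ih hh hc (by omega))).add
      ((isSolvable_smooth hp hL hLp (n + 2) hh).pow_mul c 0)).congr fun η hη t => ?_
    rw [hgh t]
    have : t = η * (t / η) := by field_simp
    generalize t / η = T at this
    subst this
    ring

/-! ### The algebra of composite functions -/

/-- The monoid of the functions `η ^ n * g t * (c + φ (t / η))`. -/
def compositeMonoid (p L : ℕ) : Submonoid (ℝ → ℝ → ℝ) where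
  carrier := {f | ∃ (n : ℕ) (g : ℝ → ℝ) (c : ℝ) (φ : ℝ → ℝ), ContDiff ℝ ∞ g ∧
    φ ∈ bracketSpan p L n ∧ f = fun η t => η ^ n * g t * (c + φ (t / η))}
  one_mem' := ⟨0, fun _ => 1, 1, 0, contDiff_const, Submodule.zero_mem _, by ext; simp⟩
  mul_mem' := by
    rintro _ _ ⟨m, g, c, φ, hg, hφ, rfl⟩ ⟨n, h, d, θ, hh, hθ, rfl⟩
    refine ⟨m + n, fun t => g t * h t, c * d, c • θ + d • φ + φ * θ, hg.mul hh,
      Submodule.add_mem _ (Submodule.add_mem _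
        (Submodule.smul_mem _ c (bracketSpan_mono (Nat.le_add_left n m) hθ))
        (Submodule.smul_mem _ d (bracketSpan_mono (Nat.le_add_right m n) hφ)))
        (mul_mem_bracketSpan hφ hθ), ?_⟩
    ext η t
    simp only [Pi.mul_apply, Pi.add_apply, Pi.smul_apply, smul_eq_mul]
    ring

/-- The algebra generated by the composite functions. -/
noncomputable def compositeAlgebra (p L : ℕ) : Subalgebra ℝ (ℝ → ℝ → ℝ) :=
  Algebra.adjoin ℝ (compositeMonoid p L)

theorem mem_compositeAlgebra_iff {f : ℝ → ℝ → ℝ} :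
    f ∈ compositeAlgebra p L ↔ f ∈ Submodule.span ℝ (compositeMonoid p L : Set (ℝ → ℝ → ℝ)) := by
  rw [compositeAlgebra, ← Subalgebra.mem_toSubmodule, Algebra.adjoin_eq_span, Submonoid.closure_eq]

theorem smooth_mem_compositeAlgebra (n : ℕ) {g : ℝ → ℝ} (hg : ContDiff ℝ ∞ g) :
    (fun η t => η ^ n * g t) ∈ compositeAlgebra p L :=
  Algebra.subset_adjoin ⟨n, g, 1, 0, hg, Submodule.zero_mem _, by ext; simp⟩

theorem compositeSpan_le_compositeAlgebra {f : ℝ → ℝ → ℝ} (hf : f ∈ compositeSpan p L) :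
    f ∈ compositeAlgebra p L := by
  have : compositeSpan p L ≤ Subalgebra.toSubmodule (compositeAlgebra p L) := by
    refine Submodule.span_le.2 ?_
    rintro f (⟨n, g, hg, rfl⟩ | ⟨n, φ, hφ, rfl⟩)
    · exact smooth_mem_compositeAlgebra n hg
    · exact Algebra.subset_adjoin ⟨n, fun _ => 1, 0, φ, contDiff_const, hφ, by ext; simp⟩
  exact this hf

theorem polynomial_mem_compositeAlgebra (q : Polynomial ℝ) :
    (fun η _ => q.eval η) ∈ compositeAlgebra p L := by
  induction q using Polynomial.induction_on' with
  | add q₁ q₂ h₁ h₂ =>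
    simp only [Polynomial.eval_add]
    exact Subalgebra.add_mem _ h₁ h₂
  | monomial n a =>
    simp only [Polynomial.eval_monomial, mul_comm a]
    exact smooth_mem_compositeAlgebra n contDiff_const

theorem exists_bound_of_mem_compositeAlgebra (hp : Odd p) (hL : Even L) (hLp : L < p)
    {f : ℝ → ℝ → ℝ} (hf : f ∈ compositeAlgebra p L) (R : ℝ) :
    ∃ K : ℝ, 0 ≤ K ∧ ∀ η ∈ Ioc (0 : ℝ) 1, ∀ t ∈ Icc (-R) R, |f η t| ≤ K := by
  rw [mem_compositeAlgebra_iff] at hf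
  induction hf using Submodule.span_induction with
  | mem f h =>
    obtain ⟨n, g, c, φ, hg, hφ, rfl⟩ := h
    obtain ⟨K, hK0, hK⟩ := exists_bound_on_Icc hg.continuous R
    obtain ⟨M, hM⟩ := exists_bound_of_mem_bracketSpan hp hL hLp hφ
    have hM0 : 0 ≤ M := (abs_nonneg _).trans (hM 0)
    refine ⟨1 * K * (|c| + M), by positivity, fun η hη t ht => ?_⟩
    rw [abs_mul, abs_mul, abs_pow, abs_of_pos hη.1]
    gcongr
    · exact pow_le_one₀ hη.1.le hη.2
    · exact hK t ht
    · exact (abs_add_le _ _).trans (add_le_add le_rfl (hM _))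
  | zero => exact ⟨0, le_rfl, fun η _ t _ => by simp⟩
  | add f g _ _ h₁ h₂ =>
    obtain ⟨K, hK0, hK⟩ := h₁
    obtain ⟨M, hM0, hM⟩ := h₂
    exact ⟨K + M, add_nonneg hK0 hM0, fun η hη t ht =>
      (abs_add_le _ _).trans (add_le_add (hK η hη t ht) (hM η hη t ht))⟩
  | smul r f _ h =>
    obtain ⟨K, hK0, hK⟩ := h
    refine ⟨|r| * K, by positivity, fun η hη t ht => ?_⟩
    rw [Pi.smul_apply, Pi.smul_apply, smul_eq_mul, abs_mul]
    exact mul_le_mul_of_nonneg_left (hK η hη t ht) (abs_nonneg r)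

/-- The extra factor η compensates the order gained by I_1. In the equation it comes from the
factors η of the arguments of P. -/
theorem isSolvable_mul_of_mem_compositeAlgebra (hp : Odd p) (hL : Even L) (hLp : L < p)
    {f : ℝ → ℝ → ℝ} (hf : f ∈ compositeAlgebra p L) :
    IsSolvable p L R N fun η t => η * f η t := by
  rw [mem_compositeAlgebra_iff] at hf
  induction hf using Submodule.span_induction with
  | mem f h =>
    obtain ⟨n, g, c, φ, hg, hφ, rfl⟩ := h
    refine (((isSolvable_smooth hp hL hLp (n + 1) hg).pow_mul c 0).add
      (isSolvable_smooth_mul_bracket hp hL hLp hg hφ)).congr fun η _ t => ?_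
    ring
  | zero => exact isSolvable_zero.congr fun η _ t => by simp
  | add f g _ _ h₁ h₂ => exact (h₁.add h₂).congr fun η _ t => by simp [mul_add]
  | smul r f _ h =>
    refine (h.pow_mul r 0).congr fun η _ t => ?_
    simp only [pow_zero, mul_one, Pi.smul_apply, smul_eq_mul]
    ring

end Canard

namespace Canard

/-! ### Improvement of composite approximations -/

/-- The filter describing estimates as `η → 0⁺`, uniform for `t` in `[-τ, τ]`. -/
def stripFilter (τ : ℝ) : Filter (ℝ × ℝ) := 𝓝[>] (0 : ℝ) ×ˢ 𝓟 (Icc (-τ) τ)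

theorem eventually_stripFilter {τ : ℝ} {q : ℝ × ℝ → Prop} :
    (∀ᶠ x in stripFilter τ, q x) ↔ ∀ᶠ η in 𝓝[>] (0 : ℝ), ∀ t ∈ Icc (-τ) τ, q (η, t) :=
  eventually_prod_principal_iff

theorem eventually_stripFilter_mem (τ : ℝ) {b : ℝ} (hb : 0 < b) :
    ∀ᶠ x in stripFilter τ, x.1 ∈ Ioc 0 b ∧ x.2 ∈ Icc (-τ) τ :=
  eventually_stripFilter.2 (mem_of_superset (Ioc_mem_nhdsGT hb) fun _ h _ ht => ⟨h, ht⟩)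

theorem isBigO_stripFilter_of_le {τ : ℝ} {f g : ℝ × ℝ → ℝ} {K : ℝ}
    (h : ∀ᶠ x in stripFilter τ, |f x| ≤ K * g x) : f =O[stripFilter τ] g := by
  refine IsBigO.of_bound |K| (h.mono fun x hx => ?_)
  rw [Real.norm_eq_abs, Real.norm_eq_abs, ← abs_mul]
  exact hx.trans (le_abs_self _)

theorem isBigO_stripFilter_pow_of_le (τ : ℝ) {m n : ℕ} (h : m ≤ n) :
    (fun x : ℝ × ℝ => x.1 ^ n) =O[stripFilter τ] fun x => x.1 ^ m := by
  refine isBigO_stripFilter_of_le (K := 1) ((eventually_stripFilter_mem τ one_pos).mono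
    fun x hx => ?_)
  rw [abs_of_nonneg (pow_nonneg hx.1.1.le n), one_mul]
  exact pow_le_pow_of_le_one hx.1.1.le hx.1.2 h

theorem isBigO_stripFilter_one_of_continuous (τ : ℝ) {g : ℝ → ℝ} (hg : Continuous g) :
    (fun x : ℝ × ℝ => g x.2) =O[stripFilter τ] fun _ => (1 : ℝ) := by
  obtain ⟨K, -, hK⟩ := exists_bound_on_Icc hg τ
  exact isBigO_stripFilter_of_le (K := K) ((eventually_stripFilter_mem τ one_pos).mono
    fun x hx => by simpa using hK x.2 hx.2)

theorem isBigO_stripFilter_polynomial (τ : ℝ) (q : Polynomial ℝ) :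
    (fun x : ℝ × ℝ => q.eval x.1) =O[stripFilter τ] fun _ => (1 : ℝ) := by
  obtain ⟨K, -, hK⟩ := exists_bound_on_Icc q.continuous 1
  exact isBigO_stripFilter_of_le (K := K) ((eventually_stripFilter_mem τ one_pos).mono
    fun x hx => by simpa using hK x.1 ⟨by linarith [hx.1.1], hx.1.2⟩)

theorem isBigO_prod_sub_prod {X ι : Type*} {l : Filter X} {h : X → ℝ} {f g : ι → X → ℝ}
    (s : Finset ι) (hf : ∀ i, f i =O[l] fun _ => (1 : ℝ)) (hg : ∀ i, g i =O[l] fun _ => (1 : ℝ))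
    (hfg : ∀ i, (fun x => f i x - g i x) =O[l] h) :
    (fun x => ∏ i ∈ s, f i x - ∏ i ∈ s, g i x) =O[l] h := by
  classical
  induction s using Finset.induction_on with
  | empty => simpa using isBigO_zero h l
  | insert i s hi ih =>
    have hone : (fun x => ∏ j ∈ s, g j x) =O[l] fun _ => (1 : ℝ) := by
      simpa using IsBigO.finsetProd (s := s) (g := fun _ _ => (1 : ℝ)) fun j _ => hg j
    have h1 := (hf i).mul ih
    have h2 := (hfg i).mul hone
    simp only [one_mul, mul_one] at h1 h2
    refine (h1.add h2).congr_left fun x => ?_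
    rw [Finset.prod_insert hi, Finset.prod_insert hi]
    ring

theorem isBigO_pow_sub_pow {X : Type*} {l : Filter X} {h f g : X → ℝ} (n : ℕ)
    (hf : f =O[l] fun _ => (1 : ℝ)) (hg : g =O[l] fun _ => (1 : ℝ))
    (hfg : (fun x => f x - g x) =O[l] h) : (fun x => f x ^ n - g x ^ n) =O[l] h := by
  simpa using isBigO_prod_sub_prod (Finset.range n) (fun _ => hf) (fun _ => hg) fun _ => hfg

variable {p L : ℕ}

/-- `(α, u)` is approximated by a polynomial in `η` and a function of composite form, up to an
error of order `η ^ k`, uniformly on the compact subintervals of `(-R, R)`. -/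
def HasCompositeApproximation (p L : ℕ) (R : ℝ) (α : ℝ → ℝ) (u : ℝ → ℝ → ℝ) (k : ℕ) : Prop :=
  ∃ (a : Polynomial ℝ) (v : ℝ → ℝ → ℝ), v ∈ compositeSpan p L ∧ ∀ τ ∈ Ioo 0 R,
    (fun x : ℝ × ℝ => α x.1 - a.eval x.1) =O[stripFilter τ] (fun x => x.1 ^ k) ∧
    (fun x : ℝ × ℝ => u x.1 x.2 - v x.1 x.2) =O[stripFilter τ] fun x => x.1 ^ k

/-- The function `F` is, up to an error of order `η ^ N * (1 + |T| ^ p)`, a forcing term for which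
the linear equation can be solved approximately. -/
def HasSolvableApproximation (p L : ℕ) (R : ℝ) (N : ℕ) (F : ℝ → ℝ → ℝ) : Prop :=
  ∃ G : ℝ → ℝ → ℝ, IsSolvable p L R N G ∧ ∀ τ ∈ Ioo 0 R,
    (fun x : ℝ × ℝ => F x.1 x.2 - G x.1 x.2) =O[stripFilter τ]
      fun x => x.1 ^ N * (1 + |x.2 / x.1| ^ p)

theorem HasSolvableApproximation.add {R : ℝ} {N : ℕ} {F G : ℝ → ℝ → ℝ}
    (hF : HasSolvableApproximation p L R N F) (hG : HasSolvableApproximation p L R N G) :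
    HasSolvableApproximation p L R N fun η t => F η t + G η t := by
  obtain ⟨F', hF', hF⟩ := hF
  obtain ⟨G', hG', hG⟩ := hG
  exact ⟨_, hF'.add hG', fun τ hτ => ((hF τ hτ).add (hG τ hτ)).congr_left fun x => by ring⟩

theorem isBigO_pow_mul_weight (τ : ℝ) (N : ℕ) : (fun x : ℝ × ℝ => x.1 ^ N) =O[stripFilter τ]
    fun x => x.1 ^ N * (1 + |x.2 / x.1| ^ p) := by
  refine isBigO_stripFilter_of_le (K := 1) ((eventually_stripFilter_mem τ one_pos).mono
    fun x hx => ?_)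
  have h1 := pow_nonneg hx.1.1.le N
  have h2 := pow_nonneg (abs_nonneg (x.2 / x.1)) p
  rw [abs_of_nonneg h1]
  nlinarith

/-- The last three arguments of P are η z with z = (u, η^(p-L) α, 1) bounded. A Taylor expansion of
degree k leaves O(η^(k+1)). In the terms of degree at least 1, replacing z by its approximation,
known up to η^k, also costs only η^(k+1) because of the factor η. -/
theorem hasSolvableApproximation_nonlinear (hp : Odd p) (hL : Even L) (hLp : L < p)
    {P : ℝ → ℝ → ℝ → ℝ → ℝ} {t₀ R η₀ : ℝ} (hR : 0 < R) (hRt : R < t₀) (hη₀ : 0 < η₀)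
    (hP : ContDiffOn ℝ ∞ (fun x : ℝ × ℝ × ℝ × ℝ => P x.1 x.2.1 x.2.2.1 x.2.2.2)
      (Icc (-t₀) t₀ ×ˢ univ ×ˢ univ ×ˢ Ico 0 η₀)) {α : ℝ → ℝ} {u : ℝ → ℝ → ℝ}
    (hα : ∀ τ ∈ Ioo 0 R, (fun x : ℝ × ℝ => α x.1) =O[stripFilter τ] fun _ => (1 : ℝ))
    (hu : ∀ τ ∈ Ioo 0 R, (fun x : ℝ × ℝ => u x.1 x.2) =O[stripFilter τ] fun _ => (1 : ℝ))
    {k : ℕ} (h : HasCompositeApproximation p L R α u k) :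
    HasSolvableApproximation p L R (k + 1)
      fun η t => P t (η * u η t) (η ^ (p - L + 1) * α η) η := by
  obtain ⟨a, v, hv, hav⟩ := h
  obtain ⟨c, hc, M, r₀, hM0, hr₀, hM⟩ := exists_taylor_last_variables hR hRt hη₀ hP k
  let z : Fin 3 → ℝ → ℝ → ℝ := ![u, fun η _ => η ^ (p - L) * α η, fun _ _ => 1]
  let zh : Fin 3 → ℝ → ℝ → ℝ := ![v, fun η _ => η ^ (p - L) * a.eval η, fun _ _ => 1]
  have hzh : ∀ i, zh i ∈ compositeAlgebra p L := by
    intro i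
    fin_cases i
    · exact compositeSpan_le_compositeAlgebra hv
    · have := polynomial_mem_compositeAlgebra (p := p) (L := L) (Polynomial.X ^ (p - L) * a)
      simpa [zh] using this
    · exact Subalgebra.one_mem _
  have hz1 : ∀ τ ∈ Ioo 0 R, ∀ i, (fun x : ℝ × ℝ => z i x.1 x.2) =O[stripFilter τ]
      fun _ => (1 : ℝ) := by
    intro τ hτ i
    fin_cases i
    · exact hu τ hτ
    · have := (isBigO_stripFilter_pow_of_le τ (Nat.zero_le (p - L))).mul (hα τ hτ)
      simpa [z] using this
    · exact isBigO_refl _ _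
  have hzh1 : ∀ τ ∈ Ioo 0 R, ∀ i, (fun x : ℝ × ℝ => zh i x.1 x.2) =O[stripFilter τ]
      fun _ => (1 : ℝ) := by
    intro τ hτ i
    obtain ⟨K, -, hK⟩ := exists_bound_of_mem_compositeAlgebra hp hL hLp (hzh i) τ
    exact isBigO_stripFilter_of_le (K := K) ((eventually_stripFilter_mem τ one_pos).mono
      fun x hx => by simpa using hK x.1 hx.1 x.2 hx.2)
  have hzz : ∀ τ ∈ Ioo 0 R, ∀ i, (fun x : ℝ × ℝ => z i x.1 x.2 - zh i x.1 x.2)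
      =O[stripFilter τ] fun x => x.1 ^ k := by
    intro τ hτ i
    fin_cases i
    · exact (hav τ hτ).2
    · have := (isBigO_stripFilter_pow_of_le τ (Nat.zero_le (p - L))).mul (hav τ hτ).1
      simpa [z, zh, mul_sub] using this
    · simpa [z, zh] using isBigO_zero _ _
  refine ⟨fun η t => ∑ j ∈ Finset.range (k + 1), ∑ w : Fin j → Fin 3,
    c j w t * ∏ i, (η * zh (w i) η t), ?_, fun τ hτ => ?_⟩
  · refine IsSolvable.sum _ fun j _ => IsSolvable.sum _ fun w _ => ?_
    -- Degree 0 is a smooth function of t. In degree j + 1 one factor η is set aside for the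
    -- solvability of products, the other η^j going into the algebra.
    rcases j with _ | j
    · simpa using isSolvable_smooth (N := k + 1) (R := R) hp hL hLp 0 (hc 0 w)
    · have hmem : (fun η t => η ^ j * c (j + 1) w t) * ∏ i, zh (w i) ∈ compositeAlgebra p L :=
        Subalgebra.mul_mem _ (smooth_mem_compositeAlgebra j (hc _ w))
          (Subalgebra.prod_mem _ fun i _ => hzh (w i))
      refine (isSolvable_mul_of_mem_compositeAlgebra hp hL hLp hmem).congr fun η _ t => ?_
      simp only [Pi.mul_apply, Finset.prod_apply, Finset.prod_mul_distrib, Finset.prod_const,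
        Finset.card_univ, Fintype.card_fin]
      ring
  · have hη : (fun x : ℝ × ℝ => x.1) =O[stripFilter τ] fun x => x.1 := isBigO_refl _ _
    have hη1 : (fun x : ℝ × ℝ => x.1) =O[stripFilter τ] fun _ => (1 : ℝ) := by
      simpa using isBigO_stripFilter_pow_of_le τ zero_le_one
    refine IsBigO.trans ?_ (isBigO_pow_mul_weight τ (k + 1))
    have h1 : (fun x : ℝ × ℝ => P x.2 (x.1 * u x.1 x.2) (x.1 ^ (p - L + 1) * α x.1) x.1
        - ∑ j ∈ Finset.range (k + 1), ∑ w : Fin j → Fin 3,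
          c j w x.2 * ∏ i, (x.1 * z (w i) x.1 x.2)) =O[stripFilter τ] fun x => x.1 ^ (k + 1) := by
      have hb : ∀ i, ∃ C : ℝ, ∀ᶠ x in stripFilter τ, |z i x.1 x.2| ≤ C := fun i => by
        obtain ⟨C, hC⟩ := (hz1 τ hτ i).bound
        exact ⟨C, hC.mono fun x hx => by simpa using hx⟩
      choose C hC using hb
      set D := ∑ i, |C i| + 1
      have hD0 : 0 < D := by positivity
      have hCD : ∀ i, C i ≤ D := fun i => by
        have h1 := Finset.single_le_sum (f := fun i => |C i|) (fun i _ => abs_nonneg (C i))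
          (Finset.mem_univ i)
        have h2 := le_abs_self (C i)
        linarith
      refine isBigO_stripFilter_of_le (K := M * D ^ (k + 1)) ?_
      filter_upwards [eventually_all.2 hC, eventually_stripFilter_mem τ (div_pos hr₀ hD0)]
        with x hx hx'
      have hx0 := hx'.1.1
      have hxt : x.2 ∈ Icc (-R) R := ⟨by linarith [hx'.2.1, hτ.2], by linarith [hx'.2.2, hτ.2]⟩
      have := hM x.2 hxt (fun i => x.1 * z i x.1 x.2) (D * x.1) (fun i => ?_) ?_ ?_
      · have e1 : x.1 * (x.1 ^ (p - L) * α x.1) = x.1 ^ (p - L + 1) * α x.1 := by ring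
        simpa [z, e1, mul_pow, mul_assoc] using this
      · rw [abs_mul, abs_of_pos hx0, mul_comm]
        exact mul_le_mul_of_nonneg_right ((hx i).trans (hCD i)) hx0.le
      · rw [mul_comm]
        exact (le_div_iff₀ hD0).1 hx'.1.2
      · simpa [z] using hx0.le
    have h2 : (fun x : ℝ × ℝ => ∑ j ∈ Finset.range (k + 1), ∑ w : Fin j → Fin 3,
        c j w x.2 * (∏ i, (x.1 * z (w i) x.1 x.2) - ∏ i, (x.1 * zh (w i) x.1 x.2)))
        =O[stripFilter τ] fun x => x.1 ^ (k + 1) := by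
      refine IsBigO.fun_sum fun j _ => IsBigO.fun_sum fun w _ => ?_
      have h3 : (fun x : ℝ × ℝ => ∏ i, (x.1 * z (w i) x.1 x.2) - ∏ i, (x.1 * zh (w i) x.1 x.2))
          =O[stripFilter τ] fun x => x.1 ^ (k + 1) := by
        refine isBigO_prod_sub_prod Finset.univ (fun i => ?_) (fun i => ?_) fun i => ?_
        · simpa using hη1.mul (hz1 τ hτ (w i))
        · simpa using hη1.mul (hzh1 τ hτ (w i))
        · simpa [pow_succ', mul_sub] using hη.mul (hzz τ hτ (w i))
      simpa using (isBigO_stripFilter_one_of_continuous τ (hc j w).continuous).mul h3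
    refine (h1.add h2).congr_left fun x => ?_
    simp only [mul_sub, Finset.sum_sub_distrib]
    ring

/-- Let q = p - L + 1. The vanishing conditions make the coefficient of a^j in S divisible by t^m
with m = p + 2 - qj (truncated at 0). Then η^(qj) t^m / η^(p+1) is T^m times a power of η with
exponent at least 1, and q ≥ 2 ensures m ≤ p. That power of η improves the error on α^j from η^k to
η^(k+1); the term j = 0 vanishes with S(t, 0). -/
theorem hasSolvableApproximation_parameter (hp : Odd p) (hL : Even L) (hLp : L < p)
    {S : ℝ → ℝ → ℝ} {t₀ R : ℝ} (hR : 0 < R) (hRt : R < t₀)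
    (hS : ContDiffOn ℝ ∞ (fun x : ℝ × ℝ => S x.1 x.2) (Icc (-t₀) t₀ ×ˢ univ))
    (hS0 : ∀ t ∈ Icc (-t₀) t₀, S t 0 = 0)
    (hSval : ∀ i j : ℕ, i + (p - L + 1) * j ≤ p + 1 →
      iteratedDeriv i (fun t => iteratedDeriv j (fun a => S t a) 0) 0 = 0) {α : ℝ → ℝ}
    {u : ℝ → ℝ → ℝ}
    (hα : ∀ τ ∈ Ioo 0 R, (fun x : ℝ × ℝ => α x.1) =O[stripFilter τ] fun _ => (1 : ℝ))
    {k : ℕ} (h : HasCompositeApproximation p L R α u k) :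
    HasSolvableApproximation p L R (k + 1)
      fun η t => (η ^ (p + 1))⁻¹ * S t (η ^ (p - L + 1) * α η) := by
  obtain ⟨a, v, -, hav⟩ := h
  -- Degree k + p + 1: the remainder is O(η^(k+p+2)), which is still O(η^(k+1)) after division by
  -- η^(p+1).
  obtain ⟨s, hs, hsS, M, hM0, hM⟩ := exists_taylor_second_variable hR hRt hS (k + p + 1)
  set q := p - L + 1 with hq
  have hq2 : 2 ≤ q := by omega
  have hfac : ∀ j : ℕ, ∃ σ : ℝ → ℝ, ContDiff ℝ ∞ σ ∧
      ∀ t, s (j + 1) t = t ^ (p + 2 - q * (j + 1)) * σ t := by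
    intro j
    refine exists_contDiff_eq_pow_mul (hs (j + 1)) _ fun i hi => ?_
    have hev : s (j + 1) =ᶠ[𝓝 0] fun t => iteratedDeriv (j + 1) (fun a => S t a) 0 := by
      filter_upwards [Icc_mem_nhds (neg_lt_zero.2 hR) hR] with t ht
      exact hsS (j + 1) t ht
    exact (hev.iteratedDeriv_eq i).trans (hSval i (j + 1) (by omega))
  choose σ hσ hsσ using hfac
  have hm : ∀ j : ℕ, p + 2 - q * (j + 1) ≤ p := fun j => by
    have : q ≤ q * (j + 1) := Nat.le_mul_of_pos_right q (Nat.succ_pos j)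
    omega
  have hpow : ∀ (j : ℕ) (η t : ℝ), 0 < η → (η ^ (p + 1))⁻¹ * (η ^ (q * (j + 1)) *
      t ^ (p + 2 - q * (j + 1))) = η ^ (q * (j + 1) + (p + 2 - q * (j + 1)) - (p + 1)) *
        (t / η) ^ (p + 2 - q * (j + 1)) := by
    intro j η t hη
    rw [div_pow]
    generalize hm' : p + 2 - q * (j + 1) = m
    obtain ⟨e, he⟩ : ∃ e, q * (j + 1) + m = e + (p + 1) :=
      ⟨q * (j + 1) + m - (p + 1), by omega⟩
    rw [he, Nat.add_sub_cancel]
    have : η ^ (q * (j + 1)) * η ^ m = η ^ e * η ^ (p + 1) := by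
      rw [← pow_add, ← pow_add, he]
    field_simp
    linear_combination t ^ m * this
  refine ⟨fun η t => ∑ j ∈ Finset.range (k + p + 1),
    (Polynomial.C ((j + 1).factorial : ℝ)⁻¹ * a ^ (j + 1)).eval η *
      (η ^ (q * (j + 1) + (p + 2 - q * (j + 1)) - (p + 1)) *
        (t / η) ^ (p + 2 - q * (j + 1)) * σ j t),
    IsSolvable.sum _ fun j _ => (isSolvable_pow_mul_smooth hp hL hLp (hm j) (hσ j)).polynomial_mul _,
    fun τ hτ => ?_⟩
  have ha1 := isBigO_stripFilter_polynomial τ a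
  have h1 : (fun x : ℝ × ℝ => (x.1 ^ (p + 1))⁻¹ * S x.2 (x.1 ^ q * α x.1)
      - ∑ j ∈ Finset.range (k + p + 1), ((j + 1).factorial : ℝ)⁻¹ * α x.1 ^ (j + 1) *
        (x.1 ^ (q * (j + 1) + (p + 2 - q * (j + 1)) - (p + 1)) *
          (x.2 / x.1) ^ (p + 2 - q * (j + 1)) * σ j x.2)) =O[stripFilter τ]
        fun x => x.1 ^ (k + 1) := by
    obtain ⟨C, hC0, hC⟩ := (hα τ hτ).exists_pos
    rw [IsBigOWith] at hC
    refine isBigO_stripFilter_of_le (K := M * C ^ (k + p + 2)) ?_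
    -- The restriction η ≤ 1/C puts the argument η^q α in [-1, 1], where the Taylor estimate holds.
    filter_upwards [hC, eventually_stripFilter_mem τ one_pos,
      eventually_stripFilter_mem τ (inv_pos.2 hC0)] with x hx hx' hx''
    obtain ⟨η, t⟩ := x
    simp only [Real.norm_eq_abs, abs_one, mul_one] at hx hx' hx'' ⊢
    have hη := hx'.1.1
    have ht : t ∈ Icc (-R) R := ⟨by linarith [hx'.2.1, hτ.2], by linarith [hx'.2.2, hτ.2]⟩
    have hle : |η ^ q * α η| ≤ C * η := by
      rw [abs_mul, abs_of_pos (pow_pos hη q), mul_comm]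
      exact mul_le_mul hx (pow_le_of_le_one hη.le hx'.1.2 (by omega)) (by positivity) hC0.le
    have hle1 : C * η ≤ 1 := by
      have := mul_le_mul_of_nonneg_left hx''.1.2 hC0.le
      rwa [mul_inv_cancel₀ hC0.ne'] at this
    have h2 := hM t ht _ (hle.trans hle1)
    have hs00 : s 0 t = 0 := by
      rw [hsS 0 t ht, iteratedDeriv_zero]
      exact hS0 t ⟨by linarith [ht.1], by linarith [ht.2]⟩
    rw [Finset.sum_range_succ', hs00] at h2
    simp only [mul_zero, add_zero] at h2
    have h3 : |η ^ q * α η| ^ (k + p + 1 + 1) ≤ (C * η) ^ (k + p + 1 + 1) :=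
      pow_le_pow_left₀ (abs_nonneg _) hle _
    have h4 : (η ^ (p + 1))⁻¹ * S t (η ^ q * α η)
        - ∑ j ∈ Finset.range (k + p + 1), ((j + 1).factorial : ℝ)⁻¹ * α η ^ (j + 1) *
          (η ^ (q * (j + 1) + (p + 2 - q * (j + 1)) - (p + 1)) *
            (t / η) ^ (p + 2 - q * (j + 1)) * σ j t)
        = (η ^ (p + 1))⁻¹ * (S t (η ^ q * α η) - ∑ j ∈ Finset.range (k + p + 1),
          ((j + 1).factorial : ℝ)⁻¹ * ((η ^ q * α η) ^ (j + 1) * s (j + 1) t)) := by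
      rw [mul_sub, Finset.mul_sum]
      congr 1
      refine Finset.sum_congr rfl fun j _ => ?_
      rw [hsσ j t, ← hpow j η t hη, mul_pow, ← pow_mul]
      ring
    rw [h4, abs_mul, abs_of_pos (by positivity)]
    calc _ ≤ (η ^ (p + 1))⁻¹ * (M * (C * η) ^ (k + p + 1 + 1)) := by
          gcongr
          exact h2.trans (by gcongr)
      _ = M * C ^ (k + p + 2) * η ^ (k + 1) := by
          rw [mul_pow, show k + p + 1 + 1 = (k + 1) + (p + 1) by ring, pow_add η]
          field_simp
          ring
  have h2 : (fun x : ℝ × ℝ => ∑ j ∈ Finset.range (k + p + 1),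
      ((j + 1).factorial : ℝ)⁻¹ * (α x.1 ^ (j + 1) - a.eval x.1 ^ (j + 1)) *
        (x.1 ^ (q * (j + 1) + (p + 2 - q * (j + 1)) - (p + 1)) *
          (x.2 / x.1) ^ (p + 2 - q * (j + 1)) * σ j x.2)) =O[stripFilter τ]
        fun x => x.1 ^ (k + 1) * (1 + |x.2 / x.1| ^ p) := by
    refine IsBigO.fun_sum fun j _ => ?_
    have e1 := (isBigO_pow_sub_pow (j + 1) (hα τ hτ) ha1 (hav τ hτ).1).const_mul_left
      ((j + 1).factorial : ℝ)⁻¹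
    have e2 := isBigO_stripFilter_pow_of_le τ (m := 1)
      (n := q * (j + 1) + (p + 2 - q * (j + 1)) - (p + 1)) (by omega)
    have e3 : (fun x : ℝ × ℝ => (x.2 / x.1) ^ (p + 2 - q * (j + 1))) =O[stripFilter τ]
        fun x => 1 + |x.2 / x.1| ^ p :=
      isBigO_stripFilter_of_le (K := 1) (Eventually.of_forall fun x => by
        rw [abs_pow, one_mul]
        exact abs_pow_le_one_add (hm j) _)
    have e4 := isBigO_stripFilter_one_of_continuous τ (hσ j).continuous
    refine (e1.mul ((e2.mul e3).mul e4)).congr_right fun x => ?_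
    ring
  refine ((h1.trans (isBigO_pow_mul_weight τ (k + 1))).add h2).congr_left fun x => ?_
  have : ∀ A B C : ℝ, C = B - A → ∀ s : ℝ, s - B + C = s - A := fun A B C h s => by
    rw [h]; ring
  refine this _ _ _ ?_ _
  rw [← Finset.sum_sub_distrib]
  refine Finset.sum_congr rfl fun j _ => ?_
  simp only [Polynomial.eval_mul, Polynomial.eval_C, Polynomial.eval_pow]
  ring

theorem exists_exp_neg_div_le {δ : ℝ} (hδ : 0 < δ) (n : ℕ) :
    ∃ K : ℝ, 0 ≤ K ∧ ∀ η > 0, Real.exp (-(δ / η)) ≤ K * η ^ n := by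
  refine ⟨n.factorial / δ ^ n, by positivity, fun η hη => ?_⟩
  have h := Real.pow_div_factorial_le_exp (δ / η) (by positivity) n
  rw [Real.exp_neg]
  refine (inv_anti₀ (by positivity) h).trans (le_of_eq ?_)
  rw [div_pow]
  field_simp

end Canard

/-! ### Induction on the order of approximation. -/

namespace Canard

variable {p L : ℕ}

/-- Stability is applied to w(T) = (u - v)(ηT) on |T| ≤ ρ/η with τ < ρ < R. The defect is O(η^N
(1+|T|^p)), and mere boundedness at the ends ±ρ/η is enough, their influence on |t| ≤ τ being
exponentially small. -/
theorem hasCompositeApproximation_of_forcing (hp : Odd p) (hL : Even L) (hLp : L < p) {R M : ℝ}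
    {N : ℕ} {α : ℝ → ℝ} {u F : ℝ → ℝ → ℝ}
    (hode : ∀ᶠ η in 𝓝[>] (0 : ℝ), ∃ u' : ℝ → ℝ, ∀ t ∈ Icc (-R) R, HasDerivAt (u η) (u' t) t ∧
      η * u' t = (p + 1) * (t / η) ^ p * u η t + α η * (t / η) ^ L + F η t)
    (hM : ∀ᶠ η in 𝓝[>] (0 : ℝ), ∀ t ∈ Icc (-R) R, |u η t| ≤ M)
    (hF : HasSolvableApproximation p L R N F) : HasCompositeApproximation p L R α u N := by
  obtain ⟨G, ⟨a, v, v', hv, hd, K, hK0, hK⟩, hFG⟩ := hF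
  obtain ⟨V, hV0, hV⟩ := exists_bound_of_mem_compositeAlgebra hp hL hLp
    (compositeSpan_le_compositeAlgebra hv) R
  obtain ⟨C, hC0, hC⟩ := exists_stability_constant hp hL hLp
  refine ⟨a, v, hv, fun τ hτ => ?_⟩
  have hτ0 := hτ.1
  set ρ := (τ + R) / 2 with hρ
  have hτρ : τ < ρ := by linarith [hτ.2]
  have hρR : ρ < R := by linarith [hτ.2]
  have hρ0 : 0 < ρ := hτ0.trans hτρ
  obtain ⟨D, hD0, hD⟩ := (hFG ρ ⟨hρ0, hρR⟩).exists_pos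
  rw [IsBigOWith, eventually_stripFilter] at hD
  have hδ : 0 < ρ ^ (p + 1) - τ ^ (p + 1) :=
    sub_pos.2 (pow_lt_pow_left₀ hτρ hτ0.le (Nat.succ_ne_zero p))
  obtain ⟨Q, hQ0, hQ⟩ := exists_exp_neg_div_le hδ N
  have hmain : ∀ᶠ η in 𝓝[>] (0 : ℝ),
      |α η - a.eval η| ≤ C * (K + D + (M + V) * Q) * η ^ N ∧
      ∀ t ∈ Icc (-τ) τ, |u η t - v η t| ≤ C * (K + D + (M + V) * Q) * η ^ N := by
    filter_upwards [hode, hM, hD, Ioc_mem_nhdsGT (lt_min one_pos hρ0)] with η hode hM hD hη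
    obtain ⟨u', hu'⟩ := hode
    have hη0 : 0 < η := hη.1
    have hη1 : η ≤ 1 := hη.2.trans (min_le_left _ _)
    have hηρ : η ≤ ρ := hη.2.trans (min_le_right _ _)
    have hηN : 0 ≤ η ^ N := pow_nonneg hη0.le N
    have hscale : ∀ T ∈ Icc (-(ρ / η)) (ρ / η), η * T ∈ Icc (-ρ) ρ := fun T hT => by
      have h1 := mul_le_mul_of_nonneg_left hT.1 hη0.le
      have h2 := mul_le_mul_of_nonneg_left hT.2 hη0.le
      rw [mul_neg, mul_div_cancel₀ _ hη0.ne'] at h1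
      rw [mul_div_cancel₀ _ hη0.ne'] at h2
      exact ⟨h1, h2⟩
    have hρsub : Icc (-ρ) ρ ⊆ Icc (-R) R := Icc_subset_Icc (by linarith) hρR.le
    have hw : ∀ T ∈ Icc (-(ρ / η)) (ρ / η), HasDerivAt (fun T => u η (η * T) - v η (η * T))
        (η * (u' (η * T) - v' η (η * T))) T := fun T hT => by
      have h1 := (hu' (η * T) (hρsub (hscale T hT))).1.sub (hd η hη0 (η * T))
      have h2 : HasDerivAt (fun T => η * T) η T := by simpa using (hasDerivAt_id T).const_mul η
      exact (h1.comp T h2).congr_deriv (by ring)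
    have hbd : ∀ t ∈ Icc (-ρ) ρ, |u η t - v η t| ≤ M + V := fun t ht =>
      (abs_sub _ _).trans (add_le_add (hM t (hρsub ht)) (hV η ⟨hη0, hη1⟩ t (hρsub ht)))
    have hMV : 0 ≤ M + V := (abs_nonneg _).trans (hbd 0 ⟨by linarith, hρ0.le⟩)
    have hres : ∀ T ∈ Icc (-(ρ / η)) (ρ / η),
        |η * (u' (η * T) - v' η (η * T)) - (p + 1) * T ^ p * (u η (η * T) - v η (η * T))
          - (α η - a.eval η) * T ^ L| ≤ (K + D) * η ^ N * (1 + |T| ^ p) := by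
      intro T hT
      have hT' := hscale T hT
      have h1 := hK η ⟨hη0, hη1⟩ (η * T) (hρsub hT')
      have h2 := hD (η * T) hT'
      have h3 := (hu' (η * T) (hρsub hT')).2
      have hpos : 0 ≤ η ^ N * (1 + |T| ^ p) := by positivity
      simp only [mul_div_cancel_left₀ T hη0.ne'] at h1 h2 h3
      rw [Real.norm_eq_abs, Real.norm_of_nonneg hpos] at h2
      have h4 := (abs_add_le _ _).trans (add_le_add h2 ((abs_neg _).trans_le h1))
      refine le_trans (le_of_eq ?_) (h4.trans_eq (by ring))
      congr 1
      linear_combination h3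
    obtain ⟨hβ, hwb⟩ := hC (ρ / η) ((K + D) * η ^ N) (M + V) (α η - a.eval η)
      (fun T => u η (η * T) - v η (η * T)) (fun T => η * (u' (η * T) - v' η (η * T)))
      ((one_le_div hη0).2 hηρ) (by positivity) hw hres
      (by rw [mul_div_cancel₀ _ hη0.ne']; exact hbd ρ ⟨by linarith, le_rfl⟩)
      (by rw [mul_neg, mul_div_cancel₀ _ hη0.ne']; exact hbd (-ρ) ⟨le_rfl, by linarith⟩)
    have hexp : ∀ t ∈ Icc (-τ) τ,
        Real.exp ((t / η) ^ (p + 1) - (ρ / η) ^ (p + 1)) ≤ Q * η ^ N := by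
      intro t ht
      refine le_trans (Real.exp_le_exp.2 ?_) (hQ η hη0)
      have h1 : t ^ (p + 1) ≤ τ ^ (p + 1) := by
        rw [← hp.add_one.pow_abs]
        exact pow_le_pow_left₀ (abs_nonneg t) (abs_le.2 ht) _
      -- The exponent is of size η^(-(p+1)); the weaker rate 1/η already beats every power of η.
      have h2 : η ^ (p + 1) ≤ η := pow_le_of_le_one hη0.le hη1 (Nat.succ_ne_zero p)
      have h3 : (ρ ^ (p + 1) - τ ^ (p + 1)) / η ≤ (ρ ^ (p + 1) - t ^ (p + 1)) / η ^ (p + 1) :=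
        div_le_div₀ (by linarith) (by linarith) (by positivity) h2
      rw [div_pow, div_pow, ← sub_div, ← neg_sub (ρ ^ (p + 1)), neg_div]
      exact neg_le_neg h3
    have hfin : ∀ E : ℝ, E ≤ Q * η ^ N →
        C * ((K + D) * η ^ N + (M + V) * E) ≤ C * (K + D + (M + V) * Q) * η ^ N := by
      intro E hE
      have := mul_le_mul_of_nonneg_left hE hMV
      rw [mul_assoc]
      refine mul_le_mul_of_nonneg_left ?_ hC0
      linarith
    constructor
    · refine hβ.trans (hfin _ ?_)
      simpa using hexp 0 ⟨by linarith, hτ0.le⟩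
    · intro t ht
      have htρ : t / η ∈ Icc (-(ρ / η)) (ρ / η) := by
        rw [← neg_div]
        exact ⟨div_le_div_of_nonneg_right (by linarith [ht.1]) hη0.le,
          div_le_div_of_nonneg_right (by linarith [ht.2]) hη0.le⟩
      have := hwb (t / η) htρ
      rw [mul_div_cancel₀ _ hη0.ne'] at this
      exact this.trans (hfin _ (hexp t ht))
  exact ⟨isBigO_stripFilter_of_le (eventually_stripFilter.2 (hmain.mono fun η h t _ => h.1)),
    isBigO_stripFilter_of_le (eventually_stripFilter.2 (hmain.mono fun η h => h.2))⟩

theorem IsCanardSolution.hasCompositeApproximation (hp : Odd p) (hL : Even L) (hLp : L < p)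
    {t₀ R η₀ : ℝ} (hR : 0 < R) (hRt : R < t₀) (hη₀ : 0 < η₀) {S : ℝ → ℝ → ℝ}
    {P : ℝ → ℝ → ℝ → ℝ → ℝ}
    (hS : ContDiffOn ℝ ∞ (fun x : ℝ × ℝ => S x.1 x.2) (Icc (-t₀) t₀ ×ˢ univ))
    (hS0 : ∀ t ∈ Icc (-t₀) t₀, S t 0 = 0)
    (hSval : ∀ i j : ℕ, i + (p - L + 1) * j ≤ p + 1 →
      iteratedDeriv i (fun t => iteratedDeriv j (fun a => S t a) 0) 0 = 0)
    (hP : ContDiffOn ℝ ∞ (fun x : ℝ × ℝ × ℝ × ℝ => P x.1 x.2.1 x.2.2.1 x.2.2.2)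
      (Icc (-t₀) t₀ ×ˢ univ ×ˢ univ ×ˢ Ico 0 η₀)) {α : ℝ → ℝ} {u : ℝ → ℝ → ℝ}
    (hu : IsCanardSolution p L t₀ S P α u) (k : ℕ) : HasCompositeApproximation p L R α u k := by
  obtain ⟨M, hM⟩ := hu.bounded
  have hsub : Icc (-R) R ⊆ Icc (-t₀) t₀ := Icc_subset_Icc (by linarith) hRt.le
  have hbα : ∀ τ ∈ Ioo 0 R, (fun x : ℝ × ℝ => α x.1) =O[stripFilter τ] fun _ => (1 : ℝ) :=
    fun τ _ => isBigO_stripFilter_of_le (K := M) (eventually_stripFilter.2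
      (hM.mono fun η h t _ => by simpa using h.1))
  have hbu : ∀ τ ∈ Ioo 0 R, (fun x : ℝ × ℝ => u x.1 x.2) =O[stripFilter τ] fun _ => (1 : ℝ) :=
    fun τ hτ => isBigO_stripFilter_of_le (K := M) (eventually_stripFilter.2
      (hM.mono fun η h t ht => by
        simpa using h.2 t (hsub (Icc_subset_Icc (neg_le_neg hτ.2.le) hτ.2.le ht))))
  induction k with
  | zero =>
    refine ⟨0, 0, Submodule.zero_mem _, fun τ hτ => ⟨?_, ?_⟩⟩
    · simpa using hbα τ hτ
    · simpa using hbu τ hτ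
  | succ k ih =>
    refine hasCompositeApproximation_of_forcing hp hL hLp (M := M)
      (F := fun η t => P t (η * u η t) (η ^ (p - L + 1) * α η) η
        + (η ^ (p + 1))⁻¹ * S t (η ^ (p - L + 1) * α η)) ?_
      (hM.mono fun η h t ht => h.2 t (hsub ht))
      ((hasSolvableApproximation_nonlinear hp hL hLp hR hRt hη₀ hP hbα hbu ih).add
        (hasSolvableApproximation_parameter hp hL hLp hR hRt hS hS0 hSval hbα ih))
    filter_upwards [hu.solution, self_mem_nhdsWithin] with η ⟨u', hu'⟩ hη
    have hη0 : η ≠ 0 := ne_of_gt hη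
    refine ⟨u', fun t ht => ⟨(hu' t (hsub ht)).1.hasDerivAt
      (Icc_mem_nhds (by linarith [ht.1]) (by linarith [ht.2])), ?_⟩⟩
    have h := (hu' t (hsub ht)).2
    have e1 : η ^ (p + 1) * (t / η) ^ p = η * t ^ p := by
      rw [div_pow, pow_succ]
      field_simp
    have e2 : η ^ (p + 1) * (t / η) ^ L = η ^ (p - L + 1) * t ^ L := by
      rw [div_pow, show p + 1 = (p - L + 1) + L by omega, pow_add]
      field_simp
    have e3 : η ^ (p + 1) * (η ^ (p + 1))⁻¹ = 1 := mul_inv_cancel₀ (pow_ne_zero _ hη0)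
    -- The equation in T is (2) divided by η^(p+1), so it is checked after multiplying back.
    refine mul_left_cancel₀ (pow_ne_zero (p + 1) hη0) ?_
    linear_combination h - (p + 1) * u η t * e1 - α η * e2
      - S t (η ^ (p - L + 1) * α η) * e3

/-! ### Composite expansions -/

/-- The partial sum of a composite expansion. -/
noncomputable def compositeSum (g φ : ℕ → ℝ → ℝ) (k : ℕ) (η t : ℝ) : ℝ :=
  ∑ n ∈ Finset.range k, η ^ n * (g n t + φ n (t / η))

theorem exists_eq_compositeSum {v : ℝ → ℝ → ℝ} (hv : v ∈ compositeSpan p L) :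
    ∃ g φ : ℕ → ℝ → ℝ, (∀ n, ContDiff ℝ ∞ (g n)) ∧ (∀ n, φ n ∈ bracketSpan p L n) ∧
      ∃ k₀ : ℕ, ∀ k ≥ k₀, v = compositeSum g φ k := by
  classical
  induction hv using Submodule.span_induction with
  | mem f h =>
    rcases h with ⟨n, g, hg, rfl⟩ | ⟨n, φ, hφ, rfl⟩
    · refine ⟨fun m => if m = n then g else 0, 0, fun m => ?_, fun m => Submodule.zero_mem _,
        n + 1, fun k hk => ?_⟩
      · dsimp only
        split_ifs
        · exact hg
        · exact contDiff_const
      · ext η t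
        rw [compositeSum, Finset.sum_eq_single n]
        · simp
        · intro m _ hm
          simp [hm]
        · intro h
          exact absurd (Finset.mem_range.2 hk) h
    · refine ⟨0, fun m => if m = n then φ else 0, fun m => contDiff_const, fun m => ?_,
        n + 1, fun k hk => ?_⟩
      · dsimp only
        split_ifs with h
        · exact h ▸ hφ
        · exact Submodule.zero_mem _
      · ext η t
        rw [compositeSum, Finset.sum_eq_single n]
        · simp
        · intro m _ hm
          simp [hm]
        · intro h
          exact absurd (Finset.mem_range.2 hk) h
  | zero =>
    exact ⟨0, 0, fun n => contDiff_const, fun n => Submodule.zero_mem _, 0, fun k _ => by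
      ext; simp [compositeSum]⟩
  | add v w _ _ hv hw =>
    obtain ⟨g, φ, hg, hφ, k, hk⟩ := hv
    obtain ⟨h, θ, hh, hθ, l, hl⟩ := hw
    refine ⟨fun n => g n + h n, fun n => φ n + θ n, fun n => (hg n).add (hh n),
      fun n => Submodule.add_mem _ (hφ n) (hθ n), max k l, fun m hm => ?_⟩
    rw [hk m (le_of_max_le_left hm), hl m (le_of_max_le_right hm)]
    ext η t
    simp only [compositeSum, Pi.add_apply, ← Finset.sum_add_distrib]
    exact Finset.sum_congr rfl fun n _ => by ring
  | smul r v _ hv =>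
    obtain ⟨g, φ, hg, hφ, k, hk⟩ := hv
    refine ⟨fun n => r • g n, fun n => r • φ n, fun n => contDiff_const.smul (hg n),
      fun n => Submodule.smul_mem _ r (hφ n), k, fun m hm => ?_⟩
    rw [hk m hm]
    ext η t
    simp only [compositeSum, Pi.smul_apply, smul_eq_mul, Finset.mul_sum]
    exact Finset.sum_congr rfl fun n _ => by ring

theorem isBigO_compositeSum_sub (hp : Odd p) (hL : Even L) (hLp : L < p) (τ : ℝ)
    {g φ : ℕ → ℝ → ℝ} (hg : ∀ n, Continuous (g n)) (hφ : ∀ n, φ n ∈ bracketSpan p L n) {k l : ℕ}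
    (hkl : k ≤ l) : (fun x : ℝ × ℝ => compositeSum g φ l x.1 x.2 - compositeSum g φ k x.1 x.2)
      =O[stripFilter τ] fun x => x.1 ^ k := by
  simp only [compositeSum, ← Finset.sum_range_add_sum_Ico _ hkl, add_sub_cancel_left]
  refine IsBigO.fun_sum fun n hn => ?_
  obtain ⟨K, hK⟩ := exists_bound_of_mem_bracketSpan hp hL hLp (hφ n)
  have h1 : (fun x : ℝ × ℝ => φ n (x.2 / x.1)) =O[stripFilter τ] fun _ => (1 : ℝ) :=
    isBigO_stripFilter_of_le (K := K) (Eventually.of_forall fun x => by simpa using hK _)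
  simpa using (isBigO_stripFilter_pow_of_le τ (Finset.mem_Ico.1 hn).1).mul
    ((isBigO_stripFilter_one_of_continuous τ (hg n)).add h1)

theorem compositeSum_succ' (g φ : ℕ → ℝ → ℝ) (k : ℕ) (η t : ℝ) :
    compositeSum g φ (k + 1) η t = g 0 t + φ 0 (t / η)
      + η * compositeSum (fun n => g (n + 1)) (fun n => φ (n + 1)) k η t := by
  rw [compositeSum, Finset.sum_range_succ', compositeSum, Finset.mul_sum, add_comm]
  congr 1
  · simp
  · exact Finset.sum_congr rfl fun n _ => by ring

/-- The leading term g₀(t) + φ₀(t/η) tends to 0 uniformly. For fixed t ≠ 0 the bracket part tends to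
0, so g₀(t) = 0, and g₀(0) = 0 by continuity. Along t = ηT with T fixed this gives φ₀(T) = 0.
Division by η then lowers k. -/
theorem eq_zero_of_isBigO_compositeSum {τ : ℝ} (hτ : 0 < τ) {g φ : ℕ → ℝ → ℝ} {k : ℕ}
    (hg : ∀ n, Continuous (g n)) (hφ : ∀ n, ∃ K, ∀ T, |φ n T| ≤ K)
    (hφ' : ∀ n, Tendsto (φ n) (atBot ⊔ atTop) (𝓝 0))
    (h : (fun x : ℝ × ℝ => compositeSum g φ k x.1 x.2) =O[stripFilter τ] fun x => x.1 ^ k) :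
    ∀ n < k, (∀ t ∈ Icc (-τ) τ, g n t = 0) ∧ φ n = 0 := by
  induction k generalizing g φ with
  | zero => intro n hn; omega
  | succ k ih =>
    have hη0 : Tendsto (fun x : ℝ × ℝ => x.1) (stripFilter τ) (𝓝 0) :=
      tendsto_fst.mono_right nhdsWithin_le_nhds
    have hlim : Tendsto (fun x : ℝ × ℝ => g 0 x.2 + φ 0 (x.2 / x.1)) (stripFilter τ) (𝓝 0) := by
      have h1 : Tendsto (fun x : ℝ × ℝ => compositeSum g φ (k + 1) x.1 x.2) (stripFilter τ)
          (𝓝 0) := by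
        refine h.trans_tendsto ?_
        simpa using hη0.pow (k + 1)
      have h2 : (fun x : ℝ × ℝ => compositeSum (fun n => g (n + 1)) (fun n => φ (n + 1)) k x.1 x.2)
          =O[stripFilter τ] fun _ => (1 : ℝ) := by
        refine IsBigO.fun_sum fun n _ => ?_
        obtain ⟨K, hK⟩ := hφ (n + 1)
        have h3 : (fun x : ℝ × ℝ => φ (n + 1) (x.2 / x.1)) =O[stripFilter τ] fun _ => (1 : ℝ) :=
          isBigO_stripFilter_of_le (K := K) (Eventually.of_forall fun x => by simpa using hK _)
        simpa using (isBigO_stripFilter_pow_of_le τ (Nat.zero_le n)).mul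
          ((isBigO_stripFilter_one_of_continuous τ (hg (n + 1))).add h3)
      have h4 := ((isBigO_refl (fun x : ℝ × ℝ => x.1) (stripFilter τ)).mul h2).trans_tendsto
        (by simpa using hη0)
      have := h1.sub h4
      rw [sub_zero] at this
      refine this.congr fun x => ?_
      rw [compositeSum_succ']
      ring
    have hg0 : ∀ t ∈ Icc (-τ) τ, t ≠ 0 → g 0 t = 0 := by
      intro t ht ht0
      have hmap : Tendsto (fun η : ℝ => (η, t)) (𝓝[>] 0) (stripFilter τ) :=
        tendsto_id.prodMk (tendsto_principal.2 (Eventually.of_forall fun _ => ht))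
      have h1 := hlim.comp hmap
      have h2 : Tendsto (fun η : ℝ => t / η) (𝓝[>] 0) (atBot ⊔ atTop) := by
        simp only [div_eq_mul_inv]
        rcases lt_or_gt_of_ne ht0 with ht0 | ht0
        · exact (tendsto_inv_nhdsGT_zero.const_mul_atTop_of_neg ht0).mono_right le_sup_left
        · exact (tendsto_inv_nhdsGT_zero.const_mul_atTop ht0).mono_right le_sup_right
      have h3 := ((hφ' 0).comp h2).const_add (g 0 t)
      rw [add_zero] at h3
      exact tendsto_nhds_unique h3 h1
    have hg0' : ∀ t ∈ Icc (-τ) τ, g 0 t = 0 := by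
      intro t ht
      rcases eq_or_ne t 0 with rfl | ht0
      · have h1 : Tendsto (g 0) (𝓝[>] 0) (𝓝 (g 0 0)) := (hg 0).continuousAt.tendsto.mono_left
          nhdsWithin_le_nhds
        refine tendsto_nhds_unique h1 (tendsto_const_nhds.congr' ?_)
        filter_upwards [Ioc_mem_nhdsGT hτ] with t ht
        exact (hg0 t ⟨by linarith [ht.1], ht.2⟩ (ne_of_gt ht.1)).symm
      · exact hg0 t ht ht0
    have hφ0 : φ 0 = 0 := by
      ext T
      have hev : ∀ᶠ η in 𝓝[>] (0 : ℝ), 0 < η ∧ η * T ∈ Icc (-τ) τ := by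
        have h1 : Tendsto (fun η : ℝ => η * T) (𝓝[>] 0) (𝓝 0) := by
          have : Tendsto (fun η : ℝ => η * T) (𝓝 0) (𝓝 (0 * T)) := tendsto_id.mul_const T
          rw [zero_mul] at this
          exact this.mono_left nhdsWithin_le_nhds
        exact (eventually_mem_nhdsWithin (s := Ioi (0 : ℝ))).and
          (h1.eventually (Icc_mem_nhds (neg_lt_zero.2 hτ) hτ))
      have hmap : Tendsto (fun η : ℝ => (η, η * T)) (𝓝[>] 0) (stripFilter τ) :=
        tendsto_id.prodMk (tendsto_principal.2 (hev.mono fun _ h => h.2))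
      refine tendsto_nhds_unique (tendsto_const_nhds.congr' ?_) (hlim.comp hmap)
      filter_upwards [hev] with η hη
      simp only [Function.comp]
      rw [hg0' _ hη.2, zero_add, mul_div_cancel_left₀ T hη.1.ne']
    have hrec : (fun x : ℝ × ℝ => compositeSum (fun n => g (n + 1)) (fun n => φ (n + 1)) k x.1 x.2)
        =O[stripFilter τ] fun x => x.1 ^ k := by
      have h1 := (isBigO_refl (fun x : ℝ × ℝ => x.1⁻¹) (stripFilter τ)).mul h
      refine h1.congr' ?_ ?_
      · filter_upwards [eventually_stripFilter_mem τ one_pos] with x hx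
        rw [compositeSum_succ', hg0' x.2 hx.2, hφ0, Pi.zero_apply, add_zero, zero_add,
          inv_mul_cancel_left₀ hx.1.1.ne']
      · filter_upwards [eventually_stripFilter_mem τ one_pos] with x hx
        rw [pow_succ', inv_mul_cancel_left₀ hx.1.1.ne']
    have := ih (fun n => hg (n + 1)) (fun n => hφ (n + 1)) (fun n => hφ' (n + 1)) hrec
    rintro (_ | n) hn
    · exact ⟨hg0', hφ0⟩
    · exact this n (by omega)

theorem eq_of_isBigO_sub_compositeSum (hp : Odd p) (hL : Even L) (hLp : L < p) {τ : ℝ} (hτ : 0 < τ)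
    {u : ℝ → ℝ → ℝ} {g h φ θ : ℕ → ℝ → ℝ} {k l : ℕ} (hkl : k ≤ l)
    (hg : ∀ n, Continuous (g n)) (hh : ∀ n, Continuous (h n))
    (hφ : ∀ n, φ n ∈ bracketSpan p L n) (hθ : ∀ n, θ n ∈ bracketSpan p L n)
    (h₁ : (fun x : ℝ × ℝ => u x.1 x.2 - compositeSum g φ k x.1 x.2)
      =O[stripFilter τ] fun x => x.1 ^ k)
    (h₂ : (fun x : ℝ × ℝ => u x.1 x.2 - compositeSum h θ l x.1 x.2)
      =O[stripFilter τ] fun x => x.1 ^ l) :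
    ∀ n < k, (∀ t ∈ Icc (-τ) τ, g n t = h n t) ∧ φ n = θ n := by
  have h3 := ((h₂.trans (isBigO_stripFilter_pow_of_le τ hkl)).add
    (isBigO_compositeSum_sub hp hL hLp τ hh hθ hkl)).sub h₁
  have h4 : (fun x : ℝ × ℝ => compositeSum (fun n => g n - h n) (fun n => φ n - θ n) k x.1 x.2)
      =O[stripFilter τ] fun x => x.1 ^ k := by
    refine h3.congr_left fun x => ?_
    have : compositeSum (fun n => g n - h n) (fun n => φ n - θ n) k x.1 x.2
        = compositeSum g φ k x.1 x.2 - compositeSum h θ k x.1 x.2 := by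
      simp only [compositeSum, ← Finset.sum_sub_distrib]
      exact Finset.sum_congr rfl fun n _ => by simp only [Pi.sub_apply]; ring
    rw [this]
    ring
  have hmem : ∀ n, φ n - θ n ∈ bracketSpan p L n := fun n => Submodule.sub_mem _ (hφ n) (hθ n)
  intro n hn
  obtain ⟨e1, e2⟩ := eq_zero_of_isBigO_compositeSum hτ (fun n => (hg n).sub (hh n))
    (fun n => exists_bound_of_mem_bracketSpan hp hL hLp (hmem n)) (fun n => (hmem n).2.tendsto)
    h4 n hn
  exact ⟨fun t ht => sub_eq_zero.1 (e1 t ht), sub_eq_zero.1 e2⟩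

/-- If a family has composite approximations to every order, these fit into one expansion. -/
theorem exists_composite_expansion (hp : Odd p) (hL : Even L) (hLp : L < p) {τ : ℝ} (hτ : 0 < τ)
    {u : ℝ → ℝ → ℝ} (h : ∀ k : ℕ, ∃ v ∈ compositeSpan p L,
      (fun x : ℝ × ℝ => u x.1 x.2 - v x.1 x.2) =O[stripFilter τ] fun x => x.1 ^ k) :
    ∃ g φ : ℕ → ℝ → ℝ, (∀ n, ContDiff ℝ ∞ (g n)) ∧ (∀ n, φ n ∈ bracketSpan p L n) ∧
      ∀ k, (fun x : ℝ × ℝ => u x.1 x.2 - compositeSum g φ k x.1 x.2)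
        =O[stripFilter τ] fun x => x.1 ^ k := by
  have h' : ∀ k : ℕ, ∃ g φ : ℕ → ℝ → ℝ, (∀ n, ContDiff ℝ ∞ (g n)) ∧
      (∀ n, φ n ∈ bracketSpan p L n) ∧
      (fun x : ℝ × ℝ => u x.1 x.2 - compositeSum g φ k x.1 x.2)
        =O[stripFilter τ] fun x => x.1 ^ k := by
    intro k
    obtain ⟨v, hv, hk⟩ := h k
    obtain ⟨g, φ, hg, hφ, k₀, hk₀⟩ := exists_eq_compositeSum hv
    refine ⟨g, φ, hg, hφ, (hk.add (isBigO_compositeSum_sub hp hL hLp τ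
      (fun n => (hg n).continuous) hφ (le_max_right k₀ k))).congr_left fun x => ?_⟩
    rw [hk₀ _ (le_max_left k₀ k)]
    ring
  choose g φ hg hφ hk using h'
  -- Diagonal choice: n + 1 is the first order of approximation that determines the coefficient of
  -- index n, and uniqueness identifies it with that of every later one.
  refine ⟨fun n => g (n + 1) n, fun n => φ (n + 1) n, fun n => hg (n + 1) n,
    fun n => hφ (n + 1) n, fun k => (hk k).congr' ?_ EventuallyEq.rfl⟩
  filter_upwards [eventually_stripFilter_mem τ one_pos] with x hx
  congr 1
  refine Finset.sum_congr rfl fun n hn => ?_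
  obtain ⟨e1, e2⟩ := eq_of_isBigO_sub_compositeSum hp hL hLp hτ (Finset.mem_range.1 hn)
    (fun m => (hg (n + 1) m).continuous) (fun m => (hg k m).continuous) (hφ (n + 1)) (hφ k)
    (hk (n + 1)) (hk k) n (Nat.lt_succ_self n)
  dsimp only
  rw [e1 x.2 hx.2, e2]

/-- A polynomial in η is a composite sum with constant smooth parts and zero brackets, so the
uniqueness of composite coefficients applies, read at t = 0. -/
theorem exists_polynomial_expansion (hp : Odd p) (hL : Even L) (hLp : L < p) {τ : ℝ} (hτ : 0 < τ)
    {α : ℝ → ℝ} (h : ∀ k : ℕ, ∃ a : Polynomial ℝ,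
      (fun x : ℝ × ℝ => α x.1 - a.eval x.1) =O[stripFilter τ] fun x => x.1 ^ k) :
    ∃ b : ℕ → ℝ, ∀ k, (fun x : ℝ × ℝ => α x.1 - ∑ n ∈ Finset.range k, b n * x.1 ^ n)
      =O[stripFilter τ] fun x => x.1 ^ k := by
  choose a ha using h
  have hsum : ∀ k, (fun x : ℝ × ℝ => α x.1
      - compositeSum (fun n _ => (a k).coeff n) 0 k x.1 x.2) =O[stripFilter τ] fun x => x.1 ^ k := by
    intro k
    refine ((ha k).add (isBigO_compositeSum_sub (g := fun n _ => (a k).coeff n) (φ := 0) hp hL hLp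
      τ (fun _ => continuous_const) (fun _ => Submodule.zero_mem _)
      (le_max_right ((a k).natDegree + 1) k))).congr_left fun x => ?_
    have : compositeSum (fun n _ => (a k).coeff n) 0 (max ((a k).natDegree + 1) k) x.1 x.2
        = (a k).eval x.1 := by
      rw [Polynomial.eval_eq_sum_range' (Nat.lt_of_succ_le (le_max_left _ k))]
      exact Finset.sum_congr rfl fun n _ => by simp [mul_comm]
    rw [this]
    ring
  refine ⟨fun n => (a (n + 1)).coeff n, fun k => (hsum k).congr_left fun x => ?_⟩
  congr 1
  refine Finset.sum_congr rfl fun n hn => ?_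
  have e := (eq_of_isBigO_sub_compositeSum (u := fun η _ => α η) hp hL hLp hτ
    (Finset.mem_range.1 hn) (fun _ => continuous_const) (fun _ => continuous_const)
    (fun _ => Submodule.zero_mem _) (fun _ => Submodule.zero_mem _)
    (hsum (n + 1)) (hsum k) n (Nat.lt_succ_self n)).1 0 ⟨neg_nonpos.2 hτ.le, hτ.le⟩
  simp [e, mul_comm]

end Canard

/-! ### The expansion as an element of the projective limit. -/

namespace Canard

variable {p L : ℕ}

/-- The element of the projective limit with prescribed components. -/
noncomputable def ALim.mk {t₁ : ℝ} (b : ℕ → ℝ) (g : ℕ → Smooth t₁) (r : ∀ n, B p L n →₀ ℝ) :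
    ALim p L t₁ :=
  ⟨fun _ l => (b l, g l, r l), fun _ => rfl⟩

theorem exists_finsupp_of_mem_bracketSpan (hp : Odd p) (hL : Even L) (hLp : L < p) {n : ℕ}
    {φ : ℝ → ℝ} (hφ : φ ∈ bracketSpan p L n) :
    ∃ r : B p L n →₀ ℝ, ∀ T, r.sum (fun θ c => c * θ.1 T) = φ T := by
  have h := bracketSpan_le_span hp hL hLp n hφ
  rw [← Subtype.range_coe (s := B p L n), Finsupp.mem_span_range_iff_exists_finsupp] at h
  obtain ⟨r, hr⟩ := h
  refine ⟨r, fun T => ?_⟩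
  rw [← hr, Finsupp.sum, Finsupp.sum, Finset.sum_apply]
  rfl

theorem hasSemiAsymptoticExpansion_mk {t₁ : ℝ} (ht₁ : 0 < t₁) {α : ℝ → ℝ} {u : ℝ → ℝ → ℝ}
    {b : ℕ → ℝ} {g φ : ℕ → ℝ → ℝ} {G : ℕ → Smooth t₁} {r : ∀ n, B p L n →₀ ℝ}
    (hG : ∀ n t, (G n).1 t = g n t) (hr : ∀ n T, (r n).sum (fun θ c => c * θ.1 T) = φ n T)
    (hα : ∀ k, (fun x : ℝ × ℝ => α x.1 - ∑ n ∈ Finset.range k, b n * x.1 ^ n)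
      =O[stripFilter t₁] fun x => x.1 ^ k)
    (hu : ∀ k, (fun x : ℝ × ℝ => u x.1 x.2 - compositeSum g φ k x.1 x.2)
      =O[stripFilter t₁] fun x => x.1 ^ k) :
    HasSemiAsymptoticExpansion α u (ALim.mk b G r) := by
  intro k
  have hα' : ∀ η, evalParam ((ALim.mk b G r).1 k) η = ∑ n ∈ Finset.range (k + 1), b n * η ^ n :=
    fun η => Fin.sum_univ_eq_sum_range (fun n => b n * η ^ n) (k + 1)
  have hu' : ∀ η t, evalFun ((ALim.mk b G r).1 k) η t = compositeSum g φ (k + 1) η t := by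
    intro η t
    refine (Finset.sum_congr rfl fun l _ => ?_).trans
      (Fin.sum_univ_eq_sum_range (fun n => η ^ n * (g n t + φ n (t / η))) (k + 1))
    rw [← hr, ← hG, mul_comm]
    rfl
  constructor
  · obtain ⟨K, hK⟩ := (hα (k + 1)).bound
    rw [eventually_stripFilter] at hK
    refine ⟨K, ?_⟩
    filter_upwards [hK, self_mem_nhdsWithin] with η h hη
    have := h 0 ⟨neg_nonpos.2 ht₁.le, ht₁.le⟩
    rwa [hα', ← Real.norm_eq_abs, ← Real.norm_of_nonneg (pow_nonneg (le_of_lt hη) (k + 1))]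
  · obtain ⟨K, hK⟩ := (hu (k + 1)).bound
    rw [eventually_stripFilter] at hK
    refine ⟨K, ?_⟩
    filter_upwards [hK, self_mem_nhdsWithin] with η h hη t
    rw [hu', ← Real.norm_eq_abs, ← Real.norm_of_nonneg (pow_nonneg (le_of_lt hη) (k + 1))]
    exact h t t.2

end Canard

theorem proposition9 (p L : ℕ) (hp : Odd p) (hp3 : 3 ≤ p) (hL : Even L) (hLp : L < p)
    (t₀ t₁ η₀ : ℝ) (ht₁ : 0 < t₁) (ht₁₀ : t₁ < t₀) (hη₀ : 0 < η₀)
    (S : ℝ → ℝ → ℝ) (P : ℝ → ℝ → ℝ → ℝ → ℝ)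
    (hS : ContDiffOn ℝ ∞ (fun x : ℝ × ℝ => S x.1 x.2) (Icc (-t₀) t₀ ×ˢ univ))
    (hS0 : ∀ t ∈ Icc (-t₀) t₀, S t 0 = 0)
    (hSval : ∀ i j : ℕ, i + (p - L + 1) * j ≤ p + 1 →
      iteratedDeriv i (fun t => iteratedDeriv j (fun a => S t a) 0) 0 = 0)
    (hP : ContDiffOn ℝ ∞ (fun x : ℝ × ℝ × ℝ × ℝ => P x.1 x.2.1 x.2.2.1 x.2.2.2)
      (Icc (-t₀) t₀ ×ˢ univ ×ˢ univ ×ˢ Ico 0 η₀))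
    (α : ℝ → ℝ) (u : ℝ → ℝ → ℝ) (hu : Canard.IsCanardSolution p L t₀ S P α u) :
    ∃ c : Canard.ALim p L t₁, Canard.HasSemiAsymptoticExpansion α u c := by
  -- A radius strictly between t₁ and t₀: below t₀ for the cutoffs, above t₁ since estimates hold on
  -- smaller intervals only.
  have happrox := hu.hasCompositeApproximation hp hL hLp (R := (t₁ + t₀) / 2) (by linarith)
    (by linarith) hη₀ hS hS0 hSval hP
  have hτ : t₁ ∈ Ioo 0 ((t₁ + t₀) / 2) := ⟨ht₁, by linarith⟩
  obtain ⟨g, φ, hg, hφ, hk⟩ := Canard.exists_composite_expansion hp hL hLp ht₁ fun k => by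
    obtain ⟨a, v, hv, h⟩ := happrox k
    exact ⟨v, hv, (h t₁ hτ).2⟩
  obtain ⟨b, hb⟩ := Canard.exists_polynomial_expansion hp hL hLp ht₁ fun k => by
    obtain ⟨a, v, hv, h⟩ := happrox k
    exact ⟨a, (h t₁ hτ).1⟩
  choose r hr using fun n => Canard.exists_finsupp_of_mem_bracketSpan hp hL hLp (hφ n)
  exact ⟨Canard.ALim.mk b (fun n => ⟨fun t => g n t, g n, (hg n).contDiffOn, fun _ => rfl⟩) r,
    Canard.hasSemiAsymptoticExpansion_mk ht₁ (fun _ _ => rfl) hr hb hk⟩
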